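/- Let $P$ be a finite set with a reflexive and symmetric relation $\mathcal C$. A labelled heap is a finite (possibly empty) poset $(E,\le)$ with a map $\varepsilon:E\to P$ such that (1) $a,b\in E$ are comparable whenever $\varepsilon(a)\,\mathcal C\,\varepsilon(b)$, and (2) $\le$ is the transitive closure of the relation "$a\le b$ and $\varepsilon(a)\,\mathcal C\,\varepsilon(b)$". A heap is an isomorphism class of labelled heaps (isomorphisms being poset isomorphisms that preserve the labels), and $H(P,\mathcal C)$ is the set of heaps. For a vertex $a$ of $E$, let $E(a)$ be the subheap on $E\setminus\{a\}$, ordered by the transitive closure of the relation "$x\le y$ and $\varepsilon(x)\,\mathcal C\,\varepsilon(y)$" on $E\setminus\{a\}$. Write $E(a)\prec E$ if either $a$ is maximal in $E$ and some $b$ with $\varepsilon(b)\neq\varepsilon(a)$ is maximal in $E(a)$ but not in $E$, or $a$ is minimal in $E$ and some $b$ with $\varepsilon(b)\ne\varepsilon(a)$ is minimal in $E(a)$ but not in $E$. A heap $E$ has property P1 if there is a (possibly one-term) sequence of heaps $E_1\prec E_2\prec\cdots\prec E$ in which the order of $E_1$ is trivial (distinct vertices are incomparable). It has property P2 if there is no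 chain $x_1<\dots<x_t$ in $E$ with $t\in\{2,3\}$ and $\varepsilon(x_1)=\varepsilon(x_t)$ that is convex, i.e. contains every $y$ with $x_i<y<x_j$ for some $i,j$. The class $H(P,\mathcal C)$ is regular if every heap in it with property P2 has property P1. The concurrency graph $\Gamma$ has vertex set $P$, with $v,w$ joined if and only if $v\neq w$ and $v\,\mathcal C\,w$. For $p,q,r\ge 0$ let $\Gamma(p,q,r)$ be the tree on $p+q+r+1$ vertices formed by a central vertex and three disjoint paths (arms) emanating from it, having $p$, $q$ and $r$ further vertices respectively. Theorem. $H(P,\mathcal C)$ is a regular class of heaps if and only if each connected component of $\Gamma$ is isomorphic to one of the following graphs: a complete graph $K_n$ ($n\ge1$); a path $A_n$ with $n\ge 1$ vertices; $D_n=\Gamma(1,1,n-3)$ with $n\ge4$; $E_n=\Gamma(1,2,n-4)$ with $n\ge 6$ (arbitrarily large); a cycle $\widetilde A_{n-1}$ with $n$ vertices, $n\ge3$ odd; or $\widetilde E_6=\Gamma(2,2,2)$. -/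

import Mathlib

/-- A concurrency relation on a set `P` of pieces: a reflexive and symmetric binary relation. -/
structure ConcurrencyRelation (P : Type*) where
  rel : P → P → Prop
  refl : ∀ p, rel p p
  symm : ∀ p q, rel p q → rel q p

/-- The concurrency graph: `v` and `w` are joined when they are distinct and concurrent. -/
def ConcurrencyRelation.graph {P : Type*} (C : ConcurrencyRelation P) : SimpleGraph P where
  Adj v w := v ≠ w ∧ C.rel v w
  symm := ⟨fun v w h => ⟨h.1.symm, C.symm v w h.2⟩⟩
  loopless := ⟨fun _ h => h.1 rfl⟩

/-- A labelled heap with pieces in `P`: a finite poset with a labelling by pieces such that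
elements with concurrent labels are comparable, and such that the order is the transitive closure
of its restriction to the pairs with concurrent labels. -/
structure LabelledHeap {P : Type*} (C : ConcurrencyRelation P) where
  carrier : Type
  [finite : Finite carrier]
  [order : PartialOrder carrier]
  label : carrier → P
  comparable : ∀ a b, C.rel (label a) (label b) → a ≤ b ∨ b ≤ a
  le_iff : ∀ a b, a ≤ b ↔
    Relation.TransGen (fun x y => x ≤ y ∧ C.rel (label x) (label y)) a b

attribute [instance] LabelledHeap.finite LabelledHeap.order

namespace LabelledHeap

variable {P : Type*} {C : ConcurrencyRelation P}

/-- Isomorphism of labelled heaps: an isomorphism of posets that respects the labels. -/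
def Iso (E F : LabelledHeap C) : Prop :=
  ∃ φ : E.carrier ≃o F.carrier, ∀ x, F.label (φ x) = E.label x

/-- The relation `a ≤ b` and `a`, `b` have concurrent labels, restricted to a subset. -/
def subRel (E : LabelledHeap C) (S : Set E.carrier) (a b : S) : Prop :=
  (a : E.carrier) ≤ b ∧ C.rel (E.label a) (E.label b)

theorem le_of_transGen_subRel (E : LabelledHeap C) (S : Set E.carrier) {a b : S}
    (h : Relation.TransGen (E.subRel S) a b) : (a : E.carrier) ≤ b := by
  induction h with
  | single h => exact h.1
  | tail _ h ih => exact ih.trans h.1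

/-- The subheap on a set of vertices. Its order is the transitive closure of `subRel`, which may
be strictly finer than the induced order. -/
def subheap (E : LabelledHeap C) (S : Set E.carrier) : LabelledHeap C where
  carrier := S
  order :=
    { le := Relation.TransGen (E.subRel S)
      lt := fun a b => Relation.TransGen (E.subRel S) a b ∧ ¬ Relation.TransGen (E.subRel S) b a
      lt_iff_le_not_ge := fun _ _ => Iff.rfl
      le_refl := fun a => .single ⟨le_refl _, C.refl _⟩
      le_trans := fun _ _ _ h k => h.trans k
      le_antisymm := fun _ _ h k => Subtype.ext
        (le_antisymm (E.le_of_transGen_subRel S h) (E.le_of_transGen_subRel S k)) }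
  label := fun a => E.label a
  comparable := fun a b h => (E.comparable a b h).imp
    (fun k => .single ⟨k, h⟩) (fun k => .single ⟨k, C.symm _ _ h⟩)
  le_iff := fun a b => by
    constructor
    · intro h
      have h' : Relation.TransGen (E.subRel S) a b := h
      clear h
      induction h' with
      | single k => exact .single ⟨.single k, k.2⟩
      | tail _ k ih => exact ih.tail ⟨.single k, k.2⟩
    · intro h
      induction h with
      | single h => exact h.1
      | tail _ h ih => exact Relation.TransGen.trans ih h.1

/-- The subheap `E(a)` obtained by deleting the vertex `a`. -/
abbrev erase (E : LabelledHeap C) (a : E.carrier) : LabelledHeap C :=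
  E.subheap {x | x ≠ a}

/-- The order relation is trivial. -/
def IsTrivial (E : LabelledHeap C) : Prop :=
  ∀ a b : E.carrier, a ≤ b → a = b

/-- `x 0 < x 1 < ⋯ < x (t - 1)` is a convex chain of length `t`. -/
def IsConvexChain (E : LabelledHeap C) {t : ℕ} (x : Fin t → E.carrier) : Prop :=
  StrictMono x ∧ ∀ i j y, x i < y → y < x j → y ∈ Set.range x

/-- A convex chain (of length `t + 1`) whose first and last vertices have the same label. -/
def IsBalancedConvexChain (E : LabelledHeap C) {t : ℕ} (x : Fin (t + 1) → E.carrier) : Prop :=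
  E.IsConvexChain x ∧ E.label (x 0) = E.label (x (Fin.last t))

/-- Property P2: there is no balanced convex chain of length 2 or 3. -/
def HasP2 (E : LabelledHeap C) : Prop :=
  ∀ (t : ℕ) (x : Fin (t + 1) → E.carrier), E.IsBalancedConvexChain x →
    t + 1 ≠ 2 ∧ t + 1 ≠ 3

/-- The vertex `a` witnesses `E(a) ≺⁺ E`: it is maximal in `E`, and some vertex with a different
label is maximal in `E(a)` but not in `E`. -/
def PrecMax (E : LabelledHeap C) (a : E.carrier) : Prop :=
  IsMax a ∧ ∃ b : (E.erase a).carrier,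
    IsMax b ∧ ¬ IsMax (b.1 : E.carrier) ∧ E.label b.1 ≠ E.label a

/-- The vertex `a` witnesses `E(a) ≺⁻ E`: it is minimal in `E`, and some vertex with a different
label is minimal in `E(a)` but not in `E`. -/
def PrecMin (E : LabelledHeap C) (a : E.carrier) : Prop :=
  IsMin a ∧ ∃ b : (E.erase a).carrier,
    IsMin b ∧ ¬ IsMin (b.1 : E.carrier) ∧ E.label b.1 ≠ E.label a

theorem Iso.refl (E : LabelledHeap C) : Iso E E :=
  ⟨OrderIso.refl _, fun _ => rfl⟩

theorem Iso.symm {E F : LabelledHeap C} (h : Iso E F) : Iso F E := by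
  obtain ⟨φ, hφ⟩ := h
  exact ⟨φ.symm, fun x => by rw [← hφ, φ.apply_symm_apply]⟩

theorem Iso.trans {E F G : LabelledHeap C} (h : Iso E F) (k : Iso F G) : Iso E G := by
  obtain ⟨φ, hφ⟩ := h
  obtain ⟨ψ, hψ⟩ := k
  exact ⟨φ.trans ψ, fun x => by rw [OrderIso.trans_apply, hψ, hφ]⟩

theorem IsTrivial.of_iso {E F : LabelledHeap C} (h : Iso E F) (hE : E.IsTrivial) :
    F.IsTrivial := by
  obtain ⟨φ, _⟩ := h
  intro a b hab
  exact φ.symm.injective (hE _ _ (φ.symm.monotone hab))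

theorem HasP2.of_iso {E F : LabelledHeap C} (h : Iso E F) (hE : E.HasP2) : F.HasP2 := by
  obtain ⟨φ, hφ⟩ := h.symm
  intro t x hx
  refine hE t (fun i => φ (x i)) ⟨⟨φ.strictMono.comp hx.1.1, ?_⟩, ?_⟩
  · intro i j y hi hj
    obtain ⟨k, hk⟩ := hx.1.2 i j (φ.symm y) (by rwa [φ.lt_symm_apply])
      (by rwa [φ.symm_apply_lt])
    exact ⟨k, by simp [hk]⟩
  · simpa only [hφ] using hx.2

/-- Isomorphism of labelled heaps as an equivalence relation. -/
instance isoSetoid : Setoid (LabelledHeap C) where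
  r := Iso
  iseqv := ⟨Iso.refl, Iso.symm, Iso.trans⟩

end LabelledHeap

/-- The class `H(P, C)` of heaps: labelled heaps up to isomorphism. -/
def Heap {P : Type*} (C : ConcurrencyRelation P) :=
  Quotient (LabelledHeap.isoSetoid (C := C))

namespace Heap

variable {P : Type*} {C : ConcurrencyRelation P}

/-- The heap represented by a labelled heap. -/
def mk (E : LabelledHeap C) : Heap C := Quotient.mk _ E

/-- A trivial heap. -/
def IsTrivial : Heap C → Prop :=
  Quotient.lift LabelledHeap.IsTrivial fun _ _ h => propext
    ⟨LabelledHeap.IsTrivial.of_iso h, LabelledHeap.IsTrivial.of_iso (LabelledHeap.Iso.symm h)⟩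

/-- A heap with property P2. -/
def HasP2 : Heap C → Prop :=
  Quotient.lift LabelledHeap.HasP2 fun _ _ h => propext
    ⟨LabelledHeap.HasP2.of_iso h, LabelledHeap.HasP2.of_iso (LabelledHeap.Iso.symm h)⟩

/-- The relation `F ≺ G`: there is a vertex `a` of `G` with `F = G(a)`, and `G(a) ≺⁺ G` or
`G(a) ≺⁻ G`. -/
def Prec (F G : Heap C) : Prop :=
  ∃ (E : LabelledHeap C) (a : E.carrier),
    mk E = G ∧ mk (E.erase a) = F ∧ (E.PrecMax a ∨ E.PrecMin a)

/-- Property P1 (dismantlability): there is a possibly one-term sequence `E₁ ≺ E₂ ≺ ⋯ ≺ E` with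
`E₁` trivial. -/
def HasP1 (E : Heap C) : Prop :=
  ∃ E₁ : Heap C, E₁.IsTrivial ∧ Relation.ReflTransGen Prec E₁ E

end Heap

/-- `H(P, C)` is a regular class of heaps: every heap with property P2 has property P1. -/
def IsRegularClass {P : Type*} (C : ConcurrencyRelation P) : Prop :=
  ∀ E : Heap C, E.HasP2 → E.HasP1

/-- The graph `Γ(ℓ 0, ℓ 1, ℓ 2)`: a central vertex `none` with three disjoint paths (arms)
emanating from it, the `i`-th one having `ℓ i` vertices besides the centre. -/
def tripodGraph (ℓ : Fin 3 → ℕ) : SimpleGraph (Option (Σ i : Fin 3, Fin (ℓ i))) :=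
  SimpleGraph.fromRel fun x y =>
    match x, y with
    | none, some ⟨_, k⟩ => (k : ℕ) = 0
    | some ⟨i, k⟩, some ⟨j, l⟩ => i = j ∧ (l : ℕ) = k + 1
    | _, none => False

/-- Type `D_n` for `n ≥ 4`: the arms have lengths `1`, `1`, `n - 3`. -/
abbrev graphD (n : ℕ) := tripodGraph ![1, 1, n - 3]

/-- Type `E_n` for `n ≥ 6`: the arms have lengths `1`, `2`, `n - 4`. -/
abbrev graphE (n : ℕ) := tripodGraph ![1, 2, n - 4]

/-- The extended Dynkin diagram of type `E_6`, with 7 vertices: three arms of length `2`. -/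
abbrev graphAffineE6 := tripodGraph ![2, 2, 2]

/-- A graph is isomorphic to one of: `K_n`; type `A_n` (a path with `n` vertices); type `D_n` with
`n ≥ 4`; type `E_n` with `n ≥ 6`; the affine type `A_{n-1}` (a cycle with `n` vertices) with
`n ≥ 3` odd; the affine type `E_6`. -/
def IsListedGraph {V : Type*} (G : SimpleGraph V) : Prop :=
  (∃ n, 1 ≤ n ∧ Nonempty (G ≃g (⊤ : SimpleGraph (Fin n)))) ∨
  (∃ n, 1 ≤ n ∧ Nonempty (G ≃g SimpleGraph.pathGraph n)) ∨
  (∃ n, 4 ≤ n ∧ Nonempty (G ≃g graphD n)) ∨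
  (∃ n, 6 ≤ n ∧ Nonempty (G ≃g graphE n)) ∨
  (∃ n, 3 ≤ n ∧ Odd n ∧ Nonempty (G ≃g SimpleGraph.cycleGraph n)) ∨
  Nonempty (G ≃g graphAffineE6)

/-! Deleting a maximal or minimal vertex preserves P2. So if every heap with P2 that admits no
reduction step `≺` is trivial, the class is regular (`isRegularClass_of_forall`); conversely, a
nontrivial heap with P2 admitting no step destroys regularity (`HasP2.not_isRegularClass`). The
theorem thus asks which graphs label a nontrivial irreducible heap with P2.

Listed components. Such a heap is a reduced poset: between two occurrences of a label there are two
vertices with adjacent labels, and no maximal vertex is the only neighbour above a vertex below it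
(dually for minimal ones). On a tripod, call the interval between consecutive occurrences of the
centre a gap. Every gap contains at least two arms. If some arm occurs in all gaps and carries a
maximal and a minimal vertex, both can be pushed to the end of the arm, where they coincide: a
contradiction (`false_of_arm`). For arms of lengths 1, at most 2 and arbitrary, the third arm has
these properties (`false_of_short_arms`); paths are the case of at most two arms
(`false_of_two_arms`), and `Γ(2,2,2)` is treated by comparing adjacent gaps (`false_of_all_two`). On
an odd cycle, maximality of the last occurrence of a label passes two labels further, hence reaches
an adjacent label (`CycleLabels.false_of_full`). On a clique the poset is a chain. Labels that do
not occur cut the graph into smaller cases.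

Other components. Explicit words give irreducible heaps: two forks joined by a non-backtracking walk
(`false_of_forks`), an even cycle (`false_of_even_cycle`), and one word each for `Γ(1,3,3)` and
`Γ(2,2,3)`. Forks force a graph with a triangle to be complete, and a triangle-free one to have at
most one branch vertex, of degree three. What survives is exactly the list
(`WordFree.isListedGraph`). -/

/-- An abstract form of an irreducible heap with property P2: a poset labelled by the vertices
of a graph, with the two local consequences of P2 and irreducibility at both ends. -/
structure IsReducedPoset {P α : Type*} (G : SimpleGraph P) [PartialOrder α] (lab : α → P) :
    Prop where
  comp : ∀ x y, (lab x = lab y ∨ G.Adj (lab x) (lab y)) → x ≤ y ∨ y ≤ x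
  fc : ∀ x y, x < y → lab x = lab y → ∃ k l, k ≠ l ∧ (x < k ∧ k < y) ∧ (x < l ∧ l < y) ∧
    G.Adj (lab x) (lab k) ∧ G.Adj (lab x) (lab l)
  up : ∀ a b, IsMax a → b < a → ∃ z, z ≠ a ∧ b < z ∧ G.Adj (lab b) (lab z)
  above : ∀ a b, b < a → ∃ z, b < z ∧ G.Adj (lab b) (lab z)
  down : ∀ a b, IsMin a → a < b → ∃ z, z ≠ a ∧ z < b ∧ G.Adj (lab b) (lab z)
  below : ∀ a b, a < b → ∃ z, z < b ∧ G.Adj (lab b) (lab z)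

/-- A tripod-shaped set of labels, closed under adjacency inside the support of a labelling. -/
structure TripodLabels {P α : Type*} (G : SimpleGraph P) (lab : α → P) (c : P)
    (a : Fin 3 → ℕ → P) (ℓ : Fin 3 → ℕ) : Prop where
  zero : ∀ i, a i 0 = c
  adj : ∀ i k, k < ℓ i → G.Adj (a i k) (a i (k + 1))
  nbr_center : ∀ x, G.Adj c (lab x) → ∃ i, 0 < ℓ i ∧ lab x = a i 1
  nbr : ∀ i k x, k + 1 ≤ ℓ i → G.Adj (a i (k + 1)) (lab x) →
    lab x = a i k ∨ (k + 1 < ℓ i ∧ lab x = a i (k + 2))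

/-! ### Reduced posets: duality and consecutive occurrences of a label -/

namespace IsReducedPoset

variable {P α : Type*} {G : SimpleGraph P} [PartialOrder α] {lab : α → P}

/-- The axioms are self-dual, so every result on maximal vertices or on what lies above also holds
for minimal vertices and below. -/
theorem dual (h : IsReducedPoset G lab) :
    IsReducedPoset G (α := αᵒᵈ) (fun x => lab (OrderDual.ofDual x)) where
  comp x y e := (h.comp (OrderDual.ofDual x) (OrderDual.ofDual y) e).symm
  fc x y hxy e := by
    obtain ⟨k, l, hkl, hk, hl, ak, al⟩ := h.fc (OrderDual.ofDual y) (OrderDual.ofDual x) hxy e.symm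
    exact ⟨OrderDual.toDual k, OrderDual.toDual l, hkl, ⟨hk.2, hk.1⟩, ⟨hl.2, hl.1⟩,
      by simpa [e] using ak, by simpa [e] using al⟩
  up a b ha hb := h.down (OrderDual.ofDual a) (OrderDual.ofDual b) ha hb
  above a b hb := h.below (OrderDual.ofDual a) (OrderDual.ofDual b) hb
  down a b ha hb := h.up (OrderDual.ofDual a) (OrderDual.ofDual b) ha hb
  below a b hb := h.above (OrderDual.ofDual a) (OrderDual.ofDual b) hb

theorem le_of_isMax (h : IsReducedPoset G lab) {x m : α} (hm : IsMax m)
    (e : lab x = lab m ∨ G.Adj (lab x) (lab m)) : x ≤ m :=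
  (h.comp x m e).elim id fun k => hm k

theorem lt_of_isMax (h : IsReducedPoset G lab) {x m : α} (hm : IsMax m)
    (e : G.Adj (lab x) (lab m)) : x < m :=
  lt_of_le_of_ne (h.le_of_isMax hm (.inr e)) fun k => G.ne_of_adj e (by rw [k])

theorem lt_or_lt (h : IsReducedPoset G lab) {x y : α} (hne : x ≠ y) (e : lab x = lab y) :
    x < y ∨ y < x :=
  (h.comp x y (.inl e)).imp (lt_of_le_of_ne · hne) (lt_of_le_of_ne · hne.symm)

theorem lt_or_lt_of_adj (h : IsReducedPoset G lab) {x y : α} (e : G.Adj (lab x) (lab y)) :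
    x < y ∨ y < x :=
  (h.comp x y (.inr e)).imp (lt_of_le_of_ne · fun k => G.ne_of_adj e (by rw [k]))
    (lt_of_le_of_ne · fun k => G.ne_of_adj e (by rw [k]))

theorem exists_top [Finite α] (h : IsReducedPoset G lab) {s : P} (hs : ∃ x, lab x = s) :
    ∃ m, lab m = s ∧ ∀ y, lab y = s → y ≤ m := by
  obtain ⟨m, hm⟩ := (Set.toFinite {x | lab x = s}).exists_maximal hs
  exact ⟨m, hm.1, fun y hy => (h.comp y m (.inl (hy.trans hm.1.symm))).elim id
    fun k => hm.2 hy k⟩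

theorem exists_next [Finite α] (_h : IsReducedPoset G lab) {x y : α} (hxy : x < y)
    (e : lab x = lab y) :
    ∃ y', x < y' ∧ y' ≤ y ∧ lab y' = lab x ∧ ∀ z, x < z → z < y' → lab z ≠ lab x := by
  obtain ⟨m, hm⟩ := (Set.toFinite {w | x < w ∧ w ≤ y ∧ lab w = lab x}).exists_minimal
    ⟨y, hxy, le_rfl, e.symm⟩
  exact ⟨m, hm.1.1, hm.1.2.1, hm.1.2.2, fun z hz hzm k =>
    hzm.not_ge (hm.2 ⟨hz, hzm.le.trans hm.1.2.1, k⟩ hzm.le)⟩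

theorem exists_prev [Finite α] (h : IsReducedPoset G lab) {x y : α} (hxy : x < y)
    (e : lab x = lab y) :
    ∃ x', x ≤ x' ∧ x' < y ∧ lab x' = lab y ∧ ∀ z, x' < z → z < y → lab z ≠ lab y := by
  obtain ⟨y', h1, h2, h3, h4⟩ := h.dual.exists_next (x := OrderDual.toDual y)
    (y := OrderDual.toDual x) hxy e.symm
  exact ⟨OrderDual.ofDual y', h2, h1, h3, fun z hz hz' => h4 (OrderDual.toDual z) hz' hz⟩

end IsReducedPoset

/-! ### Arms of a tripod: gaps between centres and maximal vertices -/

namespace TripodLabels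

variable {P α : Type*} {G : SimpleGraph P} {lab : α → P} {c : P}
  {a : Fin 3 → ℕ → P} {ℓ : Fin 3 → ℕ}

theorem dual (T : TripodLabels G lab c a ℓ) :
    TripodLabels G (α := αᵒᵈ) (fun x => lab (OrderDual.ofDual x)) c a ℓ :=
  ⟨T.zero, T.adj, fun x => T.nbr_center (OrderDual.ofDual x),
    fun i k x => T.nbr i k (OrderDual.ofDual x)⟩

theorem adj_center (T : TripodLabels G lab c a ℓ) {i : Fin 3} (hi : 0 < ℓ i) :
    G.Adj c (a i 1) := by
  have := T.adj i 0 hi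
  rwa [T.zero] at this

variable [PartialOrder α]

/-- Between two vertices on an arm with the same label there is one with the next label
towards the centre. -/
theorem exists_between [Finite α] (h : IsReducedPoset G lab) (T : TripodLabels G lab c a ℓ)
    {i : Fin 3} {k : ℕ} {x y : α} (hk : k + 1 ≤ ℓ i) (hxy : x < y) (hx : lab x = a i (k + 1))
    (hy : lab y = a i (k + 1)) : ∃ z, x < z ∧ z < y ∧ lab z = a i k := by
  -- Induction from the end of the arm inwards. If the inner label is absent, both neighbours
  -- between consecutive occurrences carry the outer label, and by induction they enclose a further
  -- occurrence.
  induction hd : ℓ i - k using Nat.strong_induction_on generalizing k x y with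
  | _ d ih =>
  by_contra! hn
  obtain ⟨y', h1, h2, h3, h4⟩ := h.exists_next hxy (hx.trans hy.symm)
  obtain ⟨p, q, hpq, hp, hq, ap, aq⟩ := h.fc x y' h1 h3.symm
  rw [hx] at ap aq h4
  have key : ∀ z, x < z → z < y' → G.Adj (a i (k + 1)) (lab z) →
      k + 1 < ℓ i ∧ lab z = a i (k + 2) := fun z z1 z2 z3 =>
    (T.nbr i k z hk z3).resolve_left (hn z z1 (z2.trans_le h2))
  obtain ⟨kl, ep⟩ := key p hp.1 hp.2 ap
  obtain ⟨-, eq⟩ := key q hq.1 hq.2 aq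
  rcases h.lt_or_lt hpq (ep.trans eq.symm) with l | l
  · obtain ⟨z, z1, z2, z3⟩ := ih (ℓ i - (k + 1)) (by omega) (k := k + 1) kl l ep eq rfl
    exact h4 z (hp.1.trans z1) (z2.trans hq.2) z3
  · obtain ⟨z, z1, z2, z3⟩ := ih (ℓ i - (k + 1)) (by omega) (k := k + 1) kl l eq ep rfl
    exact h4 z (hq.1.trans z1) (z2.trans hp.2) z3

theorem exists_center_between [Finite α] (h : IsReducedPoset G lab)
    (T : TripodLabels G lab c a ℓ) {i : Fin 3} {x y : α} (hi : 0 < ℓ i) (hxy : x < y)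
    (hx : lab x = a i 1) (hy : lab y = a i 1) : ∃ z, x < z ∧ z < y ∧ lab z = c := by
  obtain ⟨z, h1, h2, h3⟩ := exists_between h T (k := 0) hi hxy hx hy
  exact ⟨z, h1, h2, h3.trans (T.zero i)⟩

/-- If two vertices on an arm have the same label and no vertex between them has the next label
away from the centre, then between them there are two consecutive occurrences of the centre with
no occurrence of the first label of the arm in between. -/
theorem exists_skip [Finite α] (h : IsReducedPoset G lab) (T : TripodLabels G lab c a ℓ)
    {i : Fin 3} {k : ℕ} {x y : α} (hi : 0 < ℓ i) (hk : k ≤ ℓ i) (hxy : x < y)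
    (hx : lab x = a i k) (hy : lab y = a i k)
    (hn : k < ℓ i → ∀ z, x < z → z < y → lab z ≠ a i (k + 1)) :
    ∃ p q, x ≤ p ∧ p < q ∧ q ≤ y ∧ lab p = c ∧ lab q = c ∧ (∀ z, p < z → z < q → lab z ≠ c) ∧
      ∀ z, p < z → z < q → lab z ≠ a i 1 := by
  -- Here the induction runs towards the centre: without the outer label, both neighbours between
  -- consecutive occurrences carry the inner label, and consecutiveness is the absence hypothesis
  -- for that pair.
  induction k generalizing x y with
  | zero =>
    obtain ⟨y', h1, h2, h3, h4⟩ := h.exists_next hxy (hx.trans hy.symm)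
    rw [hx, T.zero] at h3 h4
    exact ⟨x, y', le_rfl, h1, h2, hx.trans (T.zero i), h3, h4,
      fun z z1 z2 => hn hi z z1 (z2.trans_le h2)⟩
  | succ k ih =>
    obtain ⟨y', h1, h2, h3, h4⟩ := h.exists_next hxy (hx.trans hy.symm)
    obtain ⟨p, q, hpq, hp, hq, ap, aq⟩ := h.fc x y' h1 h3.symm
    rw [hx] at ap aq h4
    have key : ∀ z, x < z → z < y' → G.Adj (a i (k + 1)) (lab z) → lab z = a i k :=
      fun z z1 z2 z3 => (T.nbr i k z hk z3).resolve_right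
        fun e => hn e.1 z z1 (z2.trans_le h2) e.2
    have ep := key p hp.1 hp.2 ap
    have eq := key q hq.1 hq.2 aq
    rcases h.lt_or_lt hpq (ep.trans eq.symm) with l | l
    · obtain ⟨r, s, k1, k2, k3, k4⟩ := ih (by omega) l ep eq fun _ z z1 z2 =>
        h4 z (hp.1.trans z1) (z2.trans hq.2)
      exact ⟨r, s, hp.1.le.trans k1, k2, k3.trans (hq.2.le.trans h2), k4⟩
    · obtain ⟨r, s, k1, k2, k3, k4⟩ := ih (by omega) l eq ep fun _ z z1 z2 =>
        h4 z (hq.1.trans z1) (z2.trans hp.2)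
      exact ⟨r, s, hq.1.le.trans k1, k2, k3.trans (hp.2.le.trans h2), k4⟩

/-- Between two consecutive occurrences of the centre at least two arms occur. -/
theorem exists_arms_between [Finite α] (h : IsReducedPoset G lab) (T : TripodLabels G lab c a ℓ)
    {x y : α} (hxy : x < y) (hx : lab x = c) (hy : lab y = c)
    (hn : ∀ z, x < z → z < y → lab z ≠ c) :
    ∃ i j p q, i ≠ j ∧ 0 < ℓ i ∧ 0 < ℓ j ∧ (x < p ∧ p < y ∧ lab p = a i 1) ∧
      (x < q ∧ q < y ∧ lab q = a j 1) := by
  obtain ⟨p, q, hpq, hp, hq, ap, aq⟩ := h.fc x y hxy (hx.trans hy.symm)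
  rw [hx] at ap aq
  obtain ⟨i, hi, ei⟩ := T.nbr_center p ap
  obtain ⟨j, hj, ej⟩ := T.nbr_center q aq
  refine ⟨i, j, p, q, ?_, hi, hj, ⟨hp.1, hp.2, ei⟩, ⟨hq.1, hq.2, ej⟩⟩
  rintro rfl
  rcases h.lt_or_lt hpq (ei.trans ej.symm) with l | l
  · obtain ⟨z, z1, z2, z3⟩ := exists_center_between h T hi l ei ej
    exact hn z (hp.1.trans z1) (z2.trans hq.2) z3
  · obtain ⟨z, z1, z2, z3⟩ := exists_center_between h T hi l ej ei
    exact hn z (hq.1.trans z1) (z2.trans hp.2) z3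

/-- A last occurrence of a label on an arm lying above all occurrences of the previous label is
maximal. -/
theorem isMax_of_forall_lt [Finite α] (h : IsReducedPoset G lab) (T : TripodLabels G lab c a ℓ)
    {i : Fin 3} {k : ℕ} {m : α} (hk : k + 1 ≤ ℓ i) (hm : lab m = a i (k + 1))
    (ht : ∀ y, lab y = a i (k + 1) → y ≤ m) (hb : ∀ y, lab y = a i k → y < m) : IsMax m := by
  induction hd : ℓ i - k using Nat.strong_induction_on generalizing k m with
  | _ d ih =>
  by_contra hmax
  obtain ⟨b, hmb⟩ := not_isMax_iff.1 hmax
  obtain ⟨z, z1, z2⟩ := h.above b m hmb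
  rw [hm] at z2
  rcases T.nbr i k z hk z2 with e | ⟨kl, e⟩
  · exact (hb z e).not_gt z1
  obtain ⟨m2, e2, t2⟩ := h.exists_top ⟨z, e⟩
  have hm2 : m < m2 := z1.trans_le (t2 z e)
  have mx := ih (ℓ i - (k + 1)) (by omega) (k := k + 1) kl e2 t2
    (fun y hy => (ht y hy).trans_lt hm2) rfl
  -- Irreducibility at `m2` gives a second neighbour `w` above `m`, again of the outer label.
  -- Between `w` and `m2` the label of `m` would recur above its last occurrence.
  obtain ⟨w, w1, w2, w3⟩ := h.up m2 m mx hm2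
  rw [hm] at w3
  rcases T.nbr i k w hk w3 with e' | ⟨-, e'⟩
  · exact (hb w e').not_gt w2
  obtain ⟨v, v1, v2, v3⟩ := exists_between h T (k := k + 1) kl (lt_of_le_of_ne (t2 w e') w1) e' e2
  exact (ht v v3).not_gt (w2.trans v1)

/-- Above a last occurrence of the centre that is not maximal, at least two arms occur. -/
theorem exists_arms_above [Finite α] (h : IsReducedPoset G lab) (T : TripodLabels G lab c a ℓ)
    {m : α} (hm : lab m = c) (ht : ∀ y, lab y = c → y ≤ m) (hmax : ¬ IsMax m) :
    ∃ i j p q, i ≠ j ∧ 0 < ℓ i ∧ 0 < ℓ j ∧ (m < p ∧ IsMax p ∧ lab p = a i 1) ∧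
      (m < q ∧ IsMax q ∧ lab q = a j 1) := by
  have key : ∀ z i, m < z → 0 < ℓ i → lab z = a i 1 → IsMax z := by
    intro z i hz hi e
    obtain ⟨p, e1, t1⟩ := h.exists_top ⟨z, e⟩
    have : z = p := by
      by_contra hne
      obtain ⟨v, v1, -, v3⟩ := exists_center_between h T hi (lt_of_le_of_ne (t1 z e) hne) e e1
      exact (ht v v3).not_gt (hz.trans v1)
    subst this
    exact isMax_of_forall_lt h T (k := 0) hi e1 t1
      fun y hy => (ht y (hy.trans (T.zero i))).trans_lt hz
  obtain ⟨b, hmb⟩ := not_isMax_iff.1 hmax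
  obtain ⟨p, p1, p2⟩ := h.above b m hmb
  rw [hm] at p2
  obtain ⟨i, hi, ei⟩ := T.nbr_center p p2
  have mp := key p i p1 hi ei
  obtain ⟨q, q1, q2, q3⟩ := h.up p m mp p1
  rw [hm] at q3
  obtain ⟨j, hj, ej⟩ := T.nbr_center q q3
  refine ⟨i, j, p, q, ?_, hi, hj, ⟨p1, mp, ei⟩, ⟨q2, key q j q2 hj ej, ej⟩⟩
  rintro rfl
  exact q1 (le_antisymm (h.le_of_isMax mp (.inl (ej.trans ei.symm)))
    (h.le_of_isMax (key q i q2 hj ej) (.inl (ei.trans ej.symm))))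

/-- If an arm occurs between any two consecutive occurrences of the centre and some vertex on it
is maximal, then its end occurs as a maximal vertex. -/
theorem exists_isMax_end [Finite α] (h : IsReducedPoset G lab) (T : TripodLabels G lab c a ℓ)
    (hs : ∀ i k, k ≤ ℓ i → ∃ x, lab x = a i k) {i : Fin 3} (hi : 0 < ℓ i)
    (hV : ∀ x y, x < y → lab x = c → lab y = c → (∀ z, x < z → z < y → lab z ≠ c) →
      ∃ z, x < z ∧ z < y ∧ lab z = a i 1)
    {k : ℕ} (hk : k ≤ ℓ i) {m : α} (hm : lab m = a i k) (mx : IsMax m) :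
    ∃ e, lab e = a i (ℓ i) ∧ IsMax e := by
  induction hd : ℓ i - k using Nat.strong_induction_on generalizing k m with
  | _ d ih =>
  rcases hk.eq_or_lt with rfl | hlt
  · exact ⟨m, hm, mx⟩
  obtain ⟨b, eb, tb⟩ := h.exists_top (hs i (k + 1) hlt)
  have hbm : b < m := h.lt_of_isMax mx (by rw [eb, hm]; exact (T.adj i k hlt).symm)
  -- Maximality moves outwards two labels at a time. If `z` had the label of `m`, no outer label
  -- would lie between `z` and `m`, and `exists_skip` would produce a gap without this arm.
  obtain ⟨z, z1, z2, z3⟩ := h.up m b mx hbm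
  rw [eb] at z3
  rcases T.nbr i k z hlt z3 with e | ⟨kl, e⟩
  · exfalso
    have hzm : z < m := lt_of_le_of_ne (h.le_of_isMax mx (.inl (e.trans hm.symm))) z1
    obtain ⟨p, q, -, p2, -, p4, p5, p6, p7⟩ := exists_skip h T hi hk hzm e hm
      fun _ w w1 _ we => (tb w we).not_gt (z2.trans w1)
    obtain ⟨v, v1, v2, v3⟩ := hV p q p2 p4 p5 p6
    exact p7 v v1 v2 v3
  · obtain ⟨m2, e2, t2⟩ := h.exists_top ⟨z, e⟩
    exact ih (ℓ i - (k + 2)) (by omega) (k := k + 2) kl e2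
      (isMax_of_forall_lt h T (k := k + 1) kl e2 t2
        fun y hy => (tb y hy).trans_lt (z2.trans_le (t2 z e))) rfl

/-- The end label occurs at a maximal and at a minimal vertex. These coincide, since two occurrences
of the end label would force a gap without the arm. A vertex both maximal and minimal is comparable
to no other, yet the label before the end occurs. -/
theorem false_of_arm [Finite α] (h : IsReducedPoset G lab) (T : TripodLabels G lab c a ℓ)
    (hs : ∀ i k, k ≤ ℓ i → ∃ x, lab x = a i k) {i : Fin 3} (hi : 0 < ℓ i)
    (hV : ∀ x y, x < y → lab x = c → lab y = c → (∀ z, x < z → z < y → lab z ≠ c) →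
      ∃ z, x < z ∧ z < y ∧ lab z = a i 1)
    (hmax : ∃ k m, k ≤ ℓ i ∧ lab m = a i k ∧ IsMax m)
    (hmin : ∃ k m, k ≤ ℓ i ∧ lab m = a i k ∧ IsMin m) : False := by
  obtain ⟨k, m, hk, em, mm⟩ := hmax
  obtain ⟨e, e1, e2⟩ := exists_isMax_end h T hs hi hV hk em mm
  obtain ⟨k, m, hk, em, mm⟩ := hmin
  obtain ⟨f, f1, f2⟩ := exists_isMax_end h.dual T.dual (fun i k hk => hs i k hk) hi
    (fun x y hxy hx hy hn => by
      obtain ⟨z, z1, z2, z3⟩ := hV (OrderDual.ofDual y) (OrderDual.ofDual x) hxy hy hx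
        fun z z1 z2 => hn (OrderDual.toDual z) z2 z1
      exact ⟨OrderDual.toDual z, z2, z1, z3⟩) hk (m := OrderDual.toDual m) em mm
  have hfe : OrderDual.ofDual f = e := by
    by_contra hne
    have hlt : OrderDual.ofDual f < e :=
      lt_of_le_of_ne (h.le_of_isMax e2 (.inl (f1.trans e1.symm))) hne
    -- Beyond the end of the arm there is no outer label, so the absence hypothesis is vacuous.
    obtain ⟨p, q, -, p2, -, p4, p5, p6, p7⟩ := exists_skip h T hi le_rfl hlt f1 e1
      fun k => absurd k (lt_irrefl _)
    obtain ⟨v, v1, v2, v3⟩ := hV p q p2 p4 p5 p6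
    exact p7 v v1 v2 v3
  have e3 : IsMin e := by rw [← hfe]; exact f2
  obtain ⟨n, hn⟩ : ∃ n, ℓ i = n + 1 := ⟨ℓ i - 1, by omega⟩
  obtain ⟨x, hx⟩ := hs i n (by omega)
  have hadj : G.Adj (lab x) (lab e) := by
    rw [hx, e1, hn]; exact T.adj i n (by omega)
  rcases h.lt_or_lt_of_adj hadj with l | l
  · exact e3.not_lt l
  · exact e2.not_lt l

end TripodLabels

/-! ### Short arms: no adjacent labels in a reduced poset on an admissible tripod -/

namespace TripodLabels

variable {P α : Type*} {G : SimpleGraph P} {lab : α → P} {c : P}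
  {a : Fin 3 → ℕ → P} {ℓ : Fin 3 → ℕ}

/-- Restriction of tripod labels to the part of an arm beyond a label which does not occur. -/
theorem recenter (T : TripodLabels G lab c a ℓ) {i : Fin 3} {k : ℕ} (hk : k + 1 ≤ ℓ i)
    (hno : ∀ x, lab x ≠ a i k) :
    TripodLabels G lab (a i (k + 1)) (fun j n => if j = 2 then a i (k + 1 + n) else a i (k + 1))
      (fun j => if j = 2 then ℓ i - (k + 1) else 0) := by
  refine ⟨fun j => by simp, fun j n hn => ?_, fun x hx => ⟨2, ?_⟩, fun j n x hn hx => ?_⟩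
  · split_ifs at hn ⊢ with hj
    · exact T.adj i _ (by omega)
    · omega
  · obtain ⟨k1, k2⟩ := (T.nbr i k x hk hx).resolve_left (hno x)
    simp only [if_true]
    exact ⟨by omega, k2⟩
  · split_ifs at hn hx ⊢ with hj
    · have := T.nbr i (k + 1 + n) x (by omega) hx
      exact this.imp id fun e => ⟨by omega, e.2⟩
    · omega

variable [PartialOrder α]

/-- Two occurrences of the first label of an arm which are separated by only one occurrence of
the centre. -/
theorem separated_once [Finite α] (h : IsReducedPoset G lab) (T : TripodLabels G lab c a ℓ)
    {i : Fin 3} (hi : 0 < ℓ i) {p q y : α} (hpq : p < q) (hp : lab p = a i 1) (hq : lab q = a i 1)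
    (hc : ∀ z, p < z → z < q → lab z = c → z = y) :
    (∀ z, p < z → z < q → lab z ≠ a i 1) ∧ ∃ s, p < s ∧ s < q ∧ 1 < ℓ i ∧ lab s = a i 2 := by
  constructor
  · intro z z1 z2 ez
    obtain ⟨v, v1, v2, v3⟩ := exists_center_between h T hi z1 hp ez
    obtain ⟨w, w1, w2, w3⟩ := exists_center_between h T hi z2 ez hq
    exact (v2.trans w1).ne ((hc v v1 (v2.trans z2) v3).trans (hc w (z1.trans w1) w2 w3).symm)
  -- At most one of the two neighbours is a centre, so the other lies further out on the arm.
  · obtain ⟨k, l, hkl, hk, hl, ak, al⟩ := h.fc p q hpq (hp.trans hq.symm)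
    rw [hp] at ak al
    rcases T.nbr i 0 k hi ak with ek | ⟨i1, ek⟩
    · rcases T.nbr i 0 l hi al with el | ⟨i1, el⟩
      · rw [T.zero] at ek el
        exact absurd ((hc k hk.1 hk.2 ek).trans (hc l hl.1 hl.2 el).symm) hkl
      · exact ⟨l, hl.1, hl.2, i1, el⟩
    · exact ⟨k, hk.1, hk.2, i1, ek⟩

/-- On a short arm, a maximal occurrence of the first label is not separated from another
occurrence by a single occurrence of the centre. -/
theorem false_of_isMax_of_separated_once [Finite α] (h : IsReducedPoset G lab)
    (T : TripodLabels G lab c a ℓ) {i : Fin 3} (hi : 0 < ℓ i) (hi2 : ℓ i ≤ 2) {p q y : α}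
    (hpq : p < q) (hp : lab p = a i 1) (hq : lab q = a i 1)
    (hc : ∀ z, p < z → z < q → lab z = c → z = y) (mq : IsMax q) : False := by
  obtain ⟨h1, s, s1, s2, s3, s4⟩ := separated_once h T hi hpq hp hq hc
  -- Here `s` carries the end label, whose only possible neighbour is the first label; a second such
  -- vertex above `s` would fall strictly between `p` and `q`.
  obtain ⟨z, z1, z2, z3⟩ := h.up q s mq s2
  rw [s4] at z3
  rcases T.nbr i 1 z s3 z3 with e | ⟨k, -⟩
  · exact h1 z (s1.trans z2) (lt_of_le_of_ne (h.le_of_isMax mq (.inl (e.trans hq.symm))) z1) e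
  · omega

/-- If three vertices on a short arm with the first label are consecutively separated by single
occurrences of the centre, we get a contradiction. -/
theorem false_of_separated_once_twice [Finite α] (h : IsReducedPoset G lab)
    (T : TripodLabels G lab c a ℓ) {i : Fin 3} (hi : 0 < ℓ i) (hi2 : ℓ i ≤ 2) {p q r x y : α}
    (hpq : p < q) (hqr : q < r) (hp : lab p = a i 1) (hq : lab q = a i 1) (hr : lab r = a i 1)
    (hc : ∀ z, p < z → z < q → lab z = c → z = x)
    (hc' : ∀ z, q < z → z < r → lab z = c → z = y) : False := by
  obtain ⟨h1, s, s1, s2, s3, s4⟩ := separated_once h T hi hpq hp hq hc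
  obtain ⟨h1', s', s1', s2', s3', s4'⟩ := separated_once h T hi hqr hq hr hc'
  -- Between the end labels `s` and `s'` the first label occurs only at `q`, whereas two neighbours
  -- are required.
  obtain ⟨k, l, hkl, hk, hl, ak, al⟩ := h.fc s s' (s2.trans s1') (s4.trans s4'.symm)
  rw [s4] at ak al
  have key : ∀ z, s < z → z < s' → G.Adj (a i 2) (lab z) → z = q := by
    intro z z1 z2 z3
    by_contra hne
    rcases T.nbr i 1 z s3 z3 with e | ⟨k, -⟩
    · rcases h.lt_or_lt hne (e.trans hq.symm) with l | l
      · exact h1 z (s1.trans z1) l e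
      · exact h1' z l (z2.trans s2') e
    · omega
  exact hkl ((key k hk.1 hk.2 ak).trans (key l hl.1 hl.2 al).symm)

theorem eq_of_consecutive (h : IsReducedPoset G lab) {x y z w : α} (hy : lab y = c)
    (h1 : ∀ z, x < z → z < y → lab z ≠ c) (h2 : ∀ z, y < z → z < w → lab z ≠ c)
    (hxz : x < z) (hzw : z < w) (hz : lab z = c) : z = y := by
  by_contra hne
  rcases h.lt_or_lt hne (hz.trans hy.symm) with l | l
  · exact h1 z hxz l hz
  · exact h2 z l hzw hz

/-- If two consecutive occurrences of the centre are separated by the first two arms only, then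
the upper one is followed by a further occurrence of the centre, separated by the second arm. -/
theorem exists_next_gap [Finite α] (h : IsReducedPoset G lab) (T : TripodLabels G lab c a ℓ)
    {u t v : Fin 3} (huv : ∀ i, i = u ∨ i = t ∨ i = v) (hu : ℓ u = 1) (ht : 0 < ℓ t)
    (ht2 : ℓ t ≤ 2) {x y p q : α} (hy : lab y = c)
    (hn : ∀ z, x < z → z < y → lab z ≠ c) (hp : x < p ∧ p < y ∧ lab p = a u 1)
    (hq : x < q ∧ q < y ∧ lab q = a t 1) :
    ∃ y' r, lab y' = c ∧ (∀ z, y < z → z < y' → lab z ≠ c) ∧ y < r ∧ r < y' ∧ lab r = a t 1 := by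
  -- An arm of length one cannot occur on both sides of a single centre: `separated_once` would need
  -- a second label on it.
  have noU : ∀ w p', (∀ z, y < z → z < w → lab z ≠ c) → y < p' → p' ≤ w → lab p' ≠ a u 1 := by
    intro w p' hw h1 h2 e
    obtain ⟨-, s, -, -, s3, -⟩ := separated_once h T (hu ▸ one_pos) (hp.2.1.trans h1) hp.2.2 e
      (y := y) fun z z1 z2 z3 =>
        eq_of_consecutive h hy hn hw (hp.1.trans z1) (z2.trans_le h2) z3
    omega
  -- Suppose `y` is the last centre. It is not maximal, since `p` has no neighbour above it other
  -- than `y`. Above it two distinct arms have maximal first labels, but `u` and `t` are both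
  -- barred, leaving only `v`.
  by_cases htop : ∀ z, lab z = c → z ≤ y
  · exfalso
    have htop' : ∀ w z, y < z → z < w → lab z ≠ c := fun w z z1 _ z3 => (htop z z3).not_gt z1
    by_cases hmax : IsMax y
    · obtain ⟨z, z1, z2, z3⟩ := h.up y p hmax hp.2.1
      rw [hp.2.2] at z3
      rcases T.nbr u 0 z (by omega) z3 with e | ⟨k, -⟩
      · rw [T.zero] at e
        exact hn z (hp.1.trans z2) (lt_of_le_of_ne (htop z e) z1) e
      · omega
    · obtain ⟨i, j, p', q', hij, hi, hj, h1, h2⟩ := exists_arms_above h T hy htop hmax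
      have key : ∀ i p', y < p' → IsMax p' → lab p' = a i 1 → i = v := by
        intro i p' k1 k2 k3
        rcases huv i with rfl | rfl | rfl
        · exact absurd k3 (noU p' p' (htop' _) k1 le_rfl)
        · exact (false_of_isMax_of_separated_once h T ht ht2 (hq.2.1.trans k1) hq.2.2 k3 (y := y)
            (fun z z1 z2 z3 => eq_of_consecutive h hy hn (htop' _) (hq.1.trans z1) z2 z3) k2).elim
        · rfl
      exact hij ((key i p' h1.1 h1.2.1 h1.2.2).trans (key j q' h2.1 h2.2.1 h2.2.2).symm)
  · push Not at htop
    obtain ⟨w, w1, w2⟩ := htop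
    have hyw : y < w := (h.lt_or_lt (fun e => w2 e.le) (w1.trans hy.symm)).resolve_left
      fun l => w2 l.le
    obtain ⟨y', k1, -, k3, k4⟩ := h.exists_next hyw (hy.trans w1.symm)
    rw [hy] at k3 k4
    obtain ⟨i, j, p', q', hij, hi, hj, h1, h2⟩ := exists_arms_between h T k1 hy k3 k4
    have key : ∀ i p', y < p' → p' < y' → lab p' = a i 1 → i = t ∨ i = v := by
      intro i p' l1 l2 l3
      rcases huv i with rfl | h | h
      · exact absurd l3 (noU y' p' k4 l1 l2.le)
      · exact .inl h
      · exact .inr h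
    rcases key i p' h1.1 h1.2.1 h1.2.2 with rfl | e1
    · exact ⟨y', p', k3, k4, h1⟩
    rcases key j q' h2.1 h2.2.1 h2.2.2 with rfl | e2
    · exact ⟨y', q', k3, k4, h2⟩
    exact absurd (e1.trans e2.symm) hij

/-- In the setting of arms of lengths `1`, at most `2` and arbitrary, the third arm occurs between
any two consecutive occurrences of the centre. -/
theorem third_arm_between [Finite α] (h : IsReducedPoset G lab) (T : TripodLabels G lab c a ℓ)
    {u t v : Fin 3} (huv : ∀ i, i = u ∨ i = t ∨ i = v) (hu : ℓ u = 1) (ht : 0 < ℓ t)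
    (ht2 : ℓ t ≤ 2) {x y : α} (hxy : x < y) (hx : lab x = c) (hy : lab y = c)
    (hn : ∀ z, x < z → z < y → lab z ≠ c) : ∃ z, x < z ∧ z < y ∧ lab z = a v 1 := by
  by_contra! hv
  obtain ⟨i, j, p, q, hij, hi, hj, hp, hq⟩ := exists_arms_between h T hxy hx hy hn
  obtain ⟨p, q, hp, hq⟩ : ∃ p q, (x < p ∧ p < y ∧ lab p = a u 1) ∧
      (x < q ∧ q < y ∧ lab q = a t 1) := by
    rcases huv i with rfl | rfl | rfl
    · rcases huv j with rfl | rfl | rfl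
      · exact absurd rfl hij
      · exact ⟨p, q, hp, hq⟩
      · exact absurd hq.2.2 (hv q hq.1 hq.2.1)
    · rcases huv j with rfl | rfl | rfl
      · exact ⟨q, p, hq, hp⟩
      · exact absurd rfl hij
      · exact absurd hq.2.2 (hv q hq.1 hq.2.1)
    · exact absurd hp.2.2 (hv p hp.1 hp.2.1)
  -- A gap containing `u` and `t` forces `t` into the gap above and, by duality, into the gap below:
  -- three first labels of `t` separated by single centres.
  obtain ⟨y', r, k1, k2, k3, k4, k5⟩ := exists_next_gap h T huv hu ht ht2 hy hn hp hq
  obtain ⟨x', s, l1, l2, l3, l4, l5⟩ := exists_next_gap h.dual T.dual huv hu ht ht2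
    (x := OrderDual.toDual y) (y := OrderDual.toDual x) (p := OrderDual.toDual p)
    (q := OrderDual.toDual q) hx (fun z z1 z2 => hn (OrderDual.ofDual z) z2 z1)
    ⟨hp.2.1, hp.1, hp.2.2⟩ ⟨hq.2.1, hq.1, hq.2.2⟩
  have l3' : OrderDual.ofDual s < x := l3
  have l4' : OrderDual.ofDual x' < OrderDual.ofDual s := l4
  exact false_of_separated_once_twice h T ht ht2 (l3'.trans hq.1) (hq.2.1.trans k3) l5 hq.2.2 k5
    (x := x) (y := y)
    (fun z z1 z2 z3 => eq_of_consecutive h hx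
      (fun z z1 z2 => l2 (OrderDual.toDual z) z2 z1) hn (l4'.trans z1) (z2.trans hq.2.1) z3)
    (fun z z1 z2 z3 => eq_of_consecutive h hy hn k2 (hq.1.trans z1) (z2.trans k4) z3)

/-- If the last centre is not maximal and only `u` and `t` have maximal first labels above it, then
neither arm can occur in the gap just below. But that gap needs two arms; so does the part below a
unique centre, by the dual of `exists_arms_above`. -/
theorem third_arm_isMax [Finite α] (h : IsReducedPoset G lab) (T : TripodLabels G lab c a ℓ)
    (hs : ∀ i k, k ≤ ℓ i → ∃ x, lab x = a i k)
    {u t v : Fin 3} (huv : ∀ i, i = u ∨ i = t ∨ i = v) (hu : ℓ u = 1) (ht : 0 < ℓ t)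
    (ht2 : ℓ t ≤ 2) (hv : 0 < ℓ v) : ∃ k m, k ≤ ℓ v ∧ lab m = a v k ∧ IsMax m := by
  obtain ⟨m, em, tm⟩ := h.exists_top (s := c) (by simpa [T.zero] using hs v 0 (Nat.zero_le _))
  by_cases hmax : IsMax m
  · exact ⟨0, m, Nat.zero_le _, em.trans (T.zero v).symm, hmax⟩
  obtain ⟨i, j, p, q, hij, hi, hj, hp, hq⟩ := exists_arms_above h T em tm hmax
  by_contra! hno
  have hno' : ∀ p', IsMax p' → lab p' ≠ a v 1 := fun p' k1 k2 => hno 1 p' hv k2 k1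
  obtain ⟨p, q, hp, hq⟩ : ∃ p q, (m < p ∧ IsMax p ∧ lab p = a u 1) ∧
      (m < q ∧ IsMax q ∧ lab q = a t 1) := by
    rcases huv i with rfl | rfl | rfl
    · rcases huv j with rfl | rfl | rfl
      · exact absurd rfl hij
      · exact ⟨p, q, hp, hq⟩
      · exact absurd hq.2.2 (hno' q hq.2.1)
    · rcases huv j with rfl | rfl | rfl
      · exact ⟨q, p, hq, hp⟩
      · exact absurd rfl hij
      · exact absurd hq.2.2 (hno' q hq.2.1)
    · exact absurd hp.2.2 (hno' p hp.2.1)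
  have key : ∀ k p', (∀ z, p' < z → lab z = c → z = m) → p' < m → lab p' = a k 1 → k = v := by
    intro k p' hz k2 k3
    rcases huv k with rfl | rfl | rfl
    · exact (false_of_isMax_of_separated_once h T (by omega) (by omega) (k2.trans hp.1) k3 hp.2.2
        (fun z z1 _ => hz z z1) hp.2.1).elim
    · exact (false_of_isMax_of_separated_once h T ht ht2 (k2.trans hq.1) k3 hq.2.2
        (fun z z1 _ => hz z z1) hq.2.1).elim
    · rfl
  by_cases huniq : ∀ z, lab z = c → z = m
  · obtain ⟨w, ew, tw⟩ := h.exists_top (hs v 1 hv)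
    have hwm : w < m := by
      refine (h.lt_or_lt_of_adj (x := w) (y := m) ?_).resolve_right fun l => ?_
      · rw [ew, em]; exact (T.adj_center hv).symm
      · exact hno' w (isMax_of_forall_lt h T (k := 0) hv ew tw
          fun y hy => (tm y (hy.trans (T.zero v))).trans_lt l) ew
    obtain ⟨i, j, p', q', hij, -, -, hp', hq'⟩ := exists_arms_above h.dual T.dual
      (m := OrderDual.toDual m) em (fun y hy => (huniq (OrderDual.ofDual y) hy).ge)
      fun k => k.not_lt (b := OrderDual.toDual w) hwm
    exact hij ((key i (OrderDual.ofDual p') (fun z _ => huniq z) hp'.1 hp'.2.2).trans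
      (key j (OrderDual.ofDual q') (fun z _ => huniq z) hq'.1 hq'.2.2).symm)
  · push Not at huniq
    obtain ⟨w, w1, w2⟩ := huniq
    obtain ⟨x, -, k2, k3, k4⟩ := h.exists_prev (lt_of_le_of_ne (tm w w1) w2) (w1.trans em.symm)
    rw [em] at k3 k4
    have hz : ∀ p', x < p' → ∀ z, p' < z → lab z = c → z = m := fun p' k1 z z1 z3 =>
      (tm z z3).eq_or_lt.resolve_right fun l => k4 z (k1.trans z1) l z3
    obtain ⟨i, j, p', q', hij, -, -, hp', hq'⟩ := exists_arms_between h T k2 k3 em k4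
    exact hij ((key i p' (hz p' hp'.1) hp'.2.1 hp'.2.2).trans
      (key j q' (hz q' hq'.1) hq'.2.1 hq'.2.2).symm)

theorem false_of_short_arms [Finite α] (h : IsReducedPoset G lab) (T : TripodLabels G lab c a ℓ)
    (hs : ∀ i k, k ≤ ℓ i → ∃ x, lab x = a i k)
    {u t v : Fin 3} (huv : ∀ i, i = u ∨ i = t ∨ i = v) (hu : ℓ u = 1) (ht : 0 < ℓ t)
    (ht2 : ℓ t ≤ 2) (hv : 0 < ℓ v) : False :=
  false_of_arm h T hs hv (fun _ _ => third_arm_between h T huv hu ht ht2)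
    (third_arm_isMax h T hs huv hu ht ht2 hv) (third_arm_isMax h.dual T.dual hs huv hu ht ht2 hv)

theorem eq_of_ne_of_ne {j0 i j k : Fin 3} (hi : i ≠ j0) (hj : j ≠ j0) (hk : k ≠ j0)
    (hij : i ≠ j) : i = k ∨ j = k := by
  omega

theorem two_arms_isMax [Finite α] (h : IsReducedPoset G lab) (T : TripodLabels G lab c a ℓ)
    (hs : ∀ i k, k ≤ ℓ i → ∃ x, lab x = a i k)
    {j0 v : Fin 3} (h0 : ℓ j0 = 0) (hv : 0 < ℓ v) : ∃ k m, k ≤ ℓ v ∧ lab m = a v k ∧ IsMax m := by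
  obtain ⟨m, em, tm⟩ := h.exists_top (s := c) (by simpa [T.zero] using hs v 0 (Nat.zero_le _))
  by_cases hmax : IsMax m
  · exact ⟨0, m, Nat.zero_le _, em.trans (T.zero v).symm, hmax⟩
  obtain ⟨i, j, p, q, hij, hi, hj, hp, hq⟩ := exists_arms_above h T em tm hmax
  rcases eq_of_ne_of_ne (j0 := j0) (k := v) (by rintro rfl; omega) (by rintro rfl; omega)
    (by rintro rfl; omega) hij with rfl | rfl
  · exact ⟨1, p, hv, hp.2.2, hp.2.1⟩
  · exact ⟨1, q, hv, hq.2.2, hq.2.1⟩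

/-- Once an arm has length zero, the two arms needed in each gap include any given arm of positive
length, so `false_of_arm` applies to it. This covers paths. -/
theorem false_of_two_arms [Finite α] (h : IsReducedPoset G lab) (T : TripodLabels G lab c a ℓ)
    (hs : ∀ i k, k ≤ ℓ i → ∃ x, lab x = a i k)
    {j0 v : Fin 3} (h0 : ℓ j0 = 0) (hv : 0 < ℓ v) : False := by
  refine false_of_arm h T hs hv (fun x y hxy hx hy hn => ?_) (two_arms_isMax h T hs h0 hv)
    (two_arms_isMax h.dual T.dual hs h0 hv)
  obtain ⟨i, j, p, q, hij, hi, hj, hp, hq⟩ := exists_arms_between h T hxy hx hy hn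
  rcases eq_of_ne_of_ne (j0 := j0) (k := v) (by rintro rfl; omega) (by rintro rfl; omega)
    (by rintro rfl; omega) hij with rfl | rfl
  · exact ⟨p, hp⟩
  · exact ⟨q, hq⟩

theorem exists_common {i j k l : Fin 3} (hij : i ≠ j) (hkl : k ≠ l) :
    (i = k ∨ i = l) ∨ (j = k ∨ j = l) := by
  omega

/-- Otherwise two arms have maximal first labels above the last centre, and two arms occur in the
gap before it. These pairs share an arm, against `false_of_isMax_of_separated_once`. If the centre
occurs only once, irreducibility at such a maximal vertex and `exists_skip` produce two centres. -/
theorem center_isMax_of_two [Finite α] (h : IsReducedPoset G lab) (T : TripodLabels G lab c a ℓ)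
    (hs : ∀ i k, k ≤ ℓ i → ∃ x, lab x = a i k) (h2 : ∀ i, ℓ i = 2) {m : α} (em : lab m = c)
    (tm : ∀ y, lab y = c → y ≤ m) : IsMax m := by
  by_contra hmax
  obtain ⟨i, j, p, q, hij, hi, hj, hp, hq⟩ := exists_arms_above h T em tm hmax
  by_cases huniq : ∀ z, lab z = c → z = m
  · obtain ⟨s, es, ts⟩ := h.exists_top (hs i 2 (h2 i).ge)
    have hsp : s < p := h.lt_of_isMax hp.2.1 (by
      rw [es, hp.2.2]; exact (T.adj i 1 (by rw [h2]; omega)).symm)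
    obtain ⟨z, z1, z2, z3⟩ := h.up p s hp.2.1 hsp
    rw [es] at z3
    rcases T.nbr i 1 z (h2 i).ge z3 with e | ⟨k, -⟩
    · have hzp := lt_of_le_of_ne (h.le_of_isMax hp.2.1 (.inl (e.trans hp.2.2.symm))) z1
      obtain ⟨r, r', -, k2, -, k4, k5, -⟩ := exists_skip h T (k := 1) hi hi hzp e hp.2.2
        fun _ w w1 _ we => (ts w we).not_gt (z2.trans w1)
      exact k2.ne ((huniq r k4).trans (huniq r' k5).symm)
    · rw [h2] at k; omega
  · push Not at huniq
    obtain ⟨w, w1, w2⟩ := huniq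
    obtain ⟨x, -, k2, k3, k4⟩ := h.exists_prev (lt_of_le_of_ne (tm w w1) w2) (w1.trans em.symm)
    rw [em] at k3 k4
    obtain ⟨i', j', p', q', hij', hi', hj', hp', hq'⟩ := exists_arms_between h T k2 k3 em k4
    have key : ∀ i p p', (m < p ∧ IsMax p ∧ lab p = a i 1) → (x < p' ∧ p' < m ∧ lab p' = a i 1) →
        False := by
      intro i p p' l l'
      exact false_of_isMax_of_separated_once h T (y := m) (by rw [h2]; omega) (h2 i).le
        (l'.2.1.trans l.1) l'.2.2 l.2.2
        (fun z z1 _ z3 => (tm z z3).eq_or_lt.resolve_right fun l => k4 z (l'.1.trans z1) l z3) l.2.1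
    rcases exists_common hij hij' with (rfl | rfl) | (rfl | rfl)
    · exact key _ _ _ hp hp'
    · exact key _ _ _ hp hq'
    · exact key _ _ _ hq hp'
    · exact key _ _ _ hq hq'

/-- If the first label `p` of an arm of length two lies below a maximal centre `m`, with no
centre between, then the end of the arm occurs above `p`. -/
theorem exists_end_above (h : IsReducedPoset G lab) (T : TripodLabels G lab c a ℓ)
    (h2 : ∀ i, ℓ i = 2) {m p : α} {i : Fin 3} (mm : IsMax m) (hpm : p < m) (hp : lab p = a i 1)
    (hn : ∀ z, p < z → lab z = c → z = m) : ∃ s, p < s ∧ lab s = a i 2 := by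
  obtain ⟨z, z1, z2, z3⟩ := h.up m p mm hpm
  rw [hp] at z3
  rcases T.nbr i 0 z (by rw [h2]; omega) z3 with e | ⟨-, e⟩
  · exact absurd (hn z z2 (e.trans (T.zero i))) z1
  · exact ⟨z, z2, e⟩

/-- The last centre is maximal and the first minimal. For an arm in the last gap, `exists_end_above`
puts an end label above the first label there. An end label also lies below it: by duality if there
are just two centres, and otherwise by sharing an arm with the previous gap. Two first labels would
then be needed between these ends, but only one fits. -/
theorem false_of_all_two [Finite α] (h : IsReducedPoset G lab) (T : TripodLabels G lab c a ℓ)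
    (hs : ∀ i k, k ≤ ℓ i → ∃ x, lab x = a i k) (h2 : ∀ i, ℓ i = 2) : False := by
  have hc : ∃ x, lab x = c := by simpa [T.zero] using hs 0 0 (Nat.zero_le _)
  obtain ⟨m, em, tm⟩ := h.exists_top hc
  obtain ⟨n, en, tn⟩ := h.dual.exists_top hc
  have mm := center_isMax_of_two h T hs h2 em tm
  have mn : IsMin (OrderDual.ofDual n) := center_isMax_of_two h.dual T.dual hs h2 en tn
  replace tn : ∀ y, lab y = c → OrderDual.ofDual n ≤ y := fun y hy => tn (OrderDual.toDual y) hy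
  replace en : lab (OrderDual.ofDual n) = c := en
  generalize OrderDual.ofDual n = n at tn en mn
  have pos : ∀ i, 0 < ℓ i := fun i => by rw [h2]; omega
  have hnm : n < m := by
    refine lt_of_le_of_ne (tm n en) ?_
    rintro rfl
    obtain ⟨w, ew⟩ := hs 0 1 (pos 0)
    rcases h.lt_or_lt_of_adj (x := w) (y := n)
      (by rw [ew, en]; exact (T.adj_center (pos 0)).symm) with l | l
    · exact mn.not_lt l
    · exact mm.not_lt l
  obtain ⟨x, hnx, hxm, ex, hx⟩ := h.exists_prev hnm (en.trans em.symm)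
  rw [em] at ex hx
  have hx' : ∀ z, x < z → lab z = c → z = m := fun z z1 z3 =>
    (tm z z3).eq_or_lt.resolve_right fun l => hx z z1 l z3
  obtain ⟨i, j, p, q, hij, hi, hj, hp, hq⟩ := exists_arms_between h T hxm ex em hx
  rcases hnx.eq_or_lt with rfl | hnx
  · obtain ⟨s, s1, s2⟩ := exists_end_above h T h2 mm hp.2.1 hp.2.2
      fun z z1 => hx' z (hp.1.trans z1)
    obtain ⟨r, r1, r2⟩ := exists_end_above h.dual T.dual h2 (m := OrderDual.toDual n)
      (p := OrderDual.toDual p) mn hp.1 hp.2.2 fun z z1 z2 => by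
        rcases (tn (OrderDual.ofDual z) z2).eq_or_lt with e | l
        · exact e.symm
        · exact absurd z2 (hx (OrderDual.ofDual z) l (lt_trans (b := p) z1 hp.2.1))
    replace r1 : OrderDual.ofDual r < p := r1
    obtain ⟨k, l, hkl, hk, hl, ak, al⟩ := h.fc _ _ (r1.trans s1) (r2.trans s2.symm)
    rw [r2] at ak al
    have key : ∀ z, G.Adj (a i 2) (lab z) → lab z = a i 1 ∧ n < z ∧ z < m := by
      intro z hz
      have e : lab z = a i 1 := (T.nbr i 1 z (h2 i).ge hz).resolve_right fun k => by
        rw [h2] at k; omega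
      have hcz : G.Adj c (lab z) := e ▸ T.adj_center hi
      refine ⟨e, ?_, h.lt_of_isMax mm (em ▸ hcz.symm)⟩
      exact (h.lt_or_lt_of_adj (x := n) (y := z) (en ▸ hcz)).resolve_right mn.not_lt
    obtain ⟨ek, k1, k2⟩ := key k ak
    obtain ⟨el, l1, l2⟩ := key l al
    rcases h.lt_or_lt hkl (ek.trans el.symm) with w | w
    · obtain ⟨z, z1, z2, z3⟩ := exists_center_between h T hi w ek el
      exact hx z (k1.trans z1) (z2.trans l2) z3
    · obtain ⟨z, z1, z2, z3⟩ := exists_center_between h T hi w el ek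
      exact hx z (l1.trans z1) (z2.trans k2) z3
  · obtain ⟨x', -, hx'x, ex', hx'n⟩ := h.exists_prev hnx (en.trans ex.symm)
    rw [ex] at ex' hx'n
    obtain ⟨i', j', p', q', hij', hi', hj', hp', hq'⟩ := exists_arms_between h T hx'x ex' ex hx'n
    have key : ∀ i p p', (x < p ∧ p < m ∧ lab p = a i 1) → (x' < p' ∧ p' < x ∧ lab p' = a i 1) →
        False := by
      intro i p p' l l'
      have hpp := l'.2.1.trans l.1
      have hc : ∀ z, p' < z → z < p → lab z = c → z = x := fun z z1 z2 z3 =>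
        eq_of_consecutive h ex hx'n hx (l'.1.trans z1) (z2.trans l.2.1) z3
      obtain ⟨h1, s, s1, s2, -, s4⟩ := separated_once h T (pos i) hpp l'.2.2 l.2.2 hc
      obtain ⟨r, r1, r2⟩ := exists_end_above h T h2 mm l.2.1 l.2.2
        fun z z1 => hx' z (l.1.trans z1)
      obtain ⟨k, k', hkl, hk, hk', ak, ak'⟩ := h.fc s r (s2.trans r1) (s4.trans r2.symm)
      rw [s4] at ak ak'
      have key : ∀ z, s < z → G.Adj (a i 2) (lab z) → z = p := by
        intro z z0 hz
        have e : lab z = a i 1 := (T.nbr i 1 z (h2 i).ge hz).resolve_right fun k => by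
          rw [h2] at k; omega
        have hcz : G.Adj c (lab z) := e ▸ T.adj_center (pos i)
        by_contra hne
        rcases h.lt_or_lt hne (e.trans l.2.2.symm) with w | w
        · exact h1 z (s1.trans z0) w e
        · obtain ⟨y, y1, y2, y3⟩ := exists_center_between h T (pos i) w l.2.2 e
          exact hx y (l.1.trans y1) (y2.trans (h.lt_of_isMax mm (em ▸ hcz.symm))) y3
      exact hkl ((key k hk.1 ak).trans (key k' hk'.1 ak').symm)
    rcases exists_common hij hij' with (rfl | rfl) | (rfl | rfl)
    · exact key _ _ _ hp hp'
    · exact key _ _ _ hp hq'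
    · exact key _ _ _ hq hp'
    · exact key _ _ _ hq hq'

/-- The arm lengths of the tripods in the classification, up to order and truncation. -/
def AdmissibleLengths (ℓ : Fin 3 → ℕ) : Prop :=
  (ℓ 0 ≤ 1 ∧ ℓ 1 ≤ 2) ∨ ∀ i, ℓ i ≤ 2

theorem AdmissibleLengths.mono {ℓ ℓ' : Fin 3 → ℕ} (h : AdmissibleLengths ℓ)
    (hle : ∀ i, ℓ' i ≤ ℓ i) : AdmissibleLengths ℓ' :=
  h.imp (fun k => ⟨(hle 0).trans k.1, (hle 1).trans k.2⟩) fun k i => (hle i).trans (k i)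

theorem false_of_full [Finite α] (h : IsReducedPoset G lab) (T : TripodLabels G lab c a ℓ)
    (hs : ∀ i k, k ≤ ℓ i → ∃ x, lab x = a i k) (hF : AdmissibleLengths ℓ)
    (hpos : ∃ i, 0 < ℓ i) : False := by
  obtain ⟨v, hv⟩ := hpos
  by_cases h0 : ∃ j, ℓ j = 0
  · obtain ⟨j, hj⟩ := h0
    exact false_of_two_arms h T hs hj hv
  push Not at h0
  have h0' : ∀ j, 0 < ℓ j := fun j => Nat.pos_of_ne_zero (h0 j)
  have a0 := h0' 0
  have a1 := h0' 1
  have a2 := h0' 2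
  by_cases hall : ∀ i, ℓ i = 2
  · exact false_of_all_two h T hs hall
  rcases hF with ⟨h1, h2⟩ | h2
  · exact false_of_short_arms h T hs (u := 0) (t := 1) (v := 2) (by decide) (by omega) a1 h2 a2
  · have b0 := h2 0
    have b1 := h2 1
    have b2 := h2 2
    have : ℓ 0 = 1 ∨ ℓ 1 = 1 ∨ ℓ 2 = 1 := by
      by_contra! hne
      exact hall (Fin.forall_fin_succ.2 ⟨by omega, Fin.forall_fin_two.2 ⟨by
        change ℓ 1 = 2; omega, by change ℓ 2 = 2; omega⟩⟩)
    rcases this with e | e | e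
    · exact false_of_short_arms h T hs (u := 0) (t := 1) (v := 2) (by decide) e a1 b1 a2
    · exact false_of_short_arms h T hs (u := 1) (t := 0) (v := 2) (by decide) e a0 b0 a2
    · exact false_of_short_arms h T hs (u := 2) (t := 0) (v := 1) (by decide) e a0 b0 a1

/-- Version for a tripod whose labels need not all occur: a vertex connected to the centre
through the support has no neighbour in the support. -/
theorem false_of_adj_of_center [Finite α] (h : IsReducedPoset G lab)
    (T : TripodLabels G lab c a ℓ) (hF : AdmissibleLengths ℓ) {i : Fin 3} {k : ℕ} (hk : k ≤ ℓ i)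
    (hs : ∀ j ≤ k, ∃ x, lab x = a i j) {z : α} (hz : G.Adj (a i k) (lab z)) : False := by
  classical
  let Q : Fin 3 → ℕ → Prop := fun i k => ∀ j ≤ k, ∃ x, lab x = a i j
  -- Each arm is truncated to its longest initial segment whose labels all occur.
  let ℓ' : Fin 3 → ℕ := fun i => Nat.findGreatest (Q i) (ℓ i)
  have hc : ∃ x, lab x = c := by simpa [T.zero] using hs 0 (Nat.zero_le _)
  have Q0 : ∀ i, Q i 0 := fun i j hj => by
    rw [Nat.le_zero.1 hj, T.zero]; exact hc
  have hle : ∀ i, ℓ' i ≤ ℓ i := fun i => Nat.findGreatest_le _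
  have hQ : ∀ i, Q i (ℓ' i) := fun i => Nat.findGreatest_spec (Nat.zero_le _) (Q0 i)
  have hge : ∀ i k, k ≤ ℓ i → Q i k → k ≤ ℓ' i := fun i k hk hq => Nat.le_findGreatest hk hq
  have T' : TripodLabels G lab c a ℓ' := by
    refine ⟨T.zero, fun i k hk => T.adj i k (hk.trans_le (hle i)), fun x hx => ?_,
      fun i k x hk hx => ?_⟩
    · obtain ⟨i, hi, e⟩ := T.nbr_center x hx
      refine ⟨i, hge i 1 hi fun j hj => ?_, e⟩
      interval_cases j
      · exact Q0 i 0 le_rfl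
      · exact ⟨x, e⟩
    · refine (T.nbr i k x (hk.trans (hle i)) hx).imp id fun e => ⟨?_, e.2⟩
      refine hge i (k + 2) e.1 fun j hj => ?_
      rcases Nat.lt_or_ge j (k + 2) with l | l
      · exact hQ i j (by omega)
      · rw [le_antisymm hj l]; exact ⟨x, e.2⟩
  refine false_of_full h T' (fun i k hk => hQ i k hk) (hF.mono hle) ?_
  rcases Nat.eq_zero_or_pos k with rfl | hpos
  · rw [T.zero] at hz
    obtain ⟨j, hj, -⟩ := T'.nbr_center z hz
    exact ⟨j, hj⟩
  · exact ⟨i, hpos.trans_le (hge i k hk hs)⟩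

theorem false_of_adj [Finite α] (h : IsReducedPoset G lab)
    (T : TripodLabels G lab c a ℓ) (hF : AdmissibleLengths ℓ) {i : Fin 3} {k : ℕ} (hk : k ≤ ℓ i)
    {x z : α} (hx : lab x = a i k) (hz : G.Adj (lab x) (lab z)) : False := by
  classical
  rw [hx] at hz
  by_cases hs : ∀ j ≤ k, ∃ x, lab x = a i j
  · exact false_of_adj_of_center h T hF hk hs hz
  push Not at hs
  obtain ⟨j, hj, hno⟩ := hs
  -- The last missing label before position `k`; the part of the arm beyond it behaves like a path,
  -- centred at its endpoint `n + 1`.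
  let n := Nat.findGreatest (fun j => ∀ x, lab x ≠ a i j) k
  have hn : ∀ x, lab x ≠ a i n :=
    Nat.findGreatest_spec (P := fun j => ∀ x, lab x ≠ a i j) hj hno
  have hnk : n < k := lt_of_le_of_ne (Nat.findGreatest_le _) fun e => hn x (hx.trans (by rw [e]))
  have hgt : ∀ j, n < j → j ≤ k → ∃ x, lab x = a i j := by
    intro j h1 h2
    by_contra! h3
    exact Nat.findGreatest_is_greatest (P := fun j => ∀ x, lab x ≠ a i j) h1 h2 h3
  refine false_of_adj_of_center h (T.recenter (i := i) (k := n) (by omega) hn)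
    (.inl (by simp)) (i := 2) (k := k - (n + 1)) (z := z) (by simp; omega) (fun j hj => ?_) ?_
  · simpa using hgt (n + 1 + j) (by omega) (by omega)
  · have : n + 1 + (k - (n + 1)) = k := by omega
    simpa [this] using hz

end TripodLabels

/-! ### Odd cycles and cliques -/

/-- A cyclic set of labels, closed under adjacency inside the support of a labelling. -/
structure CycleLabels {P α : Type*} (G : SimpleGraph P) (lab : α → P) (n : ℕ)
    (a : ZMod n → P) : Prop where
  adj : ∀ k, G.Adj (a k) (a (k + 1))
  nbr : ∀ k x, G.Adj (a k) (lab x) → lab x = a (k - 1) ∨ lab x = a (k + 1)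

namespace CycleLabels

variable {P α : Type*} {G : SimpleGraph P} {lab : α → P} {n : ℕ} {a : ZMod n → P}

theorem neg (T : CycleLabels G lab n a) : CycleLabels G lab n (fun k => a (-k)) where
  adj k := by
    have := (T.adj (-(k + 1))).symm
    rwa [show -(k + 1) + 1 = -k by ring] at this
  nbr k x hx := by
    rw [show -(k - 1) = -k + 1 by ring, show -(k + 1) = -k - 1 by ring]
    exact (T.nbr _ x hx).symm

variable [PartialOrder α]

theorem exists_between [Finite α] [NeZero n] (h : IsReducedPoset G lab)
    (T : CycleLabels G lab n a) (hn : 3 ≤ n) {k : ZMod n} {x y : α} (hxy : x < y)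
    (hx : lab x = a k) (hy : lab y = a k) : ∃ z, x < z ∧ z < y ∧ lab z = a (k + 1) := by
  by_contra! hno
  -- A pair enclosing no successor label contains a nested pair, one label back, with the same
  -- defect. After `n - 1` steps back the label is `a (k + 1)`, inside the original interval.
  have claim : ∀ j : ℕ, ∃ p q, x ≤ p ∧ p < q ∧ q ≤ y ∧ (j ≠ 0 → x < p ∧ q < y) ∧
      lab p = a (k - j) ∧ lab q = a (k - j) ∧ ∀ z, p < z → z < q → lab z ≠ a (k - j + 1) := by
    intro j
    induction j with
    | zero => exact ⟨x, y, le_rfl, hxy, le_rfl, fun e => absurd rfl e, by simpa using hx,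
        by simpa using hy, by simpa using hno⟩
    | succ j ih =>
      obtain ⟨p, q, h1, h2, h3, -, h4, h5, h6⟩ := ih
      obtain ⟨q', k1, k2, k3, k4⟩ := h.exists_next h2 (h4.trans h5.symm)
      obtain ⟨r, s, hrs, hr, hs, ar, as⟩ := h.fc p q' k1 k3.symm
      rw [h4] at ar as k4
      have key : ∀ z, p < z → z < q' → G.Adj (a (k - j)) (lab z) → lab z = a (k - (j + 1 : ℕ)) := by
        intro z z1 z2 z3
        have := (T.nbr _ z z3).resolve_right (h6 z z1 (z2.trans_le k2))
        rwa [show k - (j : ZMod n) - 1 = k - (j + 1 : ℕ) by push_cast; ring] at this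
      have er := key r hr.1 hr.2 ar
      have es := key s hs.1 hs.2 as
      rw [show k - (j : ZMod n) = k - (j + 1 : ℕ) + 1 by push_cast; ring] at k4
      rcases h.lt_or_lt hrs (er.trans es.symm) with l | l
      · have l1 := h1.trans_lt hr.1
        have l2 := hs.2.trans_le (k2.trans h3)
        exact ⟨r, s, l1.le, l, l2.le, fun _ => ⟨l1, l2⟩, er, es,
          fun z z1 z2 => k4 z (hr.1.trans z1) (z2.trans hs.2)⟩
      · have l1 := h1.trans_lt hs.1
        have l2 := hr.2.trans_le (k2.trans h3)
        exact ⟨s, r, l1.le, l, l2.le, fun _ => ⟨l1, l2⟩, es, er,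
          fun z z1 z2 => k4 z (hs.1.trans z1) (z2.trans hr.2)⟩
  obtain ⟨p, q, -, h2, -, h4, h5, -⟩ := claim (n - 1)
  obtain ⟨h6, h7⟩ := h4 (by omega)
  refine hno p h6 (h2.trans h7) ?_
  rw [h5, Nat.cast_sub (by omega)]
  simp

theorem exists_between' [Finite α] [NeZero n] (h : IsReducedPoset G lab)
    (T : CycleLabels G lab n a) (hn : 3 ≤ n) {k : ZMod n} {x y : α} (hxy : x < y)
    (hx : lab x = a k) (hy : lab y = a k) : ∃ z, x < z ∧ z < y ∧ lab z = a (k - 1) := by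
  obtain ⟨z, h1, h2, h3⟩ := exists_between h T.neg hn (k := -k) hxy (by simpa using hx)
    (by simpa using hy)
  refine ⟨z, h1, h2, h3.trans (by congr 1; ring)⟩

theorem false_of_full [Finite α] (h : IsReducedPoset G lab) (T : CycleLabels G lab n a)
    (hn : 3 ≤ n) (hodd : Odd n) (hs : ∀ k, ∃ x, lab x = a k) : False := by
  have : NeZero n := ⟨by omega⟩
  choose M hM tM using fun k => h.exists_top (hs k)
  -- Two successive rises among the last occurrences would propagate round the whole cycle and put a
  -- vertex above itself.
  have norun : ∀ j, M j < M (j + 1) → M (j + 1) < M (j + 2) → False := by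
    intro j h1 h2
    have step : ∀ j, M j < M (j + 1) → M (j + 1) < M (j + 2) → M (j + 2) < M (j + 3) := by
      intro j h1 h2
      have nm : ¬ IsMax (M (j + 2)) := by
        intro mx
        obtain ⟨z, z1, z2, z3⟩ := h.up _ _ mx h2
        rw [hM] at z3
        rcases T.nbr _ z z3 with e | e
        · rw [add_sub_cancel_right] at e
          exact (tM _ z e).not_gt (h1.trans z2)
        · rw [show j + 1 + 1 = j + 2 by ring] at e
          obtain ⟨w, w1, w2, w3⟩ := exists_between' h T hn
            (lt_of_le_of_ne (tM _ z e) z1) e (hM _)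
          rw [show j + 2 - 1 = j + 1 by ring] at w3
          exact (tM _ w w3).not_gt (z2.trans w1)
      obtain ⟨b, hb⟩ := not_isMax_iff.1 nm
      obtain ⟨z, z1, z2⟩ := h.above _ _ hb
      rw [hM] at z2
      rcases T.nbr _ z z2 with e | e
      · rw [show j + 2 - 1 = j + 1 by ring] at e
        exact absurd (h2.trans z1) (tM _ z e).not_gt
      · rw [show j + 2 + 1 = j + 3 by ring] at e
        exact z1.trans_le (tM _ z e)
    have all : ∀ i : ℕ, M (j + i) < M (j + i + 1) ∧ M (j + i + 1) < M (j + i + 2) := by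
      intro i
      induction i with
      | zero => simpa using ⟨h1, h2⟩
      | succ i ih =>
        have e1 : j + ((i + 1 : ℕ) : ZMod n) = j + i + 1 := by push_cast; ring
        rw [e1, show j + i + 1 + 1 = j + i + 2 by ring, show j + i + 1 + 2 = j + i + 3 by ring]
        exact ⟨ih.2, step _ ih.1 ih.2⟩
    have mono : StrictMono fun i : ℕ => M (j + i) := strictMono_nat_of_lt_succ fun i => by
      have := (all i).1
      rwa [show j + i + 1 = j + ((i + 1 : ℕ) : ZMod n) by push_cast; ring] at this
    have := mono (show 0 < n by omega)
    simp at this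
  -- Maximality advances by two labels. As `n` is odd, `n + 1` is even and steps of two lead from
  -- `k` to `k + 1`, although `M k` and `M (k + 1)` are comparable.
  have next : ∀ k, IsMax (M k) → IsMax (M (k + 2)) := by
    intro k mx
    have h1 : M (k + 1) < M k := h.lt_of_isMax mx (by rw [hM, hM]; exact (T.adj k).symm)
    obtain ⟨z, z1, z2, z3⟩ := h.up _ _ mx h1
    rw [hM] at z3
    rcases T.nbr _ z z3 with e | e
    · rw [add_sub_cancel_right] at e
      obtain ⟨w, w1, w2, w3⟩ := exists_between h T hn (lt_of_le_of_ne (tM _ z e) z1) e (hM _)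
      exact absurd (z2.trans w1) (tM _ w w3).not_gt
    rw [show k + 1 + 1 = k + 2 by ring] at e
    have h2 : M (k + 1) < M (k + 2) := z2.trans_le (tM _ z e)
    by_contra nm
    obtain ⟨b, hb⟩ := not_isMax_iff.1 nm
    obtain ⟨w, w1, w2⟩ := h.above _ _ hb
    rw [hM] at w2
    rcases T.nbr _ w w2 with e | e
    · rw [show k + 2 - 1 = k + 1 by ring] at e
      exact (tM _ w e).not_gt (h2.trans w1)
    · rw [show k + 2 + 1 = k + 1 + 2 by ring] at e
      refine norun (k + 1) ?_ ?_
      · rwa [show k + 1 + 1 = k + 2 by ring]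
      · rw [show k + 1 + 1 = k + 2 by ring]
        exact w1.trans_le (tM _ w e)
  obtain ⟨m, ⟨k, hk⟩, hm⟩ := (Set.toFinite {x | ∃ k, lab x = a k}).exists_maximal
    (let ⟨x, hx⟩ := hs 0; ⟨x, 0, hx⟩)
  have mm : IsMax m := by
    intro b hb
    by_contra hlt
    obtain ⟨z, z1, z2⟩ := h.above b m (lt_of_le_not_ge hb hlt)
    rw [hk] at z2
    exact z1.not_ge (hm ((T.nbr k z z2).elim (fun e => ⟨_, e⟩) fun e => ⟨_, e⟩) z1.le)
  have m0 : IsMax (M k) := mm.mono (tM k m hk)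
  have mi : ∀ i : ℕ, IsMax (M (k + (2 * i : ℕ))) := by
    intro i
    induction i with
    | zero => simpa using m0
    | succ i ih =>
      have := next _ ih
      rwa [show k + ((2 * i : ℕ) : ZMod n) + 2 = k + (2 * (i + 1) : ℕ) by push_cast; ring] at this
  obtain ⟨r, hr⟩ := hodd
  have m1 : IsMax (M (k + 1)) := by
    have := mi (r + 1)
    rw [show 2 * (r + 1) = n + 1 by omega] at this
    simpa using this
  exact m0.not_lt (h.lt_of_isMax (x := M k) m1 (by rw [hM, hM]; exact T.adj k))

/-- A vertex with a label in an odd cycle has no neighbour in the support. -/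
theorem false_of_adj [Finite α] (h : IsReducedPoset G lab) (T : CycleLabels G lab n a)
    (hn : 3 ≤ n) (hodd : Odd n) {k : ZMod n} {x z : α} (hx : lab x = a k)
    (hz : G.Adj (lab x) (lab z)) : False := by
  have : NeZero n := ⟨by omega⟩
  by_cases hs : ∀ k, ∃ x, lab x = a k
  · exact false_of_full h T hn hodd hs
  push Not at hs
  obtain ⟨w, hw⟩ := hs
  -- Without `w` the cycle is a path on `n - 1` labels starting at `w + 1`, that is, a single arm of
  -- length `n - 2`.
  have T' : TripodLabels G lab (a (w + 1))
      (fun i j => if i = 2 then a (w + 1 + j) else a (w + 1)) ![0, 0, n - 2] := by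
    refine ⟨fun i => by simp, fun i j hj => ?_, fun x hx => ⟨2, ?_⟩, fun i j x hj hx => ?_⟩
    · fin_cases i
      · simp at hj
      · simp at hj
      · have := T.adj (w + 1 + j)
        simpa [add_assoc] using this
    · have := (T.nbr _ x hx).resolve_left (by simpa using hw x)
      simp only [if_true]
      exact ⟨by simp; omega, by simpa using this⟩
    · fin_cases i
      · simp at hj
      · simp at hj
      · replace hx : G.Adj (a (w + 1 + (j + 1 : ℕ))) (lab x) := hx
        replace hj : j + 1 ≤ n - 2 := hj
        change lab x = a (w + 1 + j) ∨ (j + 1 < n - 2 ∧ lab x = a (w + 1 + (j + 2 : ℕ)))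
        refine (T.nbr _ x hx).imp (fun e => ?_) fun e => ⟨?_, ?_⟩
        · rw [e]; congr 1; push_cast; ring
        · by_contra hge
          apply hw x
          rw [e]; congr 1
          have : (j : ZMod n) + 1 + 2 = 0 := by
            have : ((j + 1 + 2 : ℕ) : ZMod n) = 0 := by
              rw [show j + 1 + 2 = n by omega]; simp
            push_cast at this; exact this
          push_cast
          linear_combination this
        · rw [e]; congr 1; push_cast; ring
  have hkw : k ≠ w := by rintro rfl; exact hw x hx
  have hval : (k - (w + 1)).val ≤ n - 2 := by
    have h1 := ZMod.val_lt (k - (w + 1))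
    by_contra hgt
    have h2 : (k - (w + 1)).val = n - 1 := by omega
    have h3 : ((n - 1 : ℕ) : ZMod n) = k - (w + 1) := by
      rw [← h2, ZMod.natCast_val, ZMod.cast_id]
    rw [Nat.cast_sub (by omega)] at h3
    apply hkw
    simp at h3
    linear_combination -h3
  exact TripodLabels.false_of_adj h T' (.inl (by simp)) (i := 2) (k := (k - (w + 1)).val) hval
    (x := x) (by simp [hx]) hz

end CycleLabels

/-- The vertices labelled in `K` form a chain whose top is maximal. The second vertex from the top
has only the top above it in the chain, against irreducibility. -/
theorem IsReducedPoset.false_of_clique {P α : Type*} {G : SimpleGraph P} [PartialOrder α]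
    [Finite α] {lab : α → P} (h : IsReducedPoset G lab) {K : Set P}
    (hcl : ∀ v ∈ K, ∀ w, G.Adj v w → w ∈ K) (hK : ∀ v ∈ K, ∀ w ∈ K, v ≠ w → G.Adj v w) {x z : α}
    (hx : lab x ∈ K) (hz : G.Adj (lab x) (lab z)) : False := by
  have comp : ∀ p q, lab p ∈ K → lab q ∈ K → p ≤ q ∨ q ≤ p := fun p q hp hq =>
    h.comp p q ((em (lab p = lab q)).imp id (hK _ hp _ hq))
  obtain ⟨m, hm⟩ := (Set.toFinite {p | lab p ∈ K}).exists_maximal ⟨x, hx⟩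
  have mm : IsMax m := by
    intro b hb
    by_contra hlt
    obtain ⟨y, y1, y2⟩ := h.above b m (lt_of_le_not_ge hb hlt)
    exact y1.not_ge (hm.2 (hcl _ hm.1 _ y2) y1.le)
  have hle : ∀ p, lab p ∈ K → p ≤ m := fun p hp =>
    (comp p m hp hm.1).elim id fun k => hm.2 hp k
  obtain ⟨y, hy, hym⟩ : ∃ y, lab y ∈ K ∧ y < m := by
    by_contra! hno
    have e : ∀ p, lab p ∈ K → p = m := fun p hp =>
      (hle p hp).eq_or_lt.resolve_right (hno p hp)
    exact G.ne_of_adj hz (by rw [e x hx, e z (hcl _ hx _ hz)])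
  obtain ⟨b, hb⟩ := (Set.toFinite {p | lab p ∈ K ∧ p < m}).exists_maximal ⟨y, hy, hym⟩
  obtain ⟨w, w1, w2, w3⟩ := h.up m b mm hb.1.2
  have hw := hcl _ hb.1.1 _ w3
  exact w2.not_ge (hb.2 ⟨hw, lt_of_le_of_ne (hle w hw) w1⟩ w2.le)

/-! ### From irreducible heaps with P2 to reduced posets -/

namespace LabelledHeap

variable {P : Type*} {C : ConcurrencyRelation P}

/-- A chain of concurrent steps leads from `x` to `y`, and `z` is its first proper step. -/
theorem exists_rel_above (E : LabelledHeap C) {x y : E.carrier} (h : x < y) :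
    ∃ z, x < z ∧ z ≤ y ∧ C.rel (E.label x) (E.label z) := by
  have key : x = y ∨ ∃ z, x < z ∧ z ≤ y ∧ C.rel (E.label x) (E.label z) := by
    have ht := (E.le_iff x y).1 h.le
    clear h
    induction ht using Relation.TransGen.head_induction_on with
    | single k =>
      exact k.1.eq_or_lt.imp id fun l => ⟨_, l, le_rfl, k.2⟩
    | head k k' ih =>
      rcases k.1.eq_or_lt with e | l
      · subst e; exact ih
      · exact .inr ⟨_, l, (E.le_iff _ _).2 k', k.2⟩
  exact key.resolve_left h.ne

theorem exists_rel_below (E : LabelledHeap C) {x y : E.carrier} (h : x < y) :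
    ∃ z, x ≤ z ∧ z < y ∧ C.rel (E.label z) (E.label y) := by
  have key : x = y ∨ ∃ z, x ≤ z ∧ z < y ∧ C.rel (E.label z) (E.label y) := by
    have ht := (E.le_iff x y).1 h.le
    clear h
    induction ht with
    | single k =>
      exact k.1.eq_or_lt.imp id fun l => ⟨_, le_rfl, l, k.2⟩
    | tail k' k ih =>
      rcases k.1.eq_or_lt with e | l
      · subst e; exact ih
      · exact .inr ⟨_, (E.le_iff _ _).2 k', l, k.2⟩
  exact key.resolve_left h.ne

theorem HasP2.exists_between {E : LabelledHeap C} (hE : E.HasP2) {x y : E.carrier} (h : x < y)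
    (e : E.label x = E.label y) : ∃ z, x < z ∧ z < y := by
  by_contra! hno
  refine (hE 1 ![x, y] ⟨⟨?_, ?_⟩, by simpa using e⟩).1 rfl
  · intro i j hij
    fin_cases i <;> fin_cases j <;> simp_all
  · have hmem : ∀ i, x ≤ ![x, y] i ∧ ![x, y] i ≤ y := by
      intro i
      fin_cases i <;> simp [h.le]
    intro i j z hi hj
    exact absurd (hj.trans_le (hmem j).2) (hno z ((hmem i).1.trans_lt hi))

theorem HasP2.exists_two_between {E : LabelledHeap C} (hE : E.HasP2) {x y z : E.carrier}
    (h1 : x < z) (h2 : z < y) (e : E.label x = E.label y) : ∃ w, x < w ∧ w < y ∧ w ≠ z := by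
  by_contra! hno
  refine (hE 2 ![x, z, y] ⟨⟨?_, ?_⟩, by simpa using e⟩).2 rfl
  · intro i j hij
    have := h1.trans h2
    fin_cases i <;> fin_cases j <;> simp_all
  · have hmem : ∀ i, x ≤ ![x, z, y] i ∧ ![x, z, y] i ≤ y := by
      intro i
      fin_cases i <;> simp [h1.le, h2.le, (h1.trans h2).le]
    intro i j w hi hj
    exact ⟨1, (hno w ((hmem i).1.trans_lt hi) (hj.trans_le (hmem j).2)).symm⟩

/-- P2 leaves two vertices between `x` and the next occurrence `m` of its label. One yields a first
step `p` up from `x`; some `v ≠ p` yields a first step `q` from `x` and a last step `r` into `m`. If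
`q = p`, then `r ≠ p`, since otherwise `v` would be squeezed onto `p`. -/
theorem HasP2.exists_adj_between {E : LabelledHeap C} (hE : E.HasP2) {x y : E.carrier} (h : x < y)
    (e : E.label x = E.label y) : ∃ k l, k ≠ l ∧ (x < k ∧ k < y) ∧ (x < l ∧ l < y) ∧
      C.graph.Adj (E.label x) (E.label k) ∧ C.graph.Adj (E.label x) (E.label l) := by
  obtain ⟨m, hm⟩ := (Set.toFinite {w | x < w ∧ w ≤ y ∧ E.label w = E.label x}).exists_minimal
    ⟨y, h, le_rfl, e.symm⟩
  obtain ⟨⟨m1, m2, m3⟩, m4⟩ := hm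
  have hne : ∀ z, x < z → z < m → E.label x ≠ E.label z := fun z z1 z2 z3 =>
    z2.not_ge (m4 ⟨z1, z2.le.trans m2, z3.symm⟩ z2.le)
  obtain ⟨w, w1, w2⟩ := hE.exists_between m1 m3.symm
  obtain ⟨p, p1, p2, p3⟩ := E.exists_rel_above w1
  have p4 := p2.trans_lt w2
  obtain ⟨v, v1, v2, v3⟩ := hE.exists_two_between p1 p4 m3.symm
  have adj : ∀ k, x < k → k < m → C.rel (E.label x) (E.label k) →
      C.graph.Adj (E.label x) (E.label k) := fun k k1 k2 k3 => ⟨hne k k1 k2, k3⟩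
  obtain ⟨q, q1, q2, q3⟩ := E.exists_rel_above v1
  obtain ⟨r, r1, r2, r3⟩ := E.exists_rel_below v2
  rw [m3] at r3
  have r4 := v1.trans_le r1
  have q4 := q2.trans_lt v2
  by_cases hqp : q = p
  · refine ⟨p, r, ?_, ⟨p1, p4.trans_le m2⟩, ⟨r4, r2.trans_le m2⟩, adj p p1 p4 p3,
      adj r r4 r2 (C.symm _ _ r3)⟩
    rintro rfl
    exact v3 (le_antisymm r1 (hqp ▸ q2))
  · exact ⟨q, p, hqp, ⟨q1, q4.trans_le m2⟩, ⟨p1, p4.trans_le m2⟩, adj q q1 q4 q3, adj p p1 p4 p3⟩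

/-- A chain between two other vertices never passes through a maximal vertex, so no relation is lost
by deleting it. -/
theorem erase_le_iff_of_isMax (E : LabelledHeap C) {a : E.carrier} (ha : IsMax a)
    (u v : (E.erase a).carrier) : u ≤ v ↔ (u.1 : E.carrier) ≤ v.1 := by
  refine ⟨fun h => E.le_of_transGen_subRel _ h, fun h => ?_⟩
  have ht := (E.le_iff _ _).1 h
  clear h
  have key : ∀ w (hw : w ≠ a), Relation.TransGen
      (fun x y => x ≤ y ∧ C.rel (E.label x) (E.label y)) w v.1 →
      Relation.TransGen (E.subRel {x | x ≠ a}) ⟨w, hw⟩ v := by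
    intro w hw ht
    induction ht using Relation.TransGen.head_induction_on with
    | single k => exact .single k
    | head k k' ih =>
      rename_i p q
      have hq : q ≠ a := by
        rintro rfl
        exact v.2 (ha.eq_of_le ((E.le_iff _ _).2 k')).symm
      exact Relation.TransGen.head (b := (⟨q, hq⟩ : {x | x ≠ a})) ⟨k.1, k.2⟩ (ih hq)
  exact key u.1 u.2 ht

theorem erase_le_iff_of_isMin (E : LabelledHeap C) {a : E.carrier} (ha : IsMin a)
    (u v : (E.erase a).carrier) : u ≤ v ↔ (u.1 : E.carrier) ≤ v.1 := by
  refine ⟨fun h => E.le_of_transGen_subRel _ h, fun h => ?_⟩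
  have ht := (E.le_iff _ _).1 h
  clear h
  have key : ∀ w (hw : w ≠ a), Relation.TransGen
      (fun x y => x ≤ y ∧ C.rel (E.label x) (E.label y)) u.1 w →
      Relation.TransGen (E.subRel {x | x ≠ a}) u ⟨w, hw⟩ := by
    intro w hw ht
    induction ht with
    | single k => exact .single k
    | tail k' k ih =>
      rename_i p q
      have hq : p ≠ a := by
        rintro rfl
        exact u.2 (ha.eq_of_ge ((E.le_iff _ _).2 k')).symm
      exact Relation.TransGen.tail (b := (⟨p, hq⟩ : {x | x ≠ a})) (ih hq) ⟨k.1, k.2⟩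
  exact key v.1 v.2 ht

theorem HasP2.erase {E : LabelledHeap C} (hE : E.HasP2) {a : E.carrier}
    (ha : IsMax a ∨ IsMin a) : (E.erase a).HasP2 := by
  have hle : ∀ u v : (E.erase a).carrier, u ≤ v ↔ (u.1 : E.carrier) ≤ v.1 :=
    ha.elim (fun h => E.erase_le_iff_of_isMax h) fun h => E.erase_le_iff_of_isMin h
  have hlt : ∀ u v : (E.erase a).carrier, u < v ↔ (u.1 : E.carrier) < v.1 := by
    intro u v
    rw [lt_iff_le_not_ge, lt_iff_le_not_ge, hle, hle]
  intro t x hx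
  refine hE t (fun i => (x i).1) ⟨⟨fun i j hij => (hlt _ _).1 (hx.1.1 hij), ?_⟩, hx.2⟩
  intro i j y hi hj
  have hy : y ≠ a := by
    rintro rfl
    exact ha.elim (fun h => h.not_lt hj) fun h => h.not_lt hi
  obtain ⟨k, hk⟩ := hx.1.2 i j ⟨y, hy⟩ ((hlt _ _).2 hi) ((hlt _ _).2 hj)
  exact ⟨k, congrArg Subtype.val hk⟩

/-- Were `a` the only neighbour above `b`, then `b` would become maximal once `a` is deleted. The
labels of `a` and `b` differ by `exists_adj_between`, so `a` would witness `PrecMax`. -/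
theorem HasP2.exists_of_not_precMax {E : LabelledHeap C} (hE : E.HasP2) {a b : E.carrier}
    (hp : ¬ E.PrecMax a) (ha : IsMax a) (hb : b < a) :
    ∃ z, z ≠ a ∧ b < z ∧ C.graph.Adj (E.label b) (E.label z) := by
  by_contra! hno
  have hrel : ∀ z, b < z → C.rel (E.label b) (E.label z) → z = a := by
    intro z hz hr
    by_contra hne
    by_cases e : E.label b = E.label z
    · obtain ⟨k, l, hkl, hk, hl, ak, al⟩ := hE.exists_adj_between hz e
      have hk' : k = a := by_contra fun c => hno k c hk.1 ak
      have hl' : l = a := by_contra fun c => hno l c hl.1 al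
      exact hkl (hk'.trans hl'.symm)
    · exact hno z hne hz ⟨e, hr⟩
  refine hp ⟨ha, ⟨b, hb.ne⟩, ?_, fun h => h.not_lt hb, fun e => ?_⟩
  · intro v hv
    have hv' := (E.erase_le_iff_of_isMax ha _ _).1 hv
    rcases hv'.eq_or_lt with e | l
    · exact (E.erase_le_iff_of_isMax ha _ _).2 e.ge
    · obtain ⟨z, z1, z2, z3⟩ := E.exists_rel_above l
      have := hrel z z1 z3
      subst this
      exact absurd (ha.eq_of_le z2).symm v.2
  · obtain ⟨k, -, -, hk, -, ak, -⟩ := hE.exists_adj_between hb e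
    exact hno k hk.2.ne hk.1 ak

theorem HasP2.exists_of_not_precMin {E : LabelledHeap C} (hE : E.HasP2) {a b : E.carrier}
    (hp : ¬ E.PrecMin a) (ha : IsMin a) (hb : a < b) :
    ∃ z, z ≠ a ∧ z < b ∧ C.graph.Adj (E.label b) (E.label z) := by
  by_contra! hno
  have hrel : ∀ z, z < b → C.rel (E.label z) (E.label b) → z = a := by
    intro z hz hr
    by_contra hne
    by_cases e : E.label z = E.label b
    · obtain ⟨k, l, hkl, hk, hl, ak, al⟩ := hE.exists_adj_between hz e
      rw [e] at ak al
      have hk' : k = a := by_contra fun c => hno k c hk.2 ak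
      have hl' : l = a := by_contra fun c => hno l c hl.2 al
      exact hkl (hk'.trans hl'.symm)
    · exact hno z hne hz ⟨Ne.symm e, C.symm _ _ hr⟩
  refine hp ⟨ha, ⟨b, hb.ne'⟩, ?_, fun h => h.not_lt hb, fun e => ?_⟩
  · intro v hv
    have hv' := (E.erase_le_iff_of_isMin ha _ _).1 hv
    rcases hv'.eq_or_lt with e | l
    · exact (E.erase_le_iff_of_isMin ha _ _).2 e.ge
    · obtain ⟨z, z1, z2, z3⟩ := E.exists_rel_below l
      have := hrel z z2 z3
      subst this
      exact absurd (ha.eq_of_ge z1).symm v.2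
  · obtain ⟨k, -, -, hk, -, ak, -⟩ := hE.exists_adj_between hb e.symm
    rw [← show E.label b = E.label a from e] at ak
    exact hno k hk.1.ne' hk.2 ak

theorem HasP2.exists_adj_above {E : LabelledHeap C} (hE : E.HasP2) {a b : E.carrier}
    (hb : b < a) : ∃ z, b < z ∧ C.graph.Adj (E.label b) (E.label z) := by
  obtain ⟨z, z1, -, z3⟩ := E.exists_rel_above hb
  by_cases e : E.label b = E.label z
  · obtain ⟨k, -, -, hk, -, ak, -⟩ := hE.exists_adj_between z1 e
    exact ⟨k, hk.1, ak⟩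
  · exact ⟨z, z1, e, z3⟩

theorem HasP2.exists_adj_below {E : LabelledHeap C} (hE : E.HasP2) {a b : E.carrier}
    (hb : a < b) : ∃ z, z < b ∧ C.graph.Adj (E.label b) (E.label z) := by
  obtain ⟨z, -, z1, z3⟩ := E.exists_rel_below hb
  by_cases e : E.label z = E.label b
  · obtain ⟨k, -, -, hk, -, ak, -⟩ := hE.exists_adj_between z1 e
    exact ⟨k, hk.2, e ▸ ak⟩
  · exact ⟨z, z1, Ne.symm e, C.symm _ _ z3⟩

theorem HasP2.isReducedPoset {E : LabelledHeap C} (hE : E.HasP2) (hmax : ∀ a, ¬ E.PrecMax a)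
    (hmin : ∀ a, ¬ E.PrecMin a) : IsReducedPoset C.graph E.label where
  comp x y h := E.comparable x y (h.elim (fun e => e ▸ C.refl _) fun k => k.2)
  fc _ _ := hE.exists_adj_between
  up a _ := hE.exists_of_not_precMax (hmax a)
  above _ _ := hE.exists_adj_above
  down a _ := hE.exists_of_not_precMin (hmin a)
  below _ _ := hE.exists_adj_below

/-- Induction on the number of vertices: each reduction step keeps P2, and `H` says that the process
can only stop at a trivial heap. -/
theorem HasP2.hasP1_of_forall {E : LabelledHeap C} (hE : E.HasP2)
    (H : ∀ F : LabelledHeap C, F.HasP2 → (∀ a, ¬ F.PrecMax a) → (∀ a, ¬ F.PrecMin a) →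
      F.IsTrivial) : (Heap.mk E).HasP1 := by
  induction hn : Nat.card E.carrier using Nat.strong_induction_on generalizing E with
  | _ n ih =>
  by_cases hred : ∃ a, E.PrecMax a ∨ E.PrecMin a
  · obtain ⟨a, ha⟩ := hred
    have hcard : Nat.card (E.erase a).carrier < n := by
      rw [← hn]
      exact Finite.card_subtype_lt (p := fun x => x ≠ a) (x := a) (by simp)
    obtain ⟨F, hF, hFE⟩ := ih _ hcard (hE.erase (ha.imp (fun h => h.1) fun h => h.1)) rfl
    exact ⟨F, hF, hFE.tail ⟨E, a, rfl, rfl, ha⟩⟩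
  · push Not at hred
    exact ⟨Heap.mk E, H E hE (fun a => (hred a).1) (fun a => (hred a).2), .refl⟩

theorem isRegularClass_of_forall (H : ∀ F : LabelledHeap C, F.HasP2 → (∀ a, ¬ F.PrecMax a) →
    (∀ a, ¬ F.PrecMin a) → F.IsTrivial) : IsRegularClass C := by
  intro E hE
  induction E using Quotient.inductionOn with
  | _ E => exact HasP2.hasP1_of_forall (E := E) hE H

/-- A consequence of `PrecMax` that mentions only the order of `E`, and hence is easily carried
along isomorphisms. -/
theorem PrecMax.exists_unique_above {E : LabelledHeap C} {a : E.carrier} (h : E.PrecMax a) :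
    IsMax a ∧ ∃ b, b < a ∧ ∀ z, b < z → z = a := by
  obtain ⟨ha, b, hb, hbE, -⟩ := h
  have key : ∀ z, b.1 < z → z = a := by
    intro z hz
    obtain ⟨w, w1, w2, w3⟩ := E.exists_rel_above hz
    by_cases e : w = a
    · subst e; exact (ha.eq_of_le w2).symm
    · have h1 : b ≤ (⟨w, e⟩ : (E.erase a).carrier) :=
        Relation.TransGen.single (r := E.subRel {x | x ≠ a}) (a := b) (b := ⟨w, e⟩) ⟨w1.le, w3⟩
      exact absurd (E.le_of_transGen_subRel _ (hb h1)) w1.not_ge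
  obtain ⟨c, hc⟩ := not_isMax_iff.1 hbE
  have := key c hc
  subst this
  exact ⟨ha, b.1, hc, key⟩

theorem PrecMin.exists_unique_below {E : LabelledHeap C} {a : E.carrier} (h : E.PrecMin a) :
    IsMin a ∧ ∃ b, a < b ∧ ∀ z, z < b → z = a := by
  obtain ⟨ha, b, hb, hbE, -⟩ := h
  have key : ∀ z, z < b.1 → z = a := by
    intro z hz
    obtain ⟨w, w1, w2, w3⟩ := E.exists_rel_below hz
    by_cases e : w = a
    · subst e; exact (ha.eq_of_ge w1).symm
    · obtain ⟨w', rfl⟩ : ∃ w' : (E.erase a).carrier, w'.1 = w := ⟨⟨w, e⟩, rfl⟩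
      have h1 : w' ≤ b :=
        Relation.TransGen.single (r := E.subRel {x | x ≠ a}) (a := w') (b := b) ⟨w2.le, w3⟩
      exact absurd (E.le_of_transGen_subRel _ (hb h1)) w2.not_ge
  obtain ⟨c, hc⟩ := not_isMin_iff.1 hbE
  have := key c hc
  subst this
  exact ⟨ha, b.1, hc, key⟩

/-- A nontrivial heap with property P2 in which no maximal vertex covers a vertex alone, and
dually, prevents the class from being regular. -/
theorem HasP2.not_isRegularClass {E : LabelledHeap C} (hE : E.HasP2) (hnt : ¬ E.IsTrivial)
    (hmax : ∀ a b : E.carrier, IsMax a → b < a → ∃ z, b < z ∧ z ≠ a)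
    (hmin : ∀ a b : E.carrier, IsMin a → a < b → ∃ z, z < b ∧ z ≠ a) : ¬ IsRegularClass C := by
  intro hreg
  obtain ⟨F, hF, hFE⟩ := hreg (Heap.mk E) hE
  rcases hFE.cases_tail with e | ⟨D, -, E', a, hE', -, hp⟩
  · rw [← e] at hF; exact hnt hF
  · obtain ⟨φ, -⟩ : Iso E' E := Quotient.exact hE'
    rcases hp with hp | hp
    · obtain ⟨ha, b, hb, hu⟩ := hp.exists_unique_above
      obtain ⟨z, z1, z2⟩ := hmax (φ a) (φ b) (φ.isMax_apply.2 ha) (φ.lt_iff_lt.2 hb)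
      exact z2 (by rw [← hu (φ.symm z) (φ.lt_symm_apply.2 z1), φ.apply_symm_apply])
    · obtain ⟨ha, b, hb, hu⟩ := hp.exists_unique_below
      obtain ⟨z, z1, z2⟩ := hmin (φ a) (φ b) (φ.isMin_apply.2 ha) (φ.lt_iff_lt.2 hb)
      exact z2 (by rw [← hu (φ.symm z) (φ.symm_apply_lt.2 z1), φ.apply_symm_apply])

end LabelledHeap

/-! ### Words and their heaps -/

/-- A word in the pieces whose heap is irreducible and nontrivial and has property P2. -/
structure IsIrreducibleWord {P ι : Type*} [LT ι] (C : ConcurrencyRelation P) (w : ι → P) :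
    Prop where
  two_between : ∀ i j, i < j → w i = w j → ∃ k l, k ≠ l ∧ (i < k ∧ k < j) ∧ (i < l ∧ l < j) ∧
    C.rel (w i) (w k) ∧ C.rel (w i) (w l)
  up : ∀ b a, b < a → C.rel (w b) (w a) →
    (∃ k, b < k ∧ k ≠ a ∧ C.rel (w b) (w k)) ∨ ∃ k, a < k ∧ C.rel (w a) (w k)
  down : ∀ b a, a < b → C.rel (w b) (w a) →
    (∃ k, k < b ∧ k ≠ a ∧ C.rel (w b) (w k)) ∨ ∃ k, k < a ∧ C.rel (w a) (w k)
  nontrivial : ∃ i j, i < j ∧ C.rel (w i) (w j)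

namespace LabelledHeap

variable {P : Type*} {C : ConcurrencyRelation P}

/-- The heap of a word. -/
def ofWord (C : ConcurrencyRelation P) {ι : Type} [Finite ι] [LinearOrder ι] (w : ι → P) :
    LabelledHeap C where
  carrier := ι
  order :=
    { le := Relation.TransGen fun i j => i ≤ j ∧ C.rel (w i) (w j)
      lt := fun a b => Relation.TransGen (fun i j => i ≤ j ∧ C.rel (w i) (w j)) a b ∧
        ¬ Relation.TransGen (fun i j => i ≤ j ∧ C.rel (w i) (w j)) b a
      lt_iff_le_not_ge := fun _ _ => Iff.rfl
      le_refl := fun i => .single ⟨le_rfl, C.refl _⟩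
      le_trans := fun _ _ _ h k => h.trans k
      le_antisymm := by
        have key : ∀ i j, Relation.TransGen (fun i j => i ≤ j ∧ C.rel (w i) (w j)) i j → i ≤ j :=
          fun i j h => by
            induction h with
            | single h => exact h.1
            | tail _ h ih => exact ih.trans h.1
        exact fun i j h k => le_antisymm (key i j h) (key j i k) }
  label := w
  comparable i j h := (le_total i j).imp (fun k => .single ⟨k, h⟩)
    fun k => .single ⟨k, C.symm _ _ h⟩
  le_iff i j := by
    constructor
    · intro h
      have h' : Relation.TransGen (fun i j => i ≤ j ∧ C.rel (w i) (w j)) i j := h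
      clear h
      induction h' with
      | single k => exact .single ⟨.single k, k.2⟩
      | tail _ k ih => exact ih.tail ⟨.single k, k.2⟩
    · intro h
      induction h with
      | single h => exact h.1
      | tail _ h ih => exact Relation.TransGen.trans ih h.1

end LabelledHeap

theorem IsIrreducibleWord.not_isRegularClass {P : Type*} {C : ConcurrencyRelation P} {ι : Type}
    [Finite ι] [LinearOrder ι] {w : ι → P} (hw : IsIrreducibleWord C w) : ¬ IsRegularClass C := by
  -- The heap lives on `ι` itself with a second, weaker order; the bijection `φ` keeps the two
  -- orders apart.
  obtain ⟨E, φ, hlab, hlt, hrel⟩ : ∃ (E : LabelledHeap C) (φ : E.carrier ≃ ι),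
      (∀ x, E.label x = w (φ x)) ∧ (∀ x y, x < y → φ x < φ y) ∧
      ∀ x y, φ x < φ y → C.rel (w (φ x)) (w (φ y)) → x < y := by
    have key : ∀ i j, Relation.TransGen (fun i j => i ≤ j ∧ C.rel (w i) (w j)) i j → i ≤ j :=
      fun i j h => by
        induction h with
        | single h => exact h.1
        | tail _ h ih => exact ih.trans h.1
    refine ⟨LabelledHeap.ofWord C w, Equiv.refl ι, fun _ => rfl, fun x y h => ?_, fun x y h k => ?_⟩
    · exact lt_of_le_of_ne (key x y h.le) h.ne
    · exact lt_of_le_of_ne (.single ⟨h.le, k⟩) h.ne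
  have hrel' : ∀ x k, φ x < k → C.rel (w (φ x)) (w k) → x < φ.symm k := fun x k h1 h2 =>
    hrel x (φ.symm k) (by simpa using h1) (by simpa using h2)
  have hrel'' : ∀ x k, k < φ x → C.rel (w (φ x)) (w k) → φ.symm k < x := fun x k h1 h2 =>
    hrel (φ.symm k) x (by simpa using h1) (by simpa using C.symm _ _ h2)
  have hfc : ∀ x y, x < y → E.label x = E.label y →
      ∃ k l, k ≠ l ∧ (x < k ∧ k < y) ∧ (x < l ∧ l < y) := by
    intro x y h e
    rw [hlab, hlab] at e
    obtain ⟨k, l, hkl, hk, hl, ak, al⟩ := hw.two_between _ _ (hlt x y h) e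
    exact ⟨φ.symm k, φ.symm l, by simpa using hkl,
      ⟨hrel' x k hk.1 ak, hrel'' y k hk.2 (e ▸ ak)⟩, ⟨hrel' x l hl.1 al, hrel'' y l hl.2 (e ▸ al)⟩⟩
  refine LabelledHeap.HasP2.not_isRegularClass (E := E) ?_ ?_ ?_ ?_
  · intro t x hx
    have h0 : t + 1 ≠ 1 → x 0 < x (Fin.last t) := fun ht => hx.1.1 (Fin.lt_def.2 (by simp; omega))
    refine ⟨fun ht => ?_, fun ht => ?_⟩
    · obtain ⟨k, l, -, hk, -⟩ := hfc _ _ (h0 (by omega)) hx.2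
      obtain ⟨i, rfl⟩ := hx.1.2 _ _ k hk.1 hk.2
      have h1 := Fin.lt_def.1 (hx.1.1.lt_iff_lt.1 hk.1)
      have h2 := Fin.lt_def.1 (hx.1.1.lt_iff_lt.1 hk.2)
      simp at h1 h2
      omega
    · obtain ⟨k, l, hkl, hk, hl⟩ := hfc _ _ (h0 (by omega)) hx.2
      obtain ⟨i, rfl⟩ := hx.1.2 _ _ k hk.1 hk.2
      obtain ⟨j, rfl⟩ := hx.1.2 _ _ l hl.1 hl.2
      have h1 := Fin.lt_def.1 (hx.1.1.lt_iff_lt.1 hk.1)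
      have h2 := Fin.lt_def.1 (hx.1.1.lt_iff_lt.1 hk.2)
      have h3 := Fin.lt_def.1 (hx.1.1.lt_iff_lt.1 hl.1)
      have h4 := Fin.lt_def.1 (hx.1.1.lt_iff_lt.1 hl.2)
      simp only [Fin.val_zero, Fin.val_last] at h1 h2 h3 h4
      exact hkl (congrArg x (Fin.ext (by omega)))
  · obtain ⟨i, j, hij, h⟩ := hw.nontrivial
    intro ht
    have := hrel' (φ.symm i) j (by simpa using hij) (by simpa using h)
    exact this.ne (ht _ _ this.le)
  · intro a b ha hb
    by_contra! hno
    obtain ⟨z, z1, -, z3⟩ := E.exists_rel_above hb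
    rw [hno z z1, hlab, hlab] at z3
    rcases hw.up _ _ (hlt b a hb) z3 with ⟨k, k1, k2, k3⟩ | ⟨k, k1, k2⟩
    · exact k2 (by rw [← hno _ (hrel' b k k1 k3), φ.apply_symm_apply])
    · exact ha.not_lt (hrel' a k k1 k2)
  · intro a b ha hb
    by_contra! hno
    obtain ⟨z, -, z1, z3⟩ := E.exists_rel_below hb
    rw [hno z z1, hlab, hlab] at z3
    rcases hw.down _ _ (hlt a b hb) (C.symm _ _ z3) with ⟨k, k1, k2, k3⟩ | ⟨k, k1, k2⟩
    · exact k2 (by rw [← hno _ (hrel'' b k k1 k3), φ.apply_symm_apply])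
    · exact ha.not_lt (hrel'' a k k1 k2)

/-! ### Listed components give regular classes -/

namespace TripodGraph

variable {ℓ : Fin 3 → ℕ}

/-- The vertex at distance `k` from the centre on the `i`-th arm. -/
def vertex (ℓ : Fin 3 → ℕ) (i : Fin 3) : ℕ → Option (Σ i : Fin 3, Fin (ℓ i))
  | 0 => none
  -- Past the end of the arm the value is a dummy.
  | k + 1 => if h : k < ℓ i then some ⟨i, ⟨k, h⟩⟩ else none

theorem vertex_succ {i : Fin 3} {k : ℕ} (h : k < ℓ i) :
    vertex ℓ i (k + 1) = some ⟨i, ⟨k, h⟩⟩ := by simp [vertex, h]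

theorem exists_vertex (v : Option (Σ i : Fin 3, Fin (ℓ i))) : ∃ i k, k ≤ ℓ i ∧ v = vertex ℓ i k := by
  rcases v with _ | ⟨i, k, hk⟩
  · exact ⟨0, 0, Nat.zero_le _, rfl⟩
  · exact ⟨i, k + 1, hk, (vertex_succ hk).symm⟩

theorem adj_vertex {i : Fin 3} {k : ℕ} (h : k < ℓ i) :
    (tripodGraph ℓ).Adj (vertex ℓ i k) (vertex ℓ i (k + 1)) := by
  rw [vertex_succ h]
  cases k with
  | zero => simp [tripodGraph, vertex]
  | succ k =>
    rw [vertex_succ (by omega)]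
    simp [tripodGraph]

theorem eq_of_adj_none {v : Option (Σ i : Fin 3, Fin (ℓ i))} (h : (tripodGraph ℓ).Adj none v) :
    ∃ i, 0 < ℓ i ∧ v = vertex ℓ i 1 := by
  rcases v with _ | ⟨i, k, hk⟩
  · exact absurd rfl h.ne
  · simp [tripodGraph] at h
    subst h
    exact ⟨i, hk, (vertex_succ hk).symm⟩

theorem eq_of_adj_vertex {i : Fin 3} {k : ℕ} (hk : k + 1 ≤ ℓ i)
    {v : Option (Σ i : Fin 3, Fin (ℓ i))} (h : (tripodGraph ℓ).Adj (vertex ℓ i (k + 1)) v) :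
    v = vertex ℓ i k ∨ (k + 1 < ℓ i ∧ v = vertex ℓ i (k + 2)) := by
  rw [vertex_succ hk] at h
  rcases v with _ | ⟨j, l, hl⟩
  · simp [tripodGraph] at h
    subst h
    exact .inl rfl
  · simp [tripodGraph] at h
    rcases h.2 with ⟨rfl, e⟩ | ⟨rfl, e⟩
    · subst e
      exact .inr ⟨hl, (vertex_succ hl).symm⟩
    · subst e
      exact .inl (vertex_succ hl).symm

end TripodGraph

namespace LabelledHeap

open SimpleGraph

variable {P : Type*} {C : ConcurrencyRelation P}

theorem false_of_tripod {E : LabelledHeap C} (h : IsReducedPoset C.graph E.label)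
    {K : C.graph.ConnectedComponent} {ℓ : Fin 3 → ℕ} (hF : TripodLabels.AdmissibleLengths ℓ)
    (e : K.toSimpleGraph ≃g tripodGraph ℓ) {x z : E.carrier} (hx : E.label x ∈ K)
    (hz : C.graph.Adj (E.label x) (E.label z)) : False := by
  have mem : ∀ v : K, ∀ w, C.graph.Adj v w → w ∈ K := fun v w hw =>
    (K.mem_supp_congr_adj hw).1 v.2
  have key : ∀ (v : K) w, C.graph.Adj v w →
      ∃ w' : K, w = w' ∧ (tripodGraph ℓ).Adj (e v) (e w') := fun v w hw =>
    ⟨⟨w, mem v w hw⟩, rfl, e.map_adj_iff.2 hw⟩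
  have T : TripodLabels C.graph E.label (e.symm none : K)
      (fun i k => (e.symm (TripodGraph.vertex ℓ i k) : K)) ℓ := by
    refine ⟨fun i => rfl, fun i k hk => ?_, fun x hx => ?_, fun i k x hk hx => ?_⟩
    · exact e.symm.map_adj_iff.2 (TripodGraph.adj_vertex hk)
    · obtain ⟨w, e1, e2⟩ := key _ _ hx
      rw [e.apply_symm_apply] at e2
      obtain ⟨i, hi, e3⟩ := TripodGraph.eq_of_adj_none e2
      exact ⟨i, hi, by rw [e1, ← e3, e.symm_apply_apply]⟩
    · obtain ⟨w, e1, e2⟩ := key _ _ hx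
      rw [e.apply_symm_apply] at e2
      refine (TripodGraph.eq_of_adj_vertex hk e2).imp (fun e3 => ?_) fun e3 => ⟨e3.1, ?_⟩
      · rw [e1, ← e3, e.symm_apply_apply]
      · rw [e1, ← e3.2, e.symm_apply_apply]
  obtain ⟨i, k, hk, e1⟩ := TripodGraph.exists_vertex (e ⟨_, hx⟩)
  exact TripodLabels.false_of_adj h T hF hk (x := x) (by simp only [← e1, e.symm_apply_apply]) hz

/-- A path is a tripod centred at one of its ends, with arms of lengths `0`, `0` and `n - 1`. -/
theorem false_of_path {E : LabelledHeap C} (h : IsReducedPoset C.graph E.label)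
    {K : C.graph.ConnectedComponent} {n : ℕ} (e : K.toSimpleGraph ≃g pathGraph n) {x z : E.carrier}
    (hx : E.label x ∈ K) (hz : C.graph.Adj (E.label x) (E.label z)) : False := by
  have hn : 0 < n := (Nat.zero_le _).trans_lt (e ⟨_, hx⟩).2
  have key : ∀ (v : K) w, C.graph.Adj v w →
      ∃ w' : K, w = w' ∧ (pathGraph n).Adj (e v) (e w') := fun v w hw =>
    ⟨⟨w, (K.mem_supp_congr_adj hw).1 v.2⟩, rfl, e.map_adj_iff.2 hw⟩
  let b : ℕ → K := fun k => if hk : k < n then e.symm ⟨k, hk⟩ else e.symm ⟨0, hn⟩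
  have hb : ∀ k (hk : k < n), b k = e.symm ⟨k, hk⟩ := fun k hk => by simp [b, hk]
  have hb' : ∀ w : K, w = b (e w) := fun w => by simp [hb _ (e w).2]
  have T : TripodLabels C.graph E.label (b 0)
      (fun i k => if i = 2 then (b k : P) else b 0) ![0, 0, n - 1] := by
    refine ⟨fun i => by simp, fun i k hk => ?_, fun x hx => ⟨2, ?_⟩, fun i k x hk hx => ?_⟩
    · fin_cases i
      · simp at hk
      · simp at hk
      · replace hk : k < n - 1 := hk
        change C.graph.Adj (b k) (b (k + 1))
        rw [hb k (by omega), hb (k + 1) (by omega)]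
        exact e.symm.map_adj_iff.2 (by simp [pathGraph_adj])
    · obtain ⟨w, e1, e2⟩ := key _ _ hx
      rw [hb 0 hn, e.apply_symm_apply, pathGraph_adj] at e2
      have e3 : (e w).val = 1 := by simpa [eq_comm] using e2
      have := (e w).2
      refine ⟨by change 0 < n - 1; omega, ?_⟩
      rw [e1, hb' w, e3]; simp
    · fin_cases i
      · simp at hk
      · simp at hk
      · replace hk : k + 1 ≤ n - 1 := hk
        change C.graph.Adj (b (k + 1)) (E.label x) at hx
        change E.label x = b k ∨ (k + 1 < n - 1 ∧ E.label x = b (k + 2))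
        obtain ⟨w, e1, e2⟩ := key _ _ hx
        rw [hb (k + 1) (by omega), e.apply_symm_apply, pathGraph_adj] at e2
        have := (e w).2
        rcases e2 with e2 | e2
        · right
          refine ⟨by simp at e2; omega, ?_⟩
          rw [e1, hb' w, ← e2]
        · left
          rw [e1, hb' w]
          congr 2
          simpa using e2
  have hlt := (e ⟨_, hx⟩).2
  exact TripodLabels.false_of_adj h T (.inl (by simp)) (i := 2) (k := e ⟨_, hx⟩)
    (by change (e ⟨_, hx⟩ : ℕ) ≤ n - 1; omega) (x := x) (by simp [← hb']) hz

theorem false_of_cycle {E : LabelledHeap C} (h : IsReducedPoset C.graph E.label)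
    {K : C.graph.ConnectedComponent} {n : ℕ} (hn : 3 ≤ n) (hodd : Odd n)
    (e : K.toSimpleGraph ≃g cycleGraph n) {x z : E.carrier}
    (hx : E.label x ∈ K) (hz : C.graph.Adj (E.label x) (E.label z)) : False := by
  obtain ⟨n, rfl⟩ : ∃ m, n = m + 2 := ⟨n - 2, by omega⟩
  have key : ∀ (k : Fin (n + 2)) w, C.graph.Adj (e.symm k) w →
      ∃ w' : K, w = w' ∧ (k - e w' = 1 ∨ e w' - k = 1) := fun k w hw => by
    refine ⟨⟨w, (K.mem_supp_congr_adj hw).1 (e.symm k).2⟩, rfl, cycleGraph_adj.1 ?_⟩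
    rw [← e.symm.map_adj_iff, e.symm_apply_apply]
    exact hw
  have T : CycleLabels C.graph E.label (n + 2) (fun k : Fin (n + 2) => (e.symm k : P)) := by
    refine ⟨fun k => ?_, fun k x hx => ?_⟩
    · refine e.symm.map_adj_iff.2 (cycleGraph_adj.2 (.inr ?_))
      exact add_sub_cancel_left (G := ZMod (n + 2)) k 1
    · obtain ⟨w, e1, e2⟩ := key _ _ hx
      refine e2.imp (fun e3 => ?_) fun e3 => ?_
      · have : e w = (k - 1 : ZMod (n + 2)) := by
          have e3 : @HSub.hSub (ZMod (n + 2)) (ZMod (n + 2)) _ _ k (e w) = 1 := e3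
          rw [← e3]; exact (sub_sub_cancel (G := ZMod (n + 2)) k (e w)).symm
        rw [e1]
        exact congrArg Subtype.val ((e.symm_apply_apply w).symm.trans (congrArg e.symm this))
      · have : e w = (k + 1 : ZMod (n + 2)) := by
          have e3 : @HSub.hSub (ZMod (n + 2)) (ZMod (n + 2)) _ _ (e w) k = 1 := e3
          rw [← e3]; exact (add_sub_cancel (G := ZMod (n + 2)) k (e w)).symm
        rw [e1]
        exact congrArg Subtype.val ((e.symm_apply_apply w).symm.trans (congrArg e.symm this))
  exact T.false_of_adj h hn hodd (k := e ⟨_, hx⟩) (x := x) (by simp) hz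

theorem false_of_isListedGraph {E : LabelledHeap C} (h : IsReducedPoset C.graph E.label)
    {K : C.graph.ConnectedComponent} (hK : IsListedGraph K.toSimpleGraph) {x z : E.carrier}
    (hx : E.label x ∈ K) (hz : C.graph.Adj (E.label x) (E.label z)) : False := by
  rcases hK with ⟨n, -, ⟨e⟩⟩ | ⟨n, -, ⟨e⟩⟩ | ⟨n, -, ⟨e⟩⟩ | ⟨n, -, ⟨e⟩⟩ | ⟨n, hn, ho, ⟨e⟩⟩ | ⟨⟨e⟩⟩
  · refine h.false_of_clique (K := K.supp) (fun v hv w hw => (K.mem_supp_congr_adj hw).1 hv) ?_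
      hx hz
    intro v hv w hw hne
    have : (⊤ : SimpleGraph (Fin n)).Adj (e ⟨v, hv⟩) (e ⟨w, hw⟩) := by
      simpa using hne
    exact e.map_adj_iff.1 this
  · exact false_of_path h e hx hz
  · exact false_of_tripod h (.inl (by simp)) e hx hz
  · exact false_of_tripod h (.inl (by simp)) e hx hz
  · exact false_of_cycle h hn ho e hx hz
  · exact false_of_tripod h (.inr (by decide)) e hx hz

/-- A nontrivial irreducible heap with P2 has two vertices with adjacent labels, which each listed
type of component forbids. -/
theorem isRegularClass_of_isListedGraph
    (hC : ∀ K : C.graph.ConnectedComponent, IsListedGraph K.toSimpleGraph) : IsRegularClass C := by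
  refine isRegularClass_of_forall fun E hE hmax hmin x y hxy => ?_
  by_contra hne
  obtain ⟨z, -, hz⟩ := hE.exists_adj_above (lt_of_le_of_ne hxy hne)
  exact false_of_isListedGraph (hE.isReducedPoset hmax hmin)
    (hC (C.graph.connectedComponentMk (E.label x))) (x := x) rfl hz

end LabelledHeap

/-! ### Forbidden words: forks and even cycles -/

/-- The concurrency relation with a given concurrency graph. -/
def ConcurrencyRelation.ofGraph {V : Type*} (H : SimpleGraph V) : ConcurrencyRelation V where
  rel v w := v = w ∨ H.Adj v w
  refl _ := .inl rfl
  symm _ _ h := h.imp Eq.symm fun k => k.symm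

/-- No irreducible word gives a nontrivial heap with property P2. -/
def SimpleGraph.WordFree {V : Type*} (H : SimpleGraph V) : Prop :=
  ∀ (n : ℕ) (w : Fin n → V), ¬ IsIrreducibleWord (ConcurrencyRelation.ofGraph H) w

theorem IsIrreducibleWord.transfer {V W ι : Type*} [LT ι] {C : ConcurrencyRelation V}
    {D : ConcurrencyRelation W} {w : ι → V} {w' : ι → W} (hw : IsIrreducibleWord C w)
    (heq : ∀ i j, w' i = w' j → w i = w j)
    (hrel : ∀ i j, D.rel (w' i) (w' j) ↔ C.rel (w i) (w j)) : IsIrreducibleWord D w' where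
  two_between i j hij e := by
    simpa only [hrel] using hw.two_between i j hij (heq i j e)
  up b a h := by simpa only [hrel] using hw.up b a h
  down b a h := by simpa only [hrel] using hw.down b a h
  nontrivial := by simpa only [hrel] using hw.nontrivial

/-- A word in a component, read in `P`, keeps its equalities and concurrences, so it stays
irreducible. -/
theorem IsRegularClass.wordFree {P : Type*} {C : ConcurrencyRelation P} (hC : IsRegularClass C)
    (K : C.graph.ConnectedComponent) : K.toSimpleGraph.WordFree := by
  intro n w hw
  refine IsIrreducibleWord.not_isRegularClass (w := fun i => (w i : P)) (C := C)
    (hw.transfer (fun i j e => Subtype.ext e) fun i j => ?_) hC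
  change C.rel (w i) (w j) ↔ w i = w j ∨ ((w i : P) ≠ w j ∧ C.rel (w i) (w j))
  rw [← Subtype.coe_inj]
  constructor
  · intro h
    by_cases e : (w i : P) = w j
    · exact .inl e
    · exact .inr ⟨e, h⟩
  · rintro (e | h)
    · rw [e]; exact C.refl _
    · exact h.2

namespace SimpleGraph.WordFree

variable {V : Type*} {H : SimpleGraph V}

/-- A non-backtracking walk cannot join two pairs of nonadjacent neighbours of its ends. -/
theorem false_of_forks (hH : H.WordFree) (m : ℕ) (c : ℕ → V)
    (hc : ∀ i < m, H.Adj (c i) (c (i + 1))) (hc2 : ∀ i, i + 2 ≤ m → c i ≠ c (i + 2))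
    {x y z w : V} (hxy : x ≠ y) (nxy : ¬ H.Adj x y) (hx : H.Adj (c 0) x) (hy : H.Adj (c 0) y)
    (hzw : z ≠ w) (nzw : ¬ H.Adj z w) (hz : H.Adj (c m) z) (hw : H.Adj (c m) w)
    (hm : m ≠ 0 → x ≠ c 1 ∧ y ≠ c 1 ∧ z ≠ c (m - 1) ∧ w ≠ c (m - 1))
    (h0 : m = 0 → x ≠ z ∧ x ≠ w ∧ y ≠ z ∧ y ≠ w) : False := by
  -- The word is `x y c₀ … cₘ z w`, with the walk shifted by two positions.
  obtain ⟨f, f0, f1, fm, fz, fw⟩ : ∃ f : ℕ → V, f 0 = x ∧ f 1 = y ∧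
      (∀ k ≤ m, f (k + 2) = c k) ∧ f (m + 3) = z ∧ f (m + 4) = w :=
    ⟨fun k => if k = 0 then x else if k = 1 then y else if k ≤ m + 2 then c (k - 2) else
      if k = m + 3 then z else w, by simp, by simp, fun k hk => by simp [hk], by simp, by simp⟩
  let D := ConcurrencyRelation.ofGraph H
  have adj : ∀ {v w}, H.Adj v w → D.rel v w := fun h => .inr h
  have next : ∀ i, 1 ≤ i → i ≤ m + 2 → H.Adj (f i) (f (i + 1)) := by
    intro i h1 h2
    rcases Nat.lt_or_ge i 2 with l | l
    · rw [show i = 1 by omega, f1, fm 0 (Nat.zero_le _)]; exact hy.symm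
    obtain ⟨k, rfl⟩ : ∃ k, i = k + 2 := ⟨i - 2, by omega⟩
    rcases Nat.lt_or_ge k m with l | l
    · rw [fm k l.le, show k + 2 + 1 = (k + 1) + 2 by omega, fm (k + 1) l]; exact hc k l
    · rw [show k = m by omega, fm m le_rfl, fz]; exact hz
  have next0 : H.Adj (f 0) (f 2) := by rw [f0, fm 0 (Nat.zero_le _)]; exact hx.symm
  have nextm : H.Adj (f (m + 2)) (f (m + 4)) := by rw [fm m le_rfl, fw]; exact hw
  have hup : ∀ i, i ≤ m + 2 → ∃ j, i < j ∧ j ≤ m + 3 ∧ (i < m + 2 → j < m + 3) ∧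
      D.rel (f i) (f j) := by
    intro i hi
    rcases Nat.eq_zero_or_pos i with rfl | l
    · exact ⟨2, by omega, by omega, by omega, adj next0⟩
    · exact ⟨i + 1, by omega, by omega, by omega, adj (next i l hi)⟩
  have hdown : ∀ i, 2 ≤ i → i ≤ m + 4 → ∃ j, j < i ∧ 1 ≤ j ∧ (2 < i → 1 < j) ∧
      D.rel (f i) (f j) := by
    intro i h2 h4
    rcases h4.lt_or_eq with l | rfl
    · refine ⟨i - 1, by omega, by omega, by omega, adj ?_⟩
      have := next (i - 1) (by omega) (by omega)
      rw [Nat.sub_add_cancel (by omega)] at this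
      exact this.symm
    · exact ⟨m + 2, by omega, by omega, by omega, adj nextm.symm⟩
  have rel01 : ¬ D.rel (f 0) (f 1) := by
    rw [f0, f1]; exact fun h => h.elim hxy nxy
  have relzw : ¬ D.rel (f (m + 3)) (f (m + 4)) := by
    rw [fz, fw]; exact fun h => h.elim hzw nzw
  have far : ∀ i j, i < j → j ≤ m + 4 → f i = f j →
      ∃ k l, k ≠ l ∧ (i < k ∧ k < j) ∧ (i < l ∧ l < j) ∧ D.rel (f i) (f k) ∧ D.rel (f i) (f l) := by
    intro i j hij hj e
    have n1 : i = 0 → j ≠ 1 := by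
      rintro rfl rfl; rw [f0, f1] at e; exact hxy e
    have n2 : i = m + 3 → j ≠ m + 4 := by
      rintro rfl rfl; rw [fz, fw] at e; exact hzw e
    obtain ⟨k, k1, k2, k3, k4⟩ : ∃ k, i < k ∧ ((k = i + 1 ∧ 1 ≤ i) ∨ (i = 0 ∧ k = 2)) ∧ k ≤ m + 3 ∧
        H.Adj (f i) (f k) := by
      rcases Nat.eq_zero_or_pos i with rfl | l
      · exact ⟨2, by omega, by omega, by omega, next0⟩
      · exact ⟨i + 1, by omega, by omega, by omega, next i l (by omega)⟩
    obtain ⟨l, l1, l2, l3, l4⟩ : ∃ l, l < j ∧ ((l + 1 = j ∧ j ≤ m + 3) ∨ (j = m + 4 ∧ l = m + 2)) ∧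
        1 ≤ l ∧
        H.Adj (f l) (f j) := by
      rcases hj.lt_or_eq with l | rfl
      · refine ⟨j - 1, by omega, by omega, by omega, ?_⟩
        have := next (j - 1) (by omega) (by omega)
        rwa [Nat.sub_add_cancel (by omega)] at this
      · exact ⟨m + 2, by omega, by omega, by omega, nextm⟩
    have kj : k ≠ j := fun h => H.ne_of_adj k4 (h ▸ e)
    have il : i ≠ l := fun h => H.ne_of_adj l4 (h ▸ e)
    -- If the neighbour `k` after `i` were the neighbour `l` before `j`, equal letters would flank
    -- one letter of the walk. This is excluded by `hc2` inside the walk, by `hm` at its ends and by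
    -- `h0` when `m = 0`.
    have kl : k ≠ l := by
      rintro rfl
      rcases Nat.eq_zero_or_pos m with h | h
      · obtain ⟨a1, a2, a3, a4⟩ := h0 h
        subst h
        have hi : i = 0 ∨ i = 1 := by omega
        have hj : j = 3 ∨ j = 4 := by omega
        rcases hi with rfl | rfl <;> rcases hj with rfl | rfl
        · exact a1 (f0.symm.trans (e.trans fz))
        · exact a2 (f0.symm.trans (e.trans fw))
        · exact a3 (f1.symm.trans (e.trans fz))
        · exact a4 (f1.symm.trans (e.trans fw))
      · obtain ⟨a1, a2, a3, a4⟩ := hm h.ne'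
        rcases Nat.lt_or_ge i 2 with hi | hi
        · have hj : j = 3 := by omega
          subst hj
          rw [fm 1 h] at e
          have : i = 0 ∨ i = 1 := by omega
          rcases this with rfl | rfl
          · exact a1 (f0.symm.trans e)
          · exact a2 (f1.symm.trans e)
        · rcases Nat.lt_or_ge (m + 2) j with hj | hj
          · have hi : i = m - 1 + 2 := by omega
            subst hi
            rw [fm (m - 1) (by omega)] at e
            have : j = m + 3 ∨ j = m + 4 := by omega
            rcases this with rfl | rfl
            · exact a3 (fz.symm.trans e.symm)
            · exact a4 (fw.symm.trans e.symm)
          · obtain ⟨p, rfl⟩ : ∃ p, i = p + 2 := ⟨i - 2, by omega⟩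
            have hj : j = p + 2 + 2 := by omega
            subst hj
            rw [fm p (by omega), fm (p + 2) (by omega)] at e
            exact hc2 p (by omega) e
    exact ⟨k, l, kl, by omega, by omega, adj k4, adj (e ▸ l4.symm)⟩
  refine hH (m + 5) (fun i => f i) ⟨fun i j hij e => ?_, fun b a hba hr => ?_,
    fun b a hab hr => ?_, ⟨⟨0, by omega⟩, ⟨2, by omega⟩, by simp [Fin.lt_def], adj next0⟩⟩
  · obtain ⟨k, l, h1, h2, h3, h4⟩ := far i j hij (by omega) e
    exact ⟨⟨k, by omega⟩, ⟨l, by omega⟩, by simpa using h1, h2, h3, h4⟩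
  · obtain ⟨b, hb⟩ := b
    obtain ⟨a, ha⟩ := a
    simp only [Fin.lt_def] at hba hr ⊢
    rcases Nat.lt_or_ge a (m + 3) with l | l
    · obtain ⟨j, j1, j2, -, j4⟩ := hup a (by omega)
      exact .inr ⟨⟨j, by omega⟩, j1, j4⟩
    left
    rcases Nat.lt_or_ge b (m + 2) with l' | l'
    · obtain ⟨j, j1, j2, j3, j4⟩ := hup b (by omega)
      have := j3 l'
      exact ⟨⟨j, by omega⟩, j1, by simp only [ne_eq, Fin.mk.injEq]; omega, j4⟩
    · have hb' : b = m + 2 := by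
        by_contra hne
        exact relzw (by rwa [show b = m + 3 by omega, show a = m + 4 by omega] at hr)
      subst hb'
      rcases Nat.lt_or_ge a (m + 4) with l | l
      · exact ⟨⟨m + 4, by omega⟩, by simp, by simp only [ne_eq, Fin.mk.injEq]; omega, adj nextm⟩
      · exact ⟨⟨m + 3, by omega⟩, by simp, by simp only [ne_eq, Fin.mk.injEq]; omega,
          adj (next (m + 2) (by omega) le_rfl)⟩
  · obtain ⟨b, hb⟩ := b
    obtain ⟨a, ha⟩ := a
    simp only [Fin.lt_def] at hab hr ⊢
    rcases Nat.lt_or_ge 1 a with l | l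
    · obtain ⟨j, j1, j2, -, j4⟩ := hdown a (by omega) (by omega)
      exact .inr ⟨⟨j, by omega⟩, j1, j4⟩
    left
    rcases Nat.lt_or_ge 2 b with l' | l'
    · obtain ⟨j, j1, j2, j3, j4⟩ := hdown b (by omega) (by omega)
      have := j3 l'
      exact ⟨⟨j, by omega⟩, j1, by simp only [ne_eq, Fin.mk.injEq]; omega, j4⟩
    · have hb' : b = 2 := by
        by_contra hne
        exact rel01 (D.symm _ _ (by rwa [show b = 1 by omega, show a = 0 by omega] at hr))
      subst hb'
      rcases Nat.eq_zero_or_pos a with l | l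
      · exact ⟨⟨1, by omega⟩, by simp, by simp only [ne_eq, Fin.mk.injEq]; omega,
          adj (next 1 le_rfl (by omega)).symm⟩
      · exact ⟨⟨0, by omega⟩, by simp, by simp only [ne_eq, Fin.mk.injEq]; omega, adj next0.symm⟩

/-- There is no induced even cycle. -/
theorem false_of_even_cycle (hH : H.WordFree) {m : ℕ} (hm : 2 ≤ m) (a : ℕ → V)
    (hinj : ∀ i < 2 * m, ∀ j < 2 * m, a i = a j → i = j)
    (hadj : ∀ i < 2 * m, ∀ j < 2 * m, H.Adj (a i) (a j) ↔
      (i + 1 = j ∨ j + 1 = i ∨ (i = 0 ∧ j + 1 = 2 * m) ∨ (j = 0 ∧ i + 1 = 2 * m))) : False := by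
  -- The word lists the even vertices and then the odd ones. No letter repeats, each even letter
  -- lies below both its neighbours, and these are distinct because `2 ≤ m`.
  let s : ℕ → ℕ := fun i => if i < m then 2 * i else 2 * (i - m) + 1
  have s1 : ∀ i, i < m → s i = 2 * i := fun i hi => by simp [s, hi]
  have s2 : ∀ i, m ≤ i → s i = 2 * (i - m) + 1 := fun i hi => by simp [s, Nat.not_lt.2 hi]
  have slt : ∀ i, i < 2 * m → s i < 2 * m := fun i hi => by
    rcases Nat.lt_or_ge i m with l | l
    · rw [s1 i l]; omega
    · rw [s2 i l]; omega
  have sinj : ∀ i j, i < j → j < 2 * m → a (s i) ≠ a (s j) := by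
    intro i j hij hj e
    have := hinj _ (slt i (by omega)) _ (slt j hj) e
    rcases Nat.lt_or_ge i m with l | l <;> rcases Nat.lt_or_ge j m with l' | l'
    · rw [s1 i l, s1 j l'] at this; omega
    · rw [s1 i l, s2 j l'] at this; omega
    · omega
    · rw [s2 i l, s2 j l'] at this; omega
  have key : ∀ i j, i < j → j < 2 * m → H.Adj (a (s i)) (a (s j)) →
      (i < m ∧ m ≤ j) ∧ (j = m + i ∨ j + 1 = m + i ∨ (i = 0 ∧ j + 1 = 2 * m)) := by
    intro i j hij hj e
    rw [hadj _ (slt i (by omega)) _ (slt j hj)] at e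
    rcases Nat.lt_or_ge i m with l | l <;> rcases Nat.lt_or_ge j m with l' | l'
    · rw [s1 i l, s1 j l'] at e; omega
    · rw [s1 i l, s2 j l'] at e; omega
    · omega
    · rw [s2 i l, s2 j l'] at e; omega
  have key' : ∀ i j, i < m → m ≤ j → j < 2 * m →
      (j = m + i ∨ j + 1 = m + i ∨ (i = 0 ∧ j + 1 = 2 * m)) → H.Adj (a (s i)) (a (s j)) := by
    intro i j h1 h2 h3 h4
    rw [hadj _ (slt i (by omega)) _ (slt j h3), s1 i h1, s2 j h2]
    omega
  refine hH (2 * m) (fun i => a (s i)) ⟨fun i j hij e => absurd e (sinj i j hij j.2),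
    fun b a' hba hr => .inl ?_, fun b a' hab hr => .inl ?_, ⟨⟨0, by omega⟩, ⟨m, by omega⟩,
      by simp only [Fin.lt_def]; omega, .inr (key' 0 m (by omega) le_rfl (by omega) (.inl rfl))⟩⟩
  · obtain ⟨b, hb⟩ := b
    obtain ⟨d, hd⟩ := a'
    simp only [Fin.lt_def, ne_eq] at hba hr ⊢
    obtain ⟨⟨h1, h2⟩, h3⟩ := key b d hba hd (hr.resolve_left (sinj b d hba hd))
    obtain ⟨k, k1, k2, k3⟩ : ∃ k, (m ≤ k ∧ k < 2 * m) ∧ k ≠ d ∧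
        (k = m + b ∨ k + 1 = m + b ∨ (b = 0 ∧ k + 1 = 2 * m)) := by
      rcases h3 with h | h
      · rcases Nat.eq_zero_or_pos b with hb | hb
        · exact ⟨2 * m - 1, by omega, by omega, by omega⟩
        · exact ⟨m + b - 1, by omega, by omega, by omega⟩
      · exact ⟨m + b, by omega, by omega, by omega⟩
    exact ⟨⟨k, k1.2⟩, by simp only; omega, by simpa using k2, .inr (key' b k h1 k1.1 k1.2 k3)⟩
  · obtain ⟨b, hb⟩ := b
    obtain ⟨d, hd⟩ := a'
    simp only [Fin.lt_def, ne_eq] at hab hr ⊢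
    obtain ⟨⟨h1, h2⟩, h3⟩ := key d b hab hb
      ((hr.resolve_left (sinj d b hab hb).symm).symm)
    obtain ⟨k, k1, k2, k3⟩ : ∃ k, k < m ∧ k ≠ d ∧
        (b = m + k ∨ b + 1 = m + k ∨ (k = 0 ∧ b + 1 = 2 * m)) := by
      rcases h3 with h | h
      · by_cases hb : b + 1 = 2 * m
        · exact ⟨0, by omega, by omega, by omega⟩
        · exact ⟨b + 1 - m, by omega, by omega, by omega⟩
      · exact ⟨b - m, by omega, by omega, by omega⟩
    exact ⟨⟨k, by omega⟩, by simp only; omega, by simpa using k2, .inr (key' k b k1 h2 hb k3).symm⟩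

end SimpleGraph.WordFree

/-! ### Words for the tripods with arms `1, 3, 3` and `2, 2, 3` -/

/-- The concurrency relation of three infinite arms glued along their initial vertices, where
`(0, 0)` is the only representative of the centre in use. -/
def armsRelation : ConcurrencyRelation (Fin 3 × ℕ) where
  rel p q := p = q ∨ (p.1 = q.1 ∧ (p.2 + 1 = q.2 ∨ q.2 + 1 = p.2)) ∨ (p.2 = 0 ∧ q.2 = 1) ∨
    (q.2 = 0 ∧ p.2 = 1)
  refl _ := .inl rfl
  symm p q := by
    rintro (h | ⟨h1, h2⟩ | h | h)
    · exact .inl h.symm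
    · exact .inr (.inl ⟨h1.symm, h2.symm⟩)
    · exact .inr (.inr (.inr h))
    · exact .inr (.inr (.inl h))

instance (p q : Fin 3 × ℕ) : Decidable (armsRelation.rel p q) :=
  inferInstanceAs (Decidable (p = q ∨ (p.1 = q.1 ∧ (p.2 + 1 = q.2 ∨ q.2 + 1 = p.2)) ∨
    (p.2 = 0 ∧ q.2 = 1) ∨ (q.2 = 0 ∧ p.2 = 1)))

/-- A word for the tripod with arms of lengths `1`, `3`, `3`. -/
def wordOneThreeThree : Fin 12 → Fin 3 × ℕ :=
  ![(0, 1), (2, 1), (2, 3), (0, 0), (2, 2), (1, 1), (2, 1), (0, 0), (1, 2), (0, 1), (1, 1), (1, 3)]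

/-- A word for the tripod with arms of lengths `2`, `2`, `3`. -/
def wordTwoTwoThree : Fin 20 → Fin 3 × ℕ :=
  ![(1, 1), (2, 1), (2, 3), (0, 0), (2, 2), (0, 1), (2, 1), (0, 0), (0, 2), (0, 1), (1, 1), (0, 0),
    (1, 2), (1, 1), (2, 1), (0, 0), (2, 2), (0, 1), (2, 1), (2, 3)]

set_option maxRecDepth 100000 in
theorem isIrreducibleWord_oneThreeThree : IsIrreducibleWord armsRelation wordOneThreeThree :=
  ⟨by decide, by decide, by decide, by decide⟩

set_option maxRecDepth 100000 in
theorem isIrreducibleWord_twoTwoThree : IsIrreducibleWord armsRelation wordTwoTwoThree :=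
  ⟨by decide, by decide, by decide, by decide⟩

/-! ### Word-free graphs: triangles and branch vertices -/

namespace SimpleGraph

variable {V : Type*} {H : SimpleGraph V}

theorem Preconnected.mem_of_adj_closed (h : H.Preconnected) {S : Set V} {v₀ : V} (h₀ : v₀ ∈ S)
    (hcl : ∀ v ∈ S, ∀ w, H.Adj v w → w ∈ S) (v : V) : v ∈ S := by
  have := (reachable_iff_reflTransGen v₀ v).1 (h v₀ v)
  induction this with
  | refl => exact h₀
  | tail _ hw ih => exact hcl _ ih _ hw

namespace WordFree

/-- There is no induced paw or diamond. -/
theorem adj_of_triangle (hH : H.WordFree) {v y z u : V} (vy : H.Adj v y) (vz : H.Adj v z)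
    (yz : H.Adj y z) (vu : H.Adj v u) (uy : u ≠ y) (uz : u ≠ z) : H.Adj u y := by
  by_contra nuy
  by_cases huz : H.Adj u z
  -- Diamond: the walk is the edge from `v` to `z`, with the fork `u`, `y` at both ends.
  · refine hH.false_of_forks 1 (fun k => if k = 0 then v else z) (fun i hi => ?_)
      (fun i hi => by omega) uy nuy vu vy uy nuy ?_ ?_ (fun _ => ?_) (fun h => by omega)
    · simpa [show i = 0 by omega] using vz
    · exact huz.symm
    · exact yz.symm
    · exact ⟨uz, yz.ne, vu.ne', vy.ne'⟩
  -- Paw: the walk goes once round the triangle, `v z y v`, with forks `u`, `y` and `u`, `z`.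
  · refine hH.false_of_forks 3
      (fun k => if k = 0 then v else if k = 1 then z else if k = 2 then y else v)
      (fun i hi => ?_) (fun i hi => ?_) uy nuy vu vy uz huz vu vz (fun _ => ?_)
      (fun h => by omega)
    · interval_cases i
      · exact vz
      · exact yz.symm
      · exact vy.symm
    · have : i = 0 ∨ i = 1 := by omega
      rcases this with rfl | rfl
      · exact vy.ne
      · exact vz.ne'
    · exact ⟨uz, yz.ne, uy, yz.ne'⟩

theorem neighbors_adj_of_triangle (hH : H.WordFree) {v y z u w : V} (vy : H.Adj v y)
    (vz : H.Adj v z) (yz : H.Adj y z) (vu : H.Adj v u) (vw : H.Adj v w) (huw : u ≠ w) :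
    H.Adj u w := by
  by_cases uy : u = y
  · subst uy
    by_cases wz : w = z
    · subst wz; exact yz
    · exact (hH.adj_of_triangle vu vz yz vw huw.symm wz).symm
  by_cases wy : w = y
  · subst wy
    by_cases uz : u = z
    · subst uz; exact yz.symm
    · exact hH.adj_of_triangle vw vz yz vu huw uz
  by_cases uz : u = z
  · subst uz
    exact (hH.adj_of_triangle vu vy yz.symm vw huw.symm wy).symm
  · have uy' := hH.adj_of_triangle vy vz yz vu uy uz
    exact (hH.adj_of_triangle vu vy uy' vw huw.symm wy).symm

/-- Every neighbour of `v` lies in a triangle with `v`, so its other neighbours are adjacent to `v`.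
By connectedness the closed neighbourhood of `v` is everything, and neighbours of `v` are pairwise
adjacent. -/
theorem adj_of_ne_of_triangle (hH : H.WordFree) (hc : H.Preconnected) {v y z : V} (vy : H.Adj v y)
    (vz : H.Adj v z) (yz : H.Adj y z) {u w : V} (huw : u ≠ w) : H.Adj u w := by
  have hnb : ∀ u w, H.Adj v u → H.Adj v w → u ≠ w → H.Adj u w := fun u w =>
    hH.neighbors_adj_of_triangle vy vz yz
  have key : ∀ u, u = v ∨ H.Adj v u := by
    refine hc.mem_of_adj_closed (S := {u | u = v ∨ H.Adj v u}) (.inl rfl) ?_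
    rintro u (rfl | hu) w hw
    · exact .inr hw
    by_cases e : w = v
    · exact .inl e
    right
    obtain ⟨t, ht, hut⟩ : ∃ t, H.Adj v t ∧ H.Adj u t := by
      by_cases uy : u = y
      · exact ⟨z, vz, uy ▸ yz⟩
      · exact ⟨y, vy, hnb u y hu vy uy⟩
    exact hH.neighbors_adj_of_triangle hu.symm hut ht hu.symm hw (Ne.symm e)
  rcases key u with rfl | hu
  · exact (key w).resolve_left huw.symm
  rcases key w with rfl | hw
  · exact hu.symm
  · exact hnb u w hu hw huw

end WordFree

/-- A vertex with at least three neighbours. -/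
def HasThree (H : SimpleGraph V) (v : V) : Prop :=
  ∃ x y z, x ≠ y ∧ x ≠ z ∧ y ≠ z ∧ H.Adj v x ∧ H.Adj v y ∧ H.Adj v z

theorem HasThree.exists_two {v : V} (h : H.HasThree v) (t : V) :
    ∃ p q, p ≠ q ∧ H.Adj v p ∧ H.Adj v q ∧ p ≠ t ∧ q ≠ t := by
  obtain ⟨x, y, z, xy, xz, yz, hx, hy, hz⟩ := h
  by_cases e : x = t
  · subst e
    exact ⟨y, z, yz, hy, hz, xy.symm, xz.symm⟩
  by_cases e' : y = t
  · subst e'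
    exact ⟨x, z, xz, hx, hz, e, yz.symm⟩
  · exact ⟨x, y, xy, hx, hy, e, e'⟩

namespace WordFree

/-- A path joins two distinct branch vertices, and each has two neighbours other than the next
vertex of the path; these are nonadjacent for lack of triangles, so `false_of_forks` applies. -/
theorem eq_of_hasThree (hH : H.WordFree) (hc : H.Preconnected)
    (ht : ∀ v y z, H.Adj v y → H.Adj v z → ¬ H.Adj y z) {u v : V} (hu : H.HasThree u)
    (hv : H.HasThree v) : u = v := by
  classical
  by_contra hne
  obtain ⟨p, hp⟩ : ∃ p : H.Walk u v, p.IsPath := by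
    obtain ⟨p⟩ := hc u v
    exact ⟨p.bypass, p.bypass_isPath⟩
  have hinj : ∀ i ≤ p.length, ∀ j ≤ p.length, p.getVert i = p.getVert j → i = j :=
    fun i hi j hj e => hp.getVert_injOn hi hj e
  have hl : p.length ≠ 0 := fun h => hne (Walk.eq_of_length_eq_zero h)
  obtain ⟨x, y, xy, hx, hy, x1, y1⟩ := hu.exists_two (p.getVert 1)
  obtain ⟨z, w, zw, hz, hw, z1, w1⟩ := hv.exists_two (p.getVert (p.length - 1))
  refine hH.false_of_forks p.length p.getVert (fun i hi => p.adj_getVert_succ hi)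
    (fun i hi e => ?_) xy (ht _ _ _ hx hy) (by simpa using hx) (by simpa using hy) zw
    (ht _ _ _ hz hw) (by simpa using hz) (by simpa using hw) (fun _ => ⟨x1, y1, z1, w1⟩)
    fun h => absurd h hl
  have := hinj i (by omega) (i + 2) hi e
  omega

/-- A fourth neighbour would give two disjoint forks at `v`, joined by the walk of length zero. -/
theorem eq_of_adj_of_hasThree (hH : H.WordFree)
    (ht : ∀ v y z, H.Adj v y → H.Adj v z → ¬ H.Adj y z) {v x y z w : V} (hx : H.Adj v x)
    (hy : H.Adj v y) (hz : H.Adj v z) (xy : x ≠ y) (xz : x ≠ z) (yz : y ≠ z) (hw : H.Adj v w) :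
    w = x ∨ w = y ∨ w = z := by
  by_contra! hne
  obtain ⟨wx, wy, wz⟩ := hne
  exact hH.false_of_forks 0 (fun _ => v) (fun i hi => by omega) (fun i hi => by omega) xy
    (ht _ _ _ hx hy) hx hy wz.symm (ht _ _ _ hz hw) hz hw (fun h => absurd rfl h)
    fun _ => ⟨xz, wx.symm, yz, wy.symm⟩

end WordFree

/-! ### No branch vertex: longest paths -/

/-- A sequence whose terms with indices at most `n` form a path. -/
structure IsPathSeq (H : SimpleGraph V) (n : ℕ) (a : ℕ → V) : Prop where
  inj : ∀ i ≤ n, ∀ j ≤ n, a i = a j → i = j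
  adj : ∀ i < n, H.Adj (a i) (a (i + 1))

theorem lt_card_of_inj [Finite V] {n : ℕ} {a : ℕ → V}
    (h : ∀ i ≤ n, ∀ j ≤ n, a i = a j → i = j) : n < Nat.card V := by
  have := Nat.card_le_card_of_injective (fun i : Fin (n + 1) => a i) fun i j e =>
    Fin.ext (h i (by omega) j (by omega) e)
  simpa using this

namespace IsPathSeq

theorem reverse {n : ℕ} {a : ℕ → V} (h : H.IsPathSeq n a) : H.IsPathSeq n fun k => a (n - k) where
  inj i hi j hj e := by
    have := h.inj (n - i) (by omega) (n - j) (by omega) e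
    omega
  adj i hi := by
    have := (h.adj (n - (i + 1)) (by omega)).symm
    rwa [show n - (i + 1) + 1 = n - i by omega] at this

theorem exists_maximal [Finite V] [Nonempty V] (H : SimpleGraph V) :
    ∃ n a, H.IsPathSeq n a ∧ ∀ b, ¬ H.IsPathSeq (n + 1) b := by
  by_contra! hno
  have all : ∀ n, ∃ a, H.IsPathSeq n a := by
    intro n
    induction n with
    | zero => exact ⟨fun _ => Classical.arbitrary V, fun i hi j hj _ => by omega,
        fun i hi => by omega⟩
    | succ n ih =>
      obtain ⟨a, ha⟩ := ih
      exact hno n a ha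
  obtain ⟨a, ha⟩ := all (Nat.card V)
  exact lt_irrefl _ (lt_card_of_inj ha.inj)

theorem exists_of_adj_last {n : ℕ} {a : ℕ → V} (h : H.IsPathSeq n a)
    (hmax : ∀ b, ¬ H.IsPathSeq (n + 1) b) {x : V} (hx : H.Adj (a n) x) : ∃ j ≤ n, x = a j := by
  by_contra! hno
  refine hmax (fun k => if k ≤ n then a k else x) ⟨fun i hi j hj e => ?_, fun i hi => ?_⟩
  · split_ifs at e with h1 h2 h2
    · exact h.inj i h1 j h2 e
    · exact absurd e.symm (hno i h1)
    · exact absurd e (hno j h2)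
    · omega
  · rcases Nat.lt_or_ge i n with l | l
    · simpa [l.le, Nat.succ_le_of_lt l] using h.adj i l
    · simpa [show i = n by omega] using hx

theorem neighbor_last {n : ℕ} {a : ℕ → V} (h : H.IsPathSeq n a)
    (hmax : ∀ b, ¬ H.IsPathSeq (n + 1) b) (h3 : ∀ v, ¬ H.HasThree v) {x : V}
    (hx : H.Adj (a n) x) : ∃ j ≤ n, x = a j ∧ (j + 1 = n ∨ j = 0) := by
  obtain ⟨j, hj, rfl⟩ := h.exists_of_adj_last hmax hx
  refine ⟨j, hj, rfl, ?_⟩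
  by_contra! hne
  have hjn : j ≠ n := by rintro rfl; exact hx.ne rfl
  obtain ⟨i, rfl⟩ : ∃ i, j = i + 1 := ⟨j - 1, by omega⟩
  refine h3 (a (i + 1)) ⟨a i, a (i + 2), a n, fun e => ?_, fun e => ?_, fun e => ?_,
    (h.adj i (by omega)).symm, h.adj (i + 1) (by omega), hx.symm⟩
  · have := h.inj _ (by omega) _ (by omega) e; omega
  · have := h.inj _ (by omega) _ (by omega) e; omega
  · have := h.inj _ (by omega) _ (by omega) e; omega

/-- Inner vertices already have two neighbours on the path. An end has none outside it, by
maximality, and a chord to an inner vertex would create a branch vertex, so only the two ends may be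
joined. -/
theorem neighbor {n : ℕ} {a : ℕ → V} (h : H.IsPathSeq n a)
    (hmax : ∀ b, ¬ H.IsPathSeq (n + 1) b) (h3 : ∀ v, ¬ H.HasThree v) {i : ℕ} (hi : i ≤ n) {x : V}
    (hx : H.Adj (a i) x) : ∃ j ≤ n, x = a j ∧
      (i + 1 = j ∨ j + 1 = i ∨ (i = 0 ∧ j = n) ∨ (j = 0 ∧ i = n)) := by
  rcases hi.eq_or_lt with rfl | hin
  · obtain ⟨j, hj, e, k⟩ := h.neighbor_last hmax h3 hx
    exact ⟨j, hj, e, by omega⟩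
  rcases Nat.eq_zero_or_pos i with rfl | hi0
  · obtain ⟨j, hj, e, k⟩ := h.reverse.neighbor_last hmax h3 (x := x) (by simpa using hx)
    exact ⟨n - j, by omega, e, by omega⟩
  obtain ⟨k, rfl⟩ : ∃ k, i = k + 1 := ⟨i - 1, by omega⟩
  by_contra! hno
  refine h3 (a (k + 1)) ⟨a k, a (k + 2), x, fun e => ?_, fun e => ?_, fun e => ?_,
    (h.adj k (by omega)).symm, h.adj (k + 1) hin, hx⟩
  · have := h.inj _ (by omega) _ (by omega) e; omega
  · exact absurd rfl (hno k (by omega) e.symm).2.1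
  · exact absurd rfl (hno (k + 2) (by omega) e.symm).1

/-- The identification of a graph with a graph on `Fin (n + 1)` via an enumeration. -/
theorem exists_iso {n : ℕ} {a : ℕ → V} (h : H.IsPathSeq n a) (hsurj : ∀ v, ∃ i ≤ n, v = a i)
    {F : SimpleGraph (Fin (n + 1))}
    (hF : ∀ i j : Fin (n + 1), H.Adj (a i) (a j) ↔ F.Adj i j) : Nonempty (H ≃g F) := by
  let e : Fin (n + 1) ≃ V := Equiv.ofBijective (fun i => a i)
    ⟨fun i j e => Fin.ext (h.inj i (by omega) j (by omega) e), fun v => by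
      obtain ⟨i, hi, e⟩ := hsurj v
      exact ⟨⟨i, by omega⟩, e.symm⟩⟩
  exact ⟨(⟨e, fun {i j} => hF i j⟩ : F ≃g H).symm⟩

end IsPathSeq

theorem WordFree.isListedGraph_of_not_hasThree [Finite V] (hH : H.WordFree) (hc : H.Connected)
    (h3 : ∀ v, ¬ H.HasThree v) : IsListedGraph H := by
  have := hc.nonempty
  obtain ⟨n, a, ha, hmax⟩ := IsPathSeq.exists_maximal H
  have hsurj : ∀ v, ∃ i ≤ n, v = a i :=
    hc.preconnected.mem_of_adj_closed (S := {v | ∃ i ≤ n, v = a i}) ⟨0, Nat.zero_le _, rfl⟩ <| by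
      rintro _ ⟨i, hi, rfl⟩ w hw
      obtain ⟨j, hj, e, -⟩ := ha.neighbor hmax h3 hi hw
      exact ⟨j, hj, e⟩
  have hadj : ∀ i ≤ n, ∀ j ≤ n, H.Adj (a i) (a j) →
      (i + 1 = j ∨ j + 1 = i ∨ (i = 0 ∧ j = n) ∨ (j = 0 ∧ i = n)) := by
    intro i hi j hj e
    obtain ⟨k, hk, e', h⟩ := ha.neighbor hmax h3 hi e
    rwa [ha.inj j hj k hk e']
  -- The bound excludes a single edge, whose ends are adjacent without closing a cycle.
  by_cases hcyc : 2 ≤ n ∧ H.Adj (a 0) (a n)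
  · obtain ⟨hn, h0n⟩ := hcyc
    have hiff : ∀ i ≤ n, ∀ j ≤ n, H.Adj (a i) (a j) ↔
        (i + 1 = j ∨ j + 1 = i ∨ (i = 0 ∧ j = n) ∨ (j = 0 ∧ i = n)) := by
      refine fun i hi j hj => ⟨hadj i hi j hj, ?_⟩
      rintro (rfl | rfl | ⟨rfl, rfl⟩ | ⟨rfl, rfl⟩)
      · exact ha.adj i hj
      · exact (ha.adj j hi).symm
      · exact h0n
      · exact h0n.symm
    rcases Nat.even_or_odd (n + 1) with he | ho
    · exfalso
      obtain ⟨m, hm⟩ := he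
      refine hH.false_of_even_cycle (m := m) (by omega) a
        (fun i hi j hj => ha.inj i (by omega) j (by omega)) fun i hi j hj => ?_
      rw [hiff i (by omega) j (by omega)]
      omega
    · refine .inr (.inr (.inr (.inr (.inl ⟨n + 1, by omega, ho, ha.exists_iso hsurj ?_⟩))))
      intro i j
      rw [hiff i (by omega) j (by omega), cycleGraph_adj']
      rcases le_total i j with l | l
      · have h1 := Fin.coe_sub_iff_le.2 l
        rcases l.eq_or_lt with rfl | l'
        · rw [h1]; omega
        · have h2 := Fin.coe_sub_iff_lt.2 l'
          have := Fin.lt_def.1 l'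
          rw [h1, h2]; omega
      · have h1 := Fin.coe_sub_iff_le.2 l
        rcases l.eq_or_lt with rfl | l'
        · rw [h1]; omega
        · have h2 := Fin.coe_sub_iff_lt.2 l'
          have := Fin.lt_def.1 l'
          rw [h1, h2]; omega
  · refine .inr (.inl ⟨n + 1, by omega, ha.exists_iso hsurj fun i j => ?_⟩)
    rw [pathGraph_adj]
    constructor
    · intro e
      have hne : (i : ℕ) ≠ j := fun h => e.ne (by rw [h])
      rcases hadj i (by omega) j (by omega) e with h | h | ⟨h1, h2⟩ | ⟨h1, h2⟩
      · exact .inl h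
      · exact .inr h
      · rw [h1, h2] at e
        have : ¬ 2 ≤ n := fun h => hcyc ⟨h, e⟩
        omega
      · rw [h1, h2] at e
        have : ¬ 2 ≤ n := fun h => hcyc ⟨h, e.symm⟩
        omega
    · rintro (h | h)
      · rw [← h]; exact ha.adj i (by omega)
      · rw [← h]; exact (ha.adj j (by omega)).symm

end SimpleGraph

/-! ### One branch vertex: tripods of maximal total length -/

namespace SimpleGraph

variable {V : Type*} {H : SimpleGraph V}

/-- Three paths of positive lengths `ℓ i` with a common initial vertex, otherwise disjoint. -/
structure IsTripodSeq (H : SimpleGraph V) (ℓ : Fin 3 → ℕ) (a : Fin 3 → ℕ → V) : Prop where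
  pos : ∀ i, 0 < ℓ i
  zero : ∀ i j, a i 0 = a j 0
  adj : ∀ i k, k < ℓ i → H.Adj (a i k) (a i (k + 1))
  inj : ∀ i j k l, k ≤ ℓ i → l ≤ ℓ j → a i k = a j l → k = l ∧ (k = 0 ∨ i = j)

namespace IsTripodSeq

variable {ℓ : Fin 3 → ℕ} {a : Fin 3 → ℕ → V}

theorem comp_perm (h : H.IsTripodSeq ℓ a) (σ : Equiv.Perm (Fin 3)) :
    H.IsTripodSeq (ℓ ∘ σ) (a ∘ σ) where
  pos i := h.pos (σ i)
  zero i j := h.zero (σ i) (σ j)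
  adj i k hk := h.adj (σ i) k hk
  inj _ _ _ _ hk hl e := (h.inj _ _ _ _ hk hl e).imp id fun k => k.imp id fun e => σ.injective e

theorem of_hasThree {v : V} (h : H.HasThree v) : ∃ ℓ a, H.IsTripodSeq ℓ a := by
  obtain ⟨x, y, z, xy, xz, yz, hx, hy, hz⟩ := h
  have hadj : ∀ i, H.Adj v (![x, y, z] i) := by
    intro i; fin_cases i <;> assumption
  have hinj : ∀ i j, ![x, y, z] i = ![x, y, z] j → i = j := by
    intro i j e
    fin_cases i <;> fin_cases j <;> simp_all [eq_comm]
  refine ⟨fun _ => 1, fun i k => if k = 0 then v else ![x, y, z] i, fun _ => one_pos,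
    fun _ _ => rfl, fun i k hk => ?_, fun i j k l hk hl e => ?_⟩
  · simpa [show k = 0 by omega] using hadj i
  · replace hk : k = 0 ∨ k = 1 := by omega
    replace hl : l = 0 ∨ l = 1 := by omega
    rcases hk with rfl | rfl <;> rcases hl with rfl | rfl
    · exact ⟨rfl, .inl rfl⟩
    · exact absurd e (hadj j).ne
    · exact absurd e (hadj i).ne'
    · exact ⟨rfl, .inr (hinj i j e)⟩

theorem lt_card [Finite V] (h : H.IsTripodSeq ℓ a) (i : Fin 3) : ℓ i < Nat.card V :=
  lt_card_of_inj (a := a i) fun k hk l hl e => (h.inj i i k l hk hl e).1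

theorem exists_maximal [Finite V] {v : V} (hv : H.HasThree v) :
    ∃ ℓ a, H.IsTripodSeq ℓ a ∧ Monotone ℓ ∧
      ∀ ℓ' a', H.IsTripodSeq ℓ' a' → ∑ i, ℓ' i ≤ ∑ i, ℓ i := by
  obtain ⟨ℓ, a, h, hmax⟩ : ∃ ℓ a, H.IsTripodSeq ℓ a ∧
      ∀ ℓ' a', H.IsTripodSeq ℓ' a' → ∑ i, ℓ' i ≤ ∑ i, ℓ i := by
    by_contra! hno
    have all : ∀ n, ∃ ℓ a, H.IsTripodSeq ℓ a ∧ n ≤ ∑ i, ℓ i := by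
      intro n
      induction n with
      | zero =>
        obtain ⟨ℓ, a, h⟩ := of_hasThree hv
        exact ⟨ℓ, a, h, Nat.zero_le _⟩
      | succ n ih =>
        obtain ⟨ℓ, a, h, hn⟩ := ih
        obtain ⟨ℓ', a', h', hl⟩ := hno ℓ a h
        exact ⟨ℓ', a', h', by omega⟩
    obtain ⟨ℓ, a, h, hn⟩ := all (3 * Nat.card V)
    have := h.lt_card 0
    have := h.lt_card 1
    have := h.lt_card 2
    rw [Fin.sum_univ_three] at hn
    omega
  refine ⟨ℓ ∘ Tuple.sort ℓ, a ∘ Tuple.sort ℓ, h.comp_perm _, Tuple.monotone_sort ℓ,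
    fun ℓ' a' h' => (hmax ℓ' a' h').trans_eq ?_⟩
  exact (Equiv.sum_comp (Tuple.sort ℓ) ℓ).symm

theorem extend (h : H.IsTripodSeq ℓ a) {i : Fin 3} {x : V} (hx : H.Adj (a i (ℓ i)) x)
    (hno : ∀ j l, l ≤ ℓ j → x ≠ a j l) :
    H.IsTripodSeq (fun j => if j = i then ℓ i + 1 else ℓ j)
      (fun j k => if j = i ∧ ℓ i < k then x else a j k) where
  pos j := by
    have := h.pos j
    split_ifs <;> omega
  zero j k := by simpa using h.zero j k
  adj j k hk := by
    by_cases hj : j = i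
    · subst hj
      simp only [if_true, true_and] at hk ⊢
      rcases Nat.lt_or_ge k (ℓ j) with l | l
      · rw [if_neg (by omega), if_neg (by omega)]
        exact h.adj j k l
      · rw [if_neg (by omega), if_pos (by omega), show k = ℓ j by omega]
        exact hx
    · simp only [hj, if_false, false_and] at hk ⊢
      exact h.adj j k hk
  inj j j' k l hk hl e := by
    have key : ∀ j k, k ≤ (if j = i then ℓ i + 1 else ℓ j) → ¬ (j = i ∧ ℓ i < k) → k ≤ ℓ j := by
      intro j k h1 h2
      by_cases hj : j = i
      · subst hj; simp at h2; exact h2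
      · simpa [hj] using h1
    by_cases c1 : j = i ∧ ℓ i < k <;> by_cases c2 : j' = i ∧ ℓ i < l
    · obtain ⟨rfl, c1⟩ := c1
      obtain ⟨rfl, c2⟩ := c2
      simp only [if_true] at hk hl
      exact ⟨by omega, .inr rfl⟩
    · rw [if_pos c1, if_neg c2] at e
      exact absurd e (hno j' l (key j' l hl c2))
    · rw [if_neg c1, if_pos c2] at e
      exact absurd e.symm (hno j k (key j k hk c1))
    · rw [if_neg c1, if_neg c2] at e
      exact h.inj j j' k l (key j k hk c1) (key j' l hl c2) e

theorem first_ne (h : H.IsTripodSeq ℓ a) {i j : Fin 3} (hij : i ≠ j) : a i 1 ≠ a j 1 := fun e =>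
  ((h.inj i j 1 1 (h.pos i) (h.pos j) e).2.resolve_left one_ne_zero |> hij)

theorem adj_first (h : H.IsTripodSeq ℓ a) (i j : Fin 3) : H.Adj (a i 0) (a j 1) := by
  rw [h.zero i j]; exact h.adj j 0 (h.pos j)

theorem hasThree (h : H.IsTripodSeq ℓ a) : H.HasThree (a 0 0) :=
  ⟨a 0 1, a 1 1, a 2 1, h.first_ne (by decide), h.first_ne (by decide), h.first_ne (by decide),
    h.adj_first 0 0, h.adj_first 0 1, h.adj_first 0 2⟩

/-- The ends of two arms are not adjacent. -/
theorem not_adj_ends (h : H.IsTripodSeq ℓ a) (hH : H.WordFree)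
    (ht : ∀ v y z, H.Adj v y → H.Adj v z → ¬ H.Adj y z) {i j : Fin 3} (hij : i ≠ j) :
    ¬ H.Adj (a i (ℓ i)) (a j (ℓ j)) := by
  intro e
  obtain ⟨t, ti, tj⟩ : ∃ t : Fin 3, t ≠ i ∧ t ≠ j :=
    (by decide : ∀ i j : Fin 3, ∃ t, t ≠ i ∧ t ≠ j) i j
  have pi := h.pos i
  have pj := h.pos j
  -- The closed walk leaves the centre along arm `i`, crosses the supposed edge and returns along
  -- arm `j`. It never backtracks, and the third arm `t` completes the fork at both ends.
  obtain ⟨c, c1, c2⟩ : ∃ c : ℕ → V, (∀ k ≤ ℓ i, c k = a i k) ∧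
      ∀ k ≤ ℓ j, c (ℓ i + ℓ j + 1 - k) = a j k :=
    ⟨fun k => if k ≤ ℓ i then a i k else a j (ℓ i + ℓ j + 1 - k), fun k hk => by simp [hk],
      fun k hk => by
        simp only
        rw [if_neg (by omega)]; congr 1; omega⟩
  have cm : c (ℓ i + ℓ j + 1) = a j 0 := c2 0 (Nat.zero_le _)
  have cm' : c (ℓ i + ℓ j + 1 - 1) = a j 1 := c2 1 pj
  have c3 : ∀ k, ℓ i < k → k ≤ ℓ i + ℓ j + 1 → c k = a j (ℓ i + ℓ j + 1 - k) := by
    intro k h1 h2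
    rw [← c2 _ (by omega)]; congr 1; omega
  refine hH.false_of_forks (ℓ i + ℓ j + 1) c (fun k hk => ?_) (fun k hk => ?_)
    (x := a j 1) (y := a t 1) (z := a i 1) (w := a t 1) (h.first_ne tj.symm)
    (ht _ _ _ (h.adj_first i j) (h.adj_first i t)) ?_ ?_ (h.first_ne ti.symm)
    (ht _ _ _ (h.adj_first i i) (h.adj_first i t)) ?_ ?_ (fun _ => ?_) (fun h => by omega)
  · rcases Nat.lt_or_ge k (ℓ i) with l | l
    · rw [c1 k l.le, c1 (k + 1) l]; exact h.adj i k l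
    rcases l.eq_or_lt with rfl | l
    · rw [c1 _ le_rfl, c3 _ (by omega) (by omega),
        show ℓ i + ℓ j + 1 - (ℓ i + 1) = ℓ j by omega]
      exact e
    · rw [c3 k l (by omega), c3 (k + 1) (by omega) (by omega)]
      have := (h.adj j (ℓ i + ℓ j + 1 - (k + 1)) (by omega)).symm
      rwa [show ℓ i + ℓ j + 1 - (k + 1) + 1 = ℓ i + ℓ j + 1 - k by omega] at this
  · intro e'
    rcases Nat.lt_or_ge (ℓ i) k with l | l
    · rw [c3 k l (by omega), c3 _ (by omega) (by omega)] at e'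
      have := h.inj _ _ _ _ (by omega) (by omega) e'
      omega
    rcases Nat.lt_or_ge (ℓ i) (k + 2) with l' | l'
    · rw [c1 k l, c3 _ l' (by omega)] at e'
      have := h.inj _ _ _ _ l (by omega) e'
      omega
    · rw [c1 k l, c1 _ l'] at e'
      have := h.inj _ _ _ _ l l' e'
      omega
  · rw [c1 0 (Nat.zero_le _)]; exact h.adj_first i j
  · rw [c1 0 (Nat.zero_le _)]; exact h.adj_first i t
  · rw [cm]; exact h.adj_first j i
  · rw [cm]; exact h.adj_first j t
  · rw [c1 1 pi, cm']
    exact ⟨h.first_ne hij.symm, h.first_ne ti, h.first_ne hij, h.first_ne tj⟩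

theorem eq_of_adj_center (h : H.IsTripodSeq ℓ a) (hH : H.WordFree)
    (ht : ∀ v y z, H.Adj v y → H.Adj v z → ¬ H.Adj y z) {i : Fin 3} {x : V}
    (hx : H.Adj (a i 0) x) : ∃ j, x = a j 1 := by
  rcases hH.eq_of_adj_of_hasThree ht (h.adj_first i 0) (h.adj_first i 1) (h.adj_first i 2)
    (h.first_ne (by decide)) (h.first_ne (by decide)) (h.first_ne (by decide)) hx with e | e | e
  exacts [⟨0, e⟩, ⟨1, e⟩, ⟨2, e⟩]

theorem eq_of_adj_interior (h : H.IsTripodSeq ℓ a)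
    (hu : ∀ u v, H.HasThree u → H.HasThree v → u = v) {i : Fin 3} {k : ℕ} (hk : k + 1 < ℓ i) {x : V}
    (hx : H.Adj (a i (k + 1)) x) : x = a i k ∨ x = a i (k + 2) := by
  by_contra! hne
  have h3 : H.HasThree (a i (k + 1)) := ⟨a i k, a i (k + 2), x, fun e => by
    have := h.inj _ _ _ _ (by omega) (by omega) e
    omega, hne.1.symm, hne.2.symm, (h.adj i k (by omega)).symm, h.adj i (k + 1) hk, hx⟩
  have := h.inj _ _ _ _ hk.le (Nat.zero_le _) (hu _ _ h3 h.hasThree)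
  omega

/-- Inner vertices of an arm are not branch vertices. At the end, maximality keeps the neighbour `x`
on the tripod; if `x` is the centre or an inner vertex, its known neighbours place it just before
the end, and `not_adj_ends` excludes the end of another arm. -/
theorem eq_of_adj_arm (h : H.IsTripodSeq ℓ a) (hH : H.WordFree)
    (ht : ∀ v y z, H.Adj v y → H.Adj v z → ¬ H.Adj y z)
    (hu : ∀ u v, H.HasThree u → H.HasThree v → u = v)
    (hmax : ∀ ℓ' a', H.IsTripodSeq ℓ' a' → ∑ i, ℓ' i ≤ ∑ i, ℓ i) {i : Fin 3} {k : ℕ}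
    (hk : k + 1 ≤ ℓ i) {x : V} (hx : H.Adj (a i (k + 1)) x) :
    x = a i k ∨ (k + 1 < ℓ i ∧ x = a i (k + 2)) := by
  rcases hk.lt_or_eq with hlt | hl
  · exact (h.eq_of_adj_interior hu hlt hx).imp id fun e => ⟨hlt, e⟩
  left
  obtain ⟨j, l, hj, rfl⟩ : ∃ j l, l ≤ ℓ j ∧ x = a j l := by
    by_contra! hno
    have := hmax _ _ (h.extend (i := i) (hl ▸ hx) hno)
    rw [Fin.sum_univ_three, Fin.sum_univ_three] at this
    have hi : i = 0 ∨ i = 1 ∨ i = 2 := (by decide : ∀ i : Fin 3, i = 0 ∨ i = 1 ∨ i = 2) i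
    rcases hi with rfl | rfl | rfl <;> simp at this
  rcases Nat.eq_zero_or_pos l with rfl | hl0
  · obtain ⟨t, e⟩ := h.eq_of_adj_center hH ht hx.symm
    have := h.inj _ _ _ _ hk (h.pos t) e
    rw [show k = 0 by omega]
    exact h.zero _ _
  obtain ⟨m, rfl⟩ : ∃ m, l = m + 1 := ⟨l - 1, by omega⟩
  rcases hj.lt_or_eq with hlt | hj
  · rcases h.eq_of_adj_interior hu hlt hx.symm with e | e
    · obtain ⟨e1, e2⟩ := h.inj _ _ _ _ hk (by omega) e
      obtain rfl := e2.resolve_left (by omega)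
      omega
    · obtain ⟨e1, e2⟩ := h.inj _ _ _ _ hk (by omega) e
      obtain rfl := e2.resolve_left (by omega)
      congr 1; omega
  · exfalso
    have hij : i ≠ j := by
      rintro rfl
      exact hx.ne (by congr 1; omega)
    refine h.not_adj_ends hH ht hij ?_
    rwa [← hl, ← hj]

theorem exists_eq (h : H.IsTripodSeq ℓ a) (hcen : ∀ i x, H.Adj (a i 0) x → ∃ j, x = a j 1)
    (harm : ∀ i k x, k + 1 ≤ ℓ i → H.Adj (a i (k + 1)) x →
      x = a i k ∨ (k + 1 < ℓ i ∧ x = a i (k + 2)))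
    (hc : H.Preconnected) (v : V) : ∃ i k, k ≤ ℓ i ∧ v = a i k := by
  refine hc.mem_of_adj_closed (S := {v | ∃ i k, k ≤ ℓ i ∧ v = a i k}) (v₀ := a 0 0)
    ⟨0, 0, Nat.zero_le _, rfl⟩ ?_ v
  rintro _ ⟨i, k, hk, rfl⟩ w hw
  cases k with
  | zero =>
    obtain ⟨j, e⟩ := hcen i w hw
    exact ⟨j, 1, h.pos j, e⟩
  | succ k =>
    rcases harm i k w hk hw with e | ⟨h1, e⟩
    · exact ⟨i, k, by omega, e⟩
    · exact ⟨i, k + 2, h1, e⟩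

/-- The conditions `hp0` and `hq0` make `(0, 0)` the only name of the centre, as `armsRelation`
presupposes. -/
theorem rel_iff (h : H.IsTripodSeq ℓ a) (hcen : ∀ i x, H.Adj (a i 0) x → ∃ j, x = a j 1)
    (harm : ∀ i k x, k + 1 ≤ ℓ i → H.Adj (a i (k + 1)) x →
      x = a i k ∨ (k + 1 < ℓ i ∧ x = a i (k + 2)))
    {p q : Fin 3 × ℕ} (hp : p.2 ≤ ℓ p.1) (hq : q.2 ≤ ℓ q.1) (hp0 : p.2 = 0 → p.1 = 0)
    (hq0 : q.2 = 0 → q.1 = 0) :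
    (ConcurrencyRelation.ofGraph H).rel (a p.1 p.2) (a q.1 q.2) ↔ armsRelation.rel p q := by
  obtain ⟨i, k⟩ := p
  obtain ⟨j, l⟩ := q
  dsimp only at *
  constructor
  · rintro (e | e)
    · obtain ⟨rfl, e'⟩ := h.inj _ _ _ _ hp hq e
      rcases e' with rfl | rfl
      · exact .inl (by rw [hp0 rfl, hq0 rfl])
      · exact .inl rfl
    · cases k with
      | zero =>
        obtain ⟨t, e⟩ := hcen i _ e
        obtain ⟨rfl, -⟩ := h.inj _ _ _ _ hq (h.pos t) e
        exact .inr (.inr (.inl ⟨rfl, rfl⟩))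
      | succ k =>
        rcases harm i k _ hp e with e | ⟨h1, e⟩
        · obtain ⟨rfl, e'⟩ := h.inj _ _ _ _ hq (by omega) e
          rcases e' with rfl | rfl
          · exact .inr (.inr (.inr ⟨rfl, rfl⟩))
          · exact .inr (.inl ⟨rfl, .inr rfl⟩)
        · obtain ⟨rfl, e'⟩ := h.inj _ _ _ _ hq h1 e
          obtain rfl := e'.resolve_left (by omega)
          exact .inr (.inl ⟨rfl, .inl rfl⟩)
  · rintro (e | ⟨e, h1 | h1⟩ | ⟨h1, h2⟩ | ⟨h1, h2⟩)
    · obtain ⟨rfl, rfl⟩ := Prod.mk.inj e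
      exact .inl rfl
    · dsimp only at e h1
      subst e h1
      exact .inr (h.adj _ _ hq)
    · dsimp only at e h1
      subst e h1
      exact .inr (h.adj _ _ hp).symm
    · dsimp only at h1 h2
      subst h1 h2
      exact .inr (h.adj_first i j)
    · dsimp only at h1 h2
      subst h1 h2
      exact .inr (h.adj_first j i).symm

theorem false_of_word (h : H.IsTripodSeq ℓ a) (hcen : ∀ i x, H.Adj (a i 0) x → ∃ j, x = a j 1)
    (harm : ∀ i k x, k + 1 ≤ ℓ i → H.Adj (a i (k + 1)) x →
      x = a i k ∨ (k + 1 < ℓ i ∧ x = a i (k + 2)))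
    (hH : H.WordFree) {n : ℕ} {w : Fin n → Fin 3 × ℕ}
    (hw : IsIrreducibleWord armsRelation w) (hle : ∀ i, (w i).2 ≤ ℓ (w i).1)
    (h0 : ∀ i, (w i).2 = 0 → (w i).1 = 0) : False :=
  hH n (fun i => a (w i).1 (w i).2) <| hw.transfer
    (fun i j e => by
      obtain ⟨e1, e2⟩ := h.inj _ _ _ _ (hle i) (hle j) e
      refine Prod.ext (e2.elim (fun k => ?_) id) e1
      rw [h0 i k, h0 j (e1 ▸ k)])
    fun i j => h.rel_iff hcen harm (hle i) (hle j) (h0 i) (h0 j)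

theorem exists_iso (h : H.IsTripodSeq ℓ a) (hcen : ∀ i x, H.Adj (a i 0) x → ∃ j, x = a j 1)
    (harm : ∀ i k x, k + 1 ≤ ℓ i → H.Adj (a i (k + 1)) x →
      x = a i k ∨ (k + 1 < ℓ i ∧ x = a i (k + 2)))
    (hc : H.Preconnected) : Nonempty (H ≃g tripodGraph ℓ) := by
  let f : Option (Σ i : Fin 3, Fin (ℓ i)) → V := fun v =>
    match v with
    | none => a 0 0
    | some ⟨i, k⟩ => a i (k + 1)
  have hf : ∀ i k, k ≤ ℓ i → f (TripodGraph.vertex ℓ i k) = a i k := by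
    intro i k hk
    cases k with
    | zero => exact h.zero 0 i
    | succ k => rw [TripodGraph.vertex_succ hk]
  have finj : Function.Injective f := by
    intro x y e
    rcases x with _ | ⟨i, k⟩ <;> rcases y with _ | ⟨j, l⟩
    · rfl
    · have := h.inj 0 j 0 (l + 1) (Nat.zero_le _) l.2 e
      omega
    · have := h.inj i 0 (k + 1) 0 k.2 (Nat.zero_le _) e
      omega
    · obtain ⟨e1, e2⟩ := h.inj i j (k + 1) (l + 1) k.2 l.2 e
      obtain rfl := e2.resolve_left (by omega)
      rw [Fin.ext (Nat.succ_injective e1)]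
  have fsurj : Function.Surjective f := by
    intro v
    obtain ⟨i, k, hk, e⟩ := h.exists_eq hcen harm hc v
    exact ⟨_, (hf i k hk).trans e.symm⟩
  refine ⟨(⟨Equiv.ofBijective f ⟨finj, fsurj⟩, fun {x y} => ?_⟩ : tripodGraph ℓ ≃g H).symm⟩
  change H.Adj (f x) (f y) ↔ (tripodGraph ℓ).Adj x y
  obtain ⟨i, k, hk, rfl⟩ := TripodGraph.exists_vertex x
  constructor
  · intro e
    rw [hf i k hk] at e
    cases k with
    | zero =>
      obtain ⟨j, e⟩ := hcen i _ e
      rw [← hf j 1 (h.pos j)] at e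
      rw [finj e]
      exact TripodGraph.adj_vertex (h.pos j)
    | succ k =>
      rcases harm i k _ hk e with e | ⟨h1, e⟩
      · rw [← hf i k (by omega)] at e
        rw [finj e]
        exact (TripodGraph.adj_vertex hk).symm
      · rw [← hf i (k + 2) h1] at e
        rw [finj e]
        exact TripodGraph.adj_vertex h1
  · intro e
    rw [hf i k hk]
    cases k with
    | zero =>
      obtain ⟨j, -, rfl⟩ := TripodGraph.eq_of_adj_none e
      rw [hf j 1 (h.pos j)]
      exact h.adj_first i j
    | succ k =>
      rcases TripodGraph.eq_of_adj_vertex hk e with rfl | ⟨h1, rfl⟩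
      · rw [hf i k (by omega)]
        exact (h.adj i k hk).symm
      · rw [hf i (k + 2) h1]
        exact h.adj i (k + 1) h1

end IsTripodSeq

/-! ### Classification of connected word-free graphs -/

theorem WordFree.isListedGraph_of_hasThree [Finite V] (hH : H.WordFree) (hc : H.Connected)
    (ht : ∀ v y z, H.Adj v y → H.Adj v z → ¬ H.Adj y z) {v : V} (hv : H.HasThree v) :
    IsListedGraph H := by
  obtain ⟨ℓ, a, h, hmono, hmax⟩ := IsTripodSeq.exists_maximal hv
  have hu : ∀ u v, H.HasThree u → H.HasThree v → u = v := fun u v =>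
    hH.eq_of_hasThree hc.preconnected ht
  have hcen : ∀ i x, H.Adj (a i 0) x → ∃ j, x = a j 1 := fun i x => h.eq_of_adj_center hH ht
  have harm : ∀ i k x, k + 1 ≤ ℓ i → H.Adj (a i (k + 1)) x →
      x = a i k ∨ (k + 1 < ℓ i ∧ x = a i (k + 2)) := fun i k x hk =>
    h.eq_of_adj_arm hH ht hu hmax hk
  have hiso := h.exists_iso hcen harm hc.preconnected
  have m1 : ℓ 0 ≤ ℓ 1 := hmono (by decide)
  have m2 : ℓ 1 ≤ ℓ 2 := hmono (by decide)
  have p0 := h.pos 0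
  have eta : ∀ p q r, ℓ 0 = p → ℓ 1 = q → ℓ 2 = r → ℓ = ![p, q, r] := by
    rintro p q r rfl rfl rfl
    ext i; fin_cases i <;> rfl
  have hle : ∀ L : Fin 3 → ℕ, L 0 ≤ ℓ 0 → L 1 ≤ ℓ 1 → L 2 ≤ ℓ 2 → ∀ i, L i ≤ ℓ i := by
    intro L h0 h1 h2 i
    fin_cases i <;> assumption
  by_cases h133 : 3 ≤ ℓ 1
  · exact (h.false_of_word hcen harm hH isIrreducibleWord_oneThreeThree
      (fun i => ((by decide : ∀ i, (wordOneThreeThree i).2 ≤ ![1, 3, 3] (wordOneThreeThree i).1)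
        i).trans (hle _ p0 h133 (h133.trans m2) _)) (by decide)).elim
  by_cases h223 : 2 ≤ ℓ 0 ∧ 3 ≤ ℓ 2
  · exact (h.false_of_word hcen harm hH isIrreducibleWord_twoTwoThree
      (fun i => ((by decide : ∀ i, (wordTwoTwoThree i).2 ≤ ![2, 2, 3] (wordTwoTwoThree i).1)
        i).trans (hle _ h223.1 (h223.1.trans m1) h223.2 _)) (by decide)).elim
  -- The sorted lengths that remain are `2, 2, 2`, then `1, 2, r` and `1, 1, r`.
  rcases Nat.lt_or_ge 1 (ℓ 0) with l | l
  · have := eta 2 2 2 (by omega) (by omega) (by omega)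
    subst this
    exact .inr (.inr (.inr (.inr (.inr hiso))))
  rcases Nat.lt_or_ge 1 (ℓ 1) with l' | l'
  · have := eta 1 2 (ℓ 2 + 4 - 4) (by omega) (by omega) (by omega)
    exact .inr (.inr (.inr (.inl ⟨ℓ 2 + 4, by omega, by rw [graphE, ← this]; exact hiso⟩)))
  · have := eta 1 1 (ℓ 2 + 3 - 3) (by omega) (by omega) (by omega)
    exact .inr (.inr (.inl ⟨ℓ 2 + 3, by omega, by rw [graphD, ← this]; exact hiso⟩))

theorem WordFree.isListedGraph [Finite V] (hH : H.WordFree) (hc : H.Connected) :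
    IsListedGraph H := by
  have := hc.nonempty
  by_cases ht : ∀ v y z, H.Adj v y → H.Adj v z → ¬ H.Adj y z
  · by_cases h3 : ∃ v, H.HasThree v
    · obtain ⟨v, hv⟩ := h3
      exact hH.isListedGraph_of_hasThree hc ht hv
    · push Not at h3
      exact hH.isListedGraph_of_not_hasThree hc h3
  · push Not at ht
    obtain ⟨v, y, z, vy, vz, yz⟩ := ht
    refine .inl ⟨Nat.card V, Nat.card_pos, ⟨⟨Finite.equivFin V, fun {u w} => ?_⟩⟩⟩
    rw [top_adj, (Finite.equivFin V).injective.ne_iff]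
    exact ⟨hH.adj_of_ne_of_triangle hc.preconnected vy vz yz, fun h => h.ne⟩

end SimpleGraph

theorem theorem1p5p2 {P : Type*} [Finite P] (C : ConcurrencyRelation P) :
    IsRegularClass C ↔
      ∀ K : C.graph.ConnectedComponent, IsListedGraph K.toSimpleGraph :=
  ⟨fun h K => (h.wordFree K).isListedGraph K.connected_toSimpleGraph,
    LabelledHeap.isRegularClass_of_isListedGraph⟩
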